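/- Let $k>\frac12$ and $n\ge 0$. For $R,\eta>0$ put $S^k_{R,\eta}=\{z\in\mathbb C : 0<|z|<R,\ |\arg z|<\frac{\pi}{2k}+\eta\}$. A function $f$ that is holomorphic on $S^k_{R,\eta}$, continuous on its closure, and has an asymptotic expansion $\hat f=\sum_p a_pz^p\in\mathbb C[[z]]$ at $0$ (for every proper subsector $S'$ and every $m\in\mathbb N$ there is $C$ with $|f(z)-\sum_{p<m}a_pz^p|\le C|z|^m$ on $S'$) is called Gevrey of order $k$ if for every proper subsector $S'$ there are $C,M>0$ such that $\sup_{z\in S'}|f^{(m)}(z)/m!|\le CM^m(m!)^{1/k}$ for all $m\in\mathbb N$. Let $\mathcal G_k$ be the ring of germs of such functions (the inductive limit as $R,\eta\to0$). Put $D_m=\{|z|<\frac12(m+1)^{-1/k}\}$. For $\alpha=(R,\rho,k,\eta)$ with $R,\eta>0$ and $0<\rho<1$, and for $g\in\mathcal G_k$, let $$\|g\|_\alpha=\inf\ \sum_{m\ge0}\rho^{-m}\sup_{D_m\cup S^k_{R,\eta}}|f_m| ,$$ the infimum being over all sequences of holomorphic functions $f_m$ on $D_m\cup S^k_{R,\eta}$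 such that $g$ is the germ of $\sum_m f_m$ with the series converging on $S^k_{R,\eta}$ (and $\|g\|_\alpha=\infty$ if there is no such sequence with a finite sum). Let $\mathcal G_k\{y\}=\mathcal G_k\{y_1,\dots,y_n\}$ be the ring of all series $f=\sum_{\omega\in\mathbb N^n}f_\omega(z)y^\omega$ with $f_\omega\in\mathcal G_k$ for which $\sum_\omega\|f_\omega\|_\alpha\,\mu^{|\omega|}<\infty$ for some such $\alpha$ and some $\mu>0$. Then $\mathcal G_k\{y\}$ is a pseudo-geometric ring: it is Noetherian, and for every prime ideal $\mathcal P$ of $\mathcal G_k\{y\}$, every integral domain $B$ that contains $\mathcal G_k\{y\}/\mathcal P$, is integral over it, and whose quotient field is finite over the quotient field of $\mathcal G_k\{y\}/\mathcal P$, is a finite module over $\mathcal G_k\{y\}/\mathcal P$. -/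

import Mathlib

open scoped ENNReal

/-- The open sector `{z ∈ ℂ ; 0 < |z| < r, θ₀ < arg z < θ₁}`. -/
def sector (r θ₀ θ₁ : ℝ) : Set ℂ :=
  {z | 0 < ‖z‖ ∧ ‖z‖ < r ∧ θ₀ < z.arg ∧ z.arg < θ₁}

/-- The sector `S^k_{R,η} = {z ; 0 < |z| < R, |arg z| < π/(2k) + η}`. -/
def gevreySector (k R η : ℝ) : Set ℂ :=
  sector R (-(Real.pi / (2 * k) + η)) (Real.pi / (2 * k) + η)

/-- `T` is a (proper) subsector of `S^k_{R,η}`: smaller radius, smaller opening. -/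
def IsSubsector (k R η : ℝ) (T : Set ℂ) : Prop :=
  ∃ r θ₀ θ₁ : ℝ, r < R ∧ -(Real.pi / (2 * k) + η) < θ₀ ∧ θ₁ < Real.pi / (2 * k) + η ∧
    T = sector r θ₀ θ₁

/-- `f` is holomorphic on `S^k_{R,η}`, continuous on the closed sector, has an asymptotic
expansion `a ∈ ℂ⟦z⟧` at `0`, and is Gevrey of order `k`: on every subsector
`|f⁽ⁿ⁾(z) / n!| ≤ C Mⁿ (n!)^{1/k}` for all `n`. -/
structure IsGevrey (k R η : ℝ) (f : ℂ → ℂ) : Prop where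
  holo : DifferentiableOn ℂ f (gevreySector k R η)
  cont : ContinuousOn f (closure (gevreySector k R η))
  expansion : ∃ a : PowerSeries ℂ, ∀ T, IsSubsector k R η T → ∀ n : ℕ, ∃ C : ℝ, ∀ z ∈ T,
    ‖f z - ∑ p ∈ Finset.range n, PowerSeries.coeff p a * z ^ p‖ ≤ C * ‖z‖ ^ n
  gevrey : ∀ T, IsSubsector k R η T → ∃ C M : ℝ, 0 < C ∧ 0 < M ∧ ∀ n : ℕ, ∀ z ∈ T,
    ‖iteratedDeriv n f z / (n.factorial : ℂ)‖ ≤ C * M ^ n * (n.factorial : ℝ) ^ (1 / k)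

/-- The filter of the sectors `S^k_{R,η}` as `R, η > 0` shrink. -/
def sectorFilter (k : ℝ) : Filter ℂ :=
  ⨅ (R : ℝ) (_ : 0 < R) (η : ℝ) (_ : 0 < η), Filter.principal (gevreySector k R η)

/-- Germs of functions on the sectors `S^k_{R,η}`, that is, functions up to equality on a smaller
sector of this family. -/
abbrev SectorGerm (k : ℝ) : Type := Filter.Germ (sectorFilter k) ℂ

/-- The disc `D_n = {z ; |z| < (n+1)^{-1/k} / 2}` together with the sector `S^k_{R,η}`. -/
def discSector (k R η : ℝ) (n : ℕ) : Set ℂ :=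
  Metric.ball 0 (((n : ℝ) + 1) ^ (-(1 / k)) / 2) ∪ gevreySector k R η

/-- `(f_n)` represents the germ `g`: each `f_n` is holomorphic on `D_n ∪ S^k_{R,η}` and
`g` is the germ of a function which is `∑ f_n` on `S^k_{R,η}`. -/
def IsRep (k R η : ℝ) (f : ℕ → ℂ → ℂ) (g : SectorGerm k) : Prop :=
  (∀ n, DifferentiableOn ℂ (f n) (discSector k R η n)) ∧
  ∃ F : ℂ → ℂ, (F : SectorGerm k) = g ∧
    ∀ z ∈ gevreySector k R η, HasSum (fun n => f n z) (F z)

/-- `∑_n ‖f_n‖ ρ^{-n}`, with `‖f_n‖` the supremum of `|f_n|` on `D_n ∪ S^k_{R,η}`. -/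
noncomputable def repNorm (k R η ρ : ℝ) (f : ℕ → ℂ → ℂ) : ℝ≥0∞ :=
  ∑' n : ℕ, (⨆ z ∈ discSector k R η n, ‖f n z‖ₑ) * ENNReal.ofReal (ρ⁻¹) ^ n

/-- `‖g‖_α` for `α = (R, ρ, k, η)`: the infimum of `∑_n ‖f_n‖ ρ^{-n}` over the representations
of `g` (`∞` if there is none with a finite sum; a finite sum forces `‖f_n‖ ≤ c ρⁿ`). -/
noncomputable def gevreyNorm (k R η ρ : ℝ) (g : SectorGerm k) : ℝ≥0∞ :=
  ⨅ (f : ℕ → ℂ → ℂ) (_ : IsRep k R η f g), repNorm k R η ρ f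

section helpers

lemma sector_mono {r r' a a' b b' : ℝ} (hr : r ≤ r') (ha : a' ≤ a) (hb : b ≤ b') :
    sector r a b ⊆ sector r' a' b' := fun _ hz =>
  ⟨hz.1, hz.2.1.trans_le hr, ha.trans_lt hz.2.2.1, hz.2.2.2.trans_le hb⟩

lemma gevreySector_mono {k R R' η η' : ℝ} (hR : R ≤ R') (hη : η ≤ η') :
    gevreySector k R η ⊆ gevreySector k R' η' :=
  sector_mono hR (by linarith) (by linarith)

lemma discSector_mono {k R R' η η' : ℝ} (hR : R ≤ R') (hη : η ≤ η') (n : ℕ) :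
    discSector k R η n ⊆ discSector k R' η' n :=
  Set.union_subset_union_right _ (gevreySector_mono hR hη)

lemma discSector_anti {k : ℝ} (hk : 1 / 2 < k) (R η : ℝ) {m n : ℕ} (h : m ≤ n) :
    discSector k R η n ⊆ discSector k R η m := by
  refine Set.union_subset_union_left _ (Metric.ball_subset_ball ?_)
  have hk0 : 0 < 1 / k := by
    have : 0 < k := by linarith
    positivity
  have := Real.rpow_le_rpow_of_nonpos (x := (m : ℝ) + 1) (y := (n : ℝ) + 1) (z := -(1 / k))
    (by positivity) (by gcongr) (by linarith)
  linarith

lemma isOpen_gevreySector (k R η : ℝ) : IsOpen (gevreySector k R η) := by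
  have key : IsOpen {z : ℂ | z ≠ 0 ∧ |z.arg| < Real.pi / (2 * k) + η} := by
    rcases lt_or_ge Real.pi (Real.pi / (2 * k) + η) with h | h
    · have : {z : ℂ | z ≠ 0 ∧ |z.arg| < Real.pi / (2 * k) + η} = {z : ℂ | z ≠ 0} := by
        ext z
        simp only [Set.mem_ofPred_eq, and_iff_left_iff_imp]
        exact fun _ => (Complex.abs_arg_le_pi z).trans_lt h
      rw [this]
      exact isOpen_ne
    · have : {z : ℂ | z ≠ 0 ∧ |z.arg| < Real.pi / (2 * k) + η} =
          Complex.slitPlane ∩ (fun z : ℂ => |z.arg|) ⁻¹' Set.Iio (Real.pi / (2 * k) + η) := by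
        ext z
        simp only [Set.mem_ofPred_eq, Set.mem_inter_iff, Set.mem_preimage, Set.mem_Iio,
          Complex.mem_slitPlane_iff_arg]
        constructor
        · rintro ⟨h0, h1⟩
          refine ⟨⟨fun hz => ?_, h0⟩, h1⟩
          rw [hz, abs_of_pos Real.pi_pos] at h1
          linarith
        · rintro ⟨⟨_, h0⟩, h1⟩
          exact ⟨h0, h1⟩
      rw [this]
      refine ContinuousOn.isOpen_inter_preimage ?_ Complex.isOpen_slitPlane isOpen_Iio
      exact (fun z hz => (Complex.continuousAt_arg hz).continuousWithinAt.abs)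
  have : gevreySector k R η =
      {z : ℂ | z ≠ 0 ∧ |z.arg| < Real.pi / (2 * k) + η} ∩ {z | ‖z‖ < R} := by
    ext z
    simp only [gevreySector, sector, Set.mem_ofPred_eq, Set.mem_inter_iff, norm_pos_iff, abs_lt]
    tauto
  rw [this]
  exact key.inter (isOpen_lt continuous_norm continuous_const)

lemma IsSubsector.subset {k R η : ℝ} {T : Set ℂ} (h : IsSubsector k R η T) :
    T ⊆ gevreySector k R η := by
  obtain ⟨r, a, b, hr, ha, hb, rfl⟩ := h
  exact sector_mono hr.le ha.le hb.le

lemma IsSubsector.norm_le {k R η : ℝ} {T : Set ℂ} (h : IsSubsector k R η T) {z : ℂ}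
    (hz : z ∈ T) : ‖z‖ ≤ R :=
  (h.subset hz).2.1.le

lemma IsSubsector.mono {k R R' η η' : ℝ} {T : Set ℂ} (h : IsSubsector k R η T)
    (hR : R ≤ R') (hη : η ≤ η') : IsSubsector k R' η' T := by
  obtain ⟨r, a, b, hr, ha, hb, rfl⟩ := h
  exact ⟨r, a, b, by linarith, by linarith, by linarith, rfl⟩

lemma mem_sectorFilter {k R η : ℝ} (hR : 0 < R) (hη : 0 < η) :
    gevreySector k R η ∈ sectorFilter k :=
  Filter.mem_iInf_of_mem R <| Filter.mem_iInf_of_mem hR <| Filter.mem_iInf_of_mem η <|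
    Filter.mem_iInf_of_mem hη (Filter.mem_principal_self _)

namespace IsGevrey

variable {k R R' η η' : ℝ} {f g : ℂ → ℂ}

lemma mono (hf : IsGevrey k R' η' f) (hR : R ≤ R') (hη : η ≤ η') : IsGevrey k R η f where
  holo := hf.holo.mono (gevreySector_mono hR hη)
  cont := hf.cont.mono (closure_mono (gevreySector_mono hR hη))
  expansion := by
    obtain ⟨a, ha⟩ := hf.expansion
    exact ⟨a, fun T hT => ha T (hT.mono hR hη)⟩
  gevrey := fun T hT => hf.gevrey T (hT.mono hR hη)

lemma contDiffAt (hf : IsGevrey k R η f) {z : ℂ} (hz : z ∈ gevreySector k R η) (n : WithTop ℕ∞) :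
    ContDiffAt ℂ n f z :=
  (hf.holo.analyticAt ((isOpen_gevreySector k R η).mem_nhds hz)).contDiffAt

lemma const (k R η : ℝ) (c : ℂ) : IsGevrey k R η (fun _ => c) where
  holo := differentiableOn_const c
  cont := continuousOn_const
  expansion := by
    refine ⟨PowerSeries.C c, fun T _ n => ?_⟩
    rcases n with _ | n
    · exact ⟨‖c‖, fun z _ => by simp⟩
    · refine ⟨0, fun z _ => ?_⟩
      rw [Finset.sum_eq_single 0]
      · simp
      · intro p _ hp
        simp [PowerSeries.coeff_C, hp]
      · simp
  gevrey := by
    refine fun T _ => ⟨‖c‖ + 1, 1, by positivity, one_pos, fun n z _ => ?_⟩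
    rcases n with _ | n
    · simp
    · rw [iteratedDeriv_const]
      simp only [Nat.succ_ne_zero, if_false, zero_div, norm_zero]
      positivity

lemma neg (hf : IsGevrey k R η f) : IsGevrey k R η (-f) where
  holo := hf.holo.neg
  cont := hf.cont.neg
  expansion := by
    obtain ⟨a, ha⟩ := hf.expansion
    refine ⟨-a, fun T hT n => ?_⟩
    obtain ⟨C, hC⟩ := ha T hT n
    refine ⟨C, fun z hz => ?_⟩
    rw [← norm_neg]
    have e : -((-f) z - ∑ p ∈ Finset.range n, PowerSeries.coeff p (-a) * z ^ p) =
        f z - ∑ p ∈ Finset.range n, PowerSeries.coeff p a * z ^ p := by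
      simp only [map_neg, neg_mul, Finset.sum_neg_distrib, Pi.neg_apply]
      ring
    rw [e]
    exact hC z hz
  gevrey := by
    intro T hT
    obtain ⟨C, M, hC, hM, h⟩ := hf.gevrey T hT
    refine ⟨C, M, hC, hM, fun n z hz => ?_⟩
    rw [iteratedDeriv_neg, neg_div, norm_neg]
    exact h n z hz

lemma add (hf : IsGevrey k R η f) (hg : IsGevrey k R η g) : IsGevrey k R η (f + g) where
  holo := hf.holo.add hg.holo
  cont := hf.cont.add hg.cont
  expansion := by
    obtain ⟨a, ha⟩ := hf.expansion
    obtain ⟨b, hb⟩ := hg.expansion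
    refine ⟨a + b, fun T hT n => ?_⟩
    obtain ⟨C, hC⟩ := ha T hT n
    obtain ⟨D, hD⟩ := hb T hT n
    refine ⟨C + D, fun z hz => ?_⟩
    have e : (f + g) z - ∑ p ∈ Finset.range n, PowerSeries.coeff p (a + b) * z ^ p =
        (f z - ∑ p ∈ Finset.range n, PowerSeries.coeff p a * z ^ p) +
        (g z - ∑ p ∈ Finset.range n, PowerSeries.coeff p b * z ^ p) := by
      simp only [map_add, add_mul, Finset.sum_add_distrib, Pi.add_apply]
      ring
    rw [e, add_mul]
    exact (norm_add_le _ _).trans (add_le_add (hC z hz) (hD z hz))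
  gevrey := by
    intro T hT
    obtain ⟨C, M, hC, hM, h⟩ := hf.gevrey T hT
    obtain ⟨D, N, hD, hN, h'⟩ := hg.gevrey T hT
    refine ⟨C + D, max M N, by positivity, by positivity, fun n z hz => ?_⟩
    rw [iteratedDeriv_add (hf.contDiffAt (hT.subset hz) n) (hg.contDiffAt (hT.subset hz) n),
      add_div]
    refine (norm_add_le _ _).trans ((add_le_add (h n z hz) (h' n z hz)).trans ?_)
    have h1 : C * M ^ n ≤ C * max M N ^ n := by gcongr; exact le_max_left _ _
    have h2 : D * N ^ n ≤ D * max M N ^ n := by gcongr; exact le_max_right _ _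
    rw [← add_mul]
    gcongr
    linarith

lemma mul (hk : 1 / 2 < k) (hf : IsGevrey k R η f) (hg : IsGevrey k R η g) :
    IsGevrey k R η (f * g) where
  holo := hf.holo.mul hg.holo
  cont := hf.cont.mul hg.cont
  expansion := by
    obtain ⟨a, ha⟩ := hf.expansion
    obtain ⟨b, hb⟩ := hg.expansion
    refine ⟨a * b, fun T hT n => ?_⟩
    obtain ⟨C, hC⟩ := ha T hT n
    obtain ⟨D, hD⟩ := hb T hT n
    obtain ⟨B, hB⟩ := hb T hT 0
    let P : Polynomial ℂ := PowerSeries.trunc n a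
    let Q : Polynomial ℂ := PowerSeries.trunc n b
    let U : Polynomial ℂ := PowerSeries.trunc n (a * b)
    have hev : ∀ (c : PowerSeries ℂ) (z : ℂ),
        ∑ p ∈ Finset.range n, PowerSeries.coeff p c * z ^ p = (PowerSeries.trunc n c).eval z := by
      intro c z
      rw [← Polynomial.eval₂_id, PowerSeries.eval₂_trunc_eq_sum_range]
      rfl
    have hdvd : Polynomial.X ^ n ∣ P * Q - U := by
      rw [Polynomial.X_pow_dvd_iff]
      intro d hd
      have h1 : (P * Q).coeff d = PowerSeries.coeff d (a * b) := by
        rw [Polynomial.coeff_mul, PowerSeries.coeff_mul]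
        refine Finset.sum_congr rfl fun x hx => ?_
        have := Finset.HasAntidiagonal.mem_antidiagonal.1 hx
        simp only [P, Q, PowerSeries.coeff_trunc]
        rw [if_pos (by omega), if_pos (by omega)]
      rw [Polynomial.coeff_sub, h1]
      simp [U, PowerSeries.coeff_trunc, hd]
    obtain ⟨V, hV⟩ := hdvd
    obtain ⟨A, hA⟩ := (isCompact_closedBall (0 : ℂ) R).exists_bound_of_continuousOn
      (f := fun z => P.eval z) P.continuous.continuousOn
    obtain ⟨E, hE⟩ := (isCompact_closedBall (0 : ℂ) R).exists_bound_of_continuousOn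
      (f := fun z => V.eval z) V.continuous.continuousOn
    refine ⟨C * B + A * D + E, fun z hz => ?_⟩
    have hzR : z ∈ Metric.closedBall (0 : ℂ) R := by simpa using hT.norm_le hz
    have hC' := hC z hz
    have hD' := hD z hz
    have hB' : ‖g z‖ ≤ B := by simpa using hB z hz
    rw [hev] at hC' hD' ⊢
    have hVz : P.eval z * Q.eval z - U.eval z = z ^ n * V.eval z := by
      have := congrArg (Polynomial.eval z) hV
      simpa using this
    have e : (f * g) z - U.eval z =
        (f z - P.eval z) * g z + P.eval z * (g z - Q.eval z) + z ^ n * V.eval z := by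
      rw [← hVz, Pi.mul_apply]
      ring
    change ‖(f * g) z - U.eval z‖ ≤ _
    rw [e]
    refine (norm_add₃_le).trans ?_
    rw [norm_mul, norm_mul, norm_mul, norm_pow]
    have hA0 : ‖P.eval z‖ ≤ A := hA z hzR
    have hE0 : ‖V.eval z‖ ≤ E := hE z hzR
    have t1 : ‖f z - P.eval z‖ * ‖g z‖ ≤ (C * ‖z‖ ^ n) * B :=
      mul_le_mul hC' hB' (norm_nonneg _) ((norm_nonneg _).trans hC')
    have t2 : ‖P.eval z‖ * ‖g z - Q.eval z‖ ≤ A * (D * ‖z‖ ^ n) :=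
      mul_le_mul hA0 hD' (norm_nonneg _) ((norm_nonneg _).trans hA0)
    have t3 : ‖z‖ ^ n * ‖V.eval z‖ ≤ ‖z‖ ^ n * E :=
      mul_le_mul_of_nonneg_left hE0 (by positivity)
    linarith
  gevrey := by
    intro T hT
    obtain ⟨C, M, hC, hM, h⟩ := hf.gevrey T hT
    obtain ⟨D, N, hD, hN, h'⟩ := hg.gevrey T hT
    have hk0 : 0 ≤ 1 / k := by
      have : 0 < k := by linarith
      positivity
    refine ⟨C * D, 2 * max M N, by positivity, by positivity, fun n z hz => ?_⟩
    rw [iteratedDeriv_mul (hf.contDiffAt (hT.subset hz) n) (hg.contDiffAt (hT.subset hz) n),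
      Finset.sum_div]
    have hterm : ∀ i ∈ Finset.range (n + 1),
        ‖(n.choose i : ℂ) * iteratedDeriv i f z * iteratedDeriv (n - i) g z
          / (n.factorial : ℂ)‖ ≤
        C * D * max M N ^ n * (n.factorial : ℝ) ^ (1 / k) := by
      intro i hi
      have hin : i ≤ n := Nat.lt_succ_iff.1 (Finset.mem_range.1 hi)
      have hfac : ((n.choose i : ℂ)) * (i.factorial : ℂ) * ((n - i).factorial : ℂ) =
          (n.factorial : ℂ) := by
        exact_mod_cast Nat.choose_mul_factorial_mul_factorial hin
      have e : (n.choose i : ℂ) * iteratedDeriv i f z * iteratedDeriv (n - i) g z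
          / (n.factorial : ℂ) = (iteratedDeriv i f z / (i.factorial : ℂ)) *
            (iteratedDeriv (n - i) g z / ((n - i).factorial : ℂ)) := by
        have h1 : (i.factorial : ℂ) ≠ 0 := by exact_mod_cast i.factorial_ne_zero
        have h2 : ((n - i).factorial : ℂ) ≠ 0 := by exact_mod_cast (n - i).factorial_ne_zero
        have h3 : (n.choose i : ℂ) ≠ 0 := by exact_mod_cast (Nat.choose_pos hin).ne'
        rw [← hfac]
        field_simp
      rw [e, norm_mul]
      refine (mul_le_mul (h i z hz) (h' (n - i) z hz) (norm_nonneg _) (by positivity)).trans ?_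
      have p1 : M ^ i ≤ max M N ^ i := by gcongr; exact le_max_left _ _
      have p2 : N ^ (n - i) ≤ max M N ^ (n - i) := by gcongr; exact le_max_right _ _
      have p3 : max M N ^ i * max M N ^ (n - i) = max M N ^ n := by
        rw [← pow_add, Nat.add_sub_cancel' hin]
      have p4 : (i.factorial : ℝ) ^ (1 / k) * ((n - i).factorial : ℝ) ^ (1 / k) ≤
          (n.factorial : ℝ) ^ (1 / k) := by
        rw [← Real.mul_rpow (by positivity) (by positivity)]
        refine Real.rpow_le_rpow (by positivity) ?_ hk0
        exact_mod_cast Nat.le_of_dvd n.factorial_pos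
          (Nat.factorial_mul_factorial_dvd_factorial hin)
      calc C * M ^ i * (i.factorial : ℝ) ^ (1 / k) *
            (D * N ^ (n - i) * ((n - i).factorial : ℝ) ^ (1 / k))
          = C * D * (M ^ i * N ^ (n - i)) *
            ((i.factorial : ℝ) ^ (1 / k) * ((n - i).factorial : ℝ) ^ (1 / k)) := by ring
        _ ≤ C * D * (max M N ^ i * max M N ^ (n - i)) * (n.factorial : ℝ) ^ (1 / k) := by
            gcongr
        _ = _ := by rw [p3]
    refine (norm_sum_le _ _).trans ((Finset.sum_le_sum hterm).trans ?_)
    rw [Finset.sum_const, Finset.card_range, nsmul_eq_mul]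
    have h2n : ((n + 1 : ℕ) : ℝ) ≤ 2 ^ n := by exact_mod_cast Nat.lt_two_pow_self
    rw [mul_pow]
    calc ((n + 1 : ℕ) : ℝ) * (C * D * max M N ^ n * (n.factorial : ℝ) ^ (1 / k))
        ≤ 2 ^ n * (C * D * max M N ^ n * (n.factorial : ℝ) ^ (1 / k)) := by gcongr
      _ = _ := by ring

end IsGevrey

end helpers

/-- The ring `𝒢_k` of `k`-summable functions in the direction of the positive real axis: the
inductive limit over `R, η > 0` of the algebras of functions on `S^k_{R,η}` that are Gevrey of
order `k`. -/
def gevreyRing (k : ℝ) (hk : 1 / 2 < k) : Subring (SectorGerm k) where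
  carrier := {g | ∃ R η : ℝ, 0 < R ∧ 0 < η ∧ ∃ f : ℂ → ℂ, IsGevrey k R η f ∧
    (f : SectorGerm k) = g}
  mul_mem' := by
    rintro _ _ ⟨R, η, hR, hη, f, hf, rfl⟩ ⟨R', η', hR', hη', f', hf', rfl⟩
    exact ⟨min R R', min η η', lt_min hR hR', lt_min hη hη', f * f',
      (hf.mono (min_le_left _ _) (min_le_left _ _)).mul hk
        (hf'.mono (min_le_right _ _) (min_le_right _ _)), rfl⟩
  one_mem' := ⟨1, 1, one_pos, one_pos, _, IsGevrey.const k 1 1 1, rfl⟩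
  add_mem' := by
    rintro _ _ ⟨R, η, hR, hη, f, hf, rfl⟩ ⟨R', η', hR', hη', f', hf', rfl⟩
    exact ⟨min R R', min η η', lt_min hR hR', lt_min hη hη', f + f',
      (hf.mono (min_le_left _ _) (min_le_left _ _)).add
        (hf'.mono (min_le_right _ _) (min_le_right _ _)), rfl⟩
  zero_mem' := ⟨1, 1, one_pos, one_pos, _, IsGevrey.const k 1 1 0, rfl⟩
  neg_mem' := by
    rintro _ ⟨R, η, hR, hη, f, hf, rfl⟩
    exact ⟨R, η, hR, hη, -f, hf.neg, rfl⟩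

section normHelpers

variable {k R R' η η' ρ ρ' : ℝ}

lemma gevreyNorm_le {f : ℕ → ℂ → ℂ} {g : SectorGerm k} (h : IsRep k R η f g) :
    gevreyNorm k R η ρ g ≤ repNorm k R η ρ f :=
  iInf₂_le (f := fun f (_ : IsRep k R η f g) => repNorm k R η ρ f) f h

lemma IsRep.mono {f : ℕ → ℂ → ℂ} {g : SectorGerm k} (h : IsRep k R' η' f g)
    (hR : R ≤ R') (hη : η ≤ η') : IsRep k R η f g := by
  obtain ⟨h1, F, hF, h2⟩ := h
  exact ⟨fun n => (h1 n).mono (discSector_mono hR hη n), F, hF,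
    fun z hz => h2 z (gevreySector_mono hR hη hz)⟩

lemma repNorm_mono (f : ℕ → ℂ → ℂ) (hR : R ≤ R') (hη : η ≤ η') (hρ0 : 0 < ρ')
    (hρ : ρ' ≤ ρ) : repNorm k R η ρ f ≤ repNorm k R' η' ρ' f := by
  refine ENNReal.tsum_le_tsum fun n => mul_le_mul' ?_ ?_
  · exact biSup_mono fun z hz => discSector_mono hR hη n hz
  · gcongr

lemma gevreyNorm_mono (g : SectorGerm k) (hR : R ≤ R') (hη : η ≤ η') (hρ0 : 0 < ρ')
    (hρ : ρ' ≤ ρ) : gevreyNorm k R η ρ g ≤ gevreyNorm k R' η' ρ' g :=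
  le_iInf₂ fun f hf => (gevreyNorm_le (hf.mono hR hη)).trans (repNorm_mono f hR hη hρ0 hρ)

lemma gevreyNorm_const_le (c : ℂ) :
    gevreyNorm k R η ρ ((fun _ => c : ℂ → ℂ) : SectorGerm k) ≤ ‖c‖ₑ := by
  have hrep : IsRep k R η (fun n _ => if n = 0 then c else 0)
      ((fun _ => c : ℂ → ℂ) : SectorGerm k) :=
    ⟨fun n => differentiableOn_const _, fun _ => c, rfl, fun z _ => hasSum_ite_eq 0 c⟩
  refine (gevreyNorm_le hrep).trans ?_
  · rw [repNorm, tsum_eq_single 0]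
    · simp
    · intro n hn
      simp [hn]

lemma gevreyNorm_zero : gevreyNorm k R η ρ (0 : SectorGerm k) = 0 := by
  have := gevreyNorm_const_le (k := k) (R := R) (η := η) (ρ := ρ) 0
  rw [enorm_zero] at this
  exact le_antisymm this bot_le

lemma gevreyNorm_neg_le (g : SectorGerm k) : gevreyNorm k R η ρ (-g) ≤ gevreyNorm k R η ρ g := by
  refine le_iInf₂ fun f hf => ?_
  obtain ⟨h1, F, rfl, h2⟩ := hf
  have hrep : IsRep k R η (fun n => -f n) (-(F : SectorGerm k)) :=
    ⟨fun n => (h1 n).neg, -F, rfl, fun z hz => (h2 z hz).neg⟩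
  refine (gevreyNorm_le hrep).trans ?_
  simp [repNorm]

lemma gevreyNorm_add_le (g h : SectorGerm k) :
    gevreyNorm k R η ρ (g + h) ≤ gevreyNorm k R η ρ g + gevreyNorm k R η ρ h := by
  refine ENNReal.le_iInf₂_add_iInf₂ fun f hf f' hf' => ?_
  obtain ⟨h1, F, rfl, h2⟩ := hf
  obtain ⟨h1', F', rfl, h2'⟩ := hf'
  have hrep : IsRep k R η (fun n => f n + f' n) ((F : SectorGerm k) + (F' : SectorGerm k)) :=
    ⟨fun n => (h1 n).add (h1' n), F + F', rfl, fun z hz => (h2 z hz).add (h2' z hz)⟩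
  refine (gevreyNorm_le hrep).trans ?_
  rw [repNorm, repNorm, repNorm, ← ENNReal.tsum_add]
  refine ENNReal.tsum_le_tsum fun n => ?_
  rw [← add_mul]
  gcongr
  refine iSup₂_le fun z hz => (enorm_add_le _ _).trans (add_le_add ?_ ?_)
  · exact le_iSup₂ (f := fun z (_ : z ∈ discSector k R η n) => ‖f n z‖ₑ) z hz
  · exact le_iSup₂ (f := fun z (_ : z ∈ discSector k R η n) => ‖f' n z‖ₑ) z hz

lemma tsum_enorm_le_repNorm (hρ0 : 0 < ρ) (hρ : ρ < 1) (f : ℕ → ℂ → ℂ) {z : ℂ}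
    (hz : z ∈ gevreySector k R η) : ∑' n, ‖f n z‖ₑ ≤ repNorm k R η ρ f := by
  refine ENNReal.tsum_le_tsum fun n => ?_
  have h1 : (1 : ℝ≥0∞) ≤ ENNReal.ofReal ρ⁻¹ ^ n := by
    refine one_le_pow₀ ?_
    rw [ENNReal.one_le_ofReal]
    exact (one_le_inv₀ hρ0).2 hρ.le
  calc ‖f n z‖ₑ = ‖f n z‖ₑ * 1 := (mul_one _).symm
    _ ≤ _ := mul_le_mul' (le_iSup₂ (f := fun z (_ : z ∈ discSector k R η n) => ‖f n z‖ₑ) z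
      (Or.inr hz)) h1

lemma tsum_sum_antidiagonal {A : Type*} [AddCommMonoid A] [Finset.HasAntidiagonal A]
    (u v : A → ℝ≥0∞) :
    ∑' n, ∑ x ∈ Finset.HasAntidiagonal.antidiagonal n, u x.1 * v x.2 = (∑' n, u n) * ∑' n, v n := by
  calc ∑' n, ∑ x ∈ Finset.HasAntidiagonal.antidiagonal n, u x.1 * v x.2
      = ∑' n, ∑' x : Finset.HasAntidiagonal.antidiagonal n, u x.1.1 * v x.1.2 := by
        refine tsum_congr fun n => ?_
        rw [Finset.tsum_subtype (Finset.HasAntidiagonal.antidiagonal n) (fun x => u x.1 * v x.2)]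
    _ = ∑' x : (Σ n : A, Finset.HasAntidiagonal.antidiagonal n), u x.2.1.1 * v x.2.1.2 :=
        (ENNReal.tsum_sigma' (fun x : (Σ n : A, Finset.HasAntidiagonal.antidiagonal n) =>
          u x.2.1.1 * v x.2.1.2)).symm
    _ = ∑' x : A × A, u x.1 * v x.2 :=
        Finset.HasAntidiagonal.sigmaAntidiagonalEquivProd.tsum_eq (fun x : A × A => u x.1 * v x.2)
    _ = ∑' i, ∑' j, u i * v j := ENNReal.tsum_prod (f := fun i j => u i * v j)
    _ = _ := by simp_rw [ENNReal.tsum_mul_left, ENNReal.tsum_mul_right]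

lemma gevreyNorm_mul_le (hk : 1 / 2 < k) (hρ0 : 0 < ρ) (hρ : ρ < 1) (g h : SectorGerm k)
    (hg : gevreyNorm k R η ρ g ≠ ∞) (hh : gevreyNorm k R η ρ h ≠ ∞) :
    gevreyNorm k R η ρ (g * h) ≤ gevreyNorm k R η ρ g * gevreyNorm k R η ρ h := by
  refine ENNReal.le_mul_of_forall_lt (Or.inr hh) (Or.inl hg) fun a ha b hb => ?_
  simp only [gevreyNorm, gt_iff_lt, iInf_lt_iff] at ha hb
  obtain ⟨f, hf, hfa⟩ := ha
  obtain ⟨f', hf', hfb⟩ := hb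
  refine le_trans ?_ (mul_le_mul' hfa.le hfb.le)
  obtain ⟨h1, F, rfl, h2⟩ := hf
  obtain ⟨h1', F', rfl, h2'⟩ := hf'
  suffices hrep : IsRep k R η (fun n => ∑ x ∈ Finset.HasAntidiagonal.antidiagonal n,
      f x.1 * f' x.2) ((F : SectorGerm k) * (F' : SectorGerm k)) by
    refine (gevreyNorm_le hrep).trans ?_
    rw [repNorm, repNorm, repNorm, ← tsum_sum_antidiagonal]
    refine ENNReal.tsum_le_tsum fun n => ?_
    have : (⨆ z ∈ discSector k R η n, ‖(∑ x ∈ Finset.HasAntidiagonal.antidiagonal n, f x.1 * f' x.2) z‖ₑ) ≤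
        ∑ x ∈ Finset.HasAntidiagonal.antidiagonal n, (⨆ z ∈ discSector k R η x.1, ‖f x.1 z‖ₑ) *
          (⨆ z ∈ discSector k R η x.2, ‖f' x.2 z‖ₑ) := by
      refine iSup₂_le fun z hz => ?_
      rw [Finset.sum_apply]
      refine (enorm_sum_le _ _).trans (Finset.sum_le_sum fun x hx => ?_)
      have := Finset.HasAntidiagonal.mem_antidiagonal.1 hx
      rw [Pi.mul_apply, enorm_mul]
      refine mul_le_mul' ?_ ?_
      · exact le_iSup₂ (f := fun z (_ : z ∈ discSector k R η x.1) => ‖f x.1 z‖ₑ) z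
          (discSector_anti hk R η (by omega) hz)
      · exact le_iSup₂ (f := fun z (_ : z ∈ discSector k R η x.2) => ‖f' x.2 z‖ₑ) z
          (discSector_anti hk R η (by omega) hz)
    refine (mul_le_mul_left this _).trans ?_
    rw [Finset.sum_mul]
    refine Finset.sum_le_sum fun x hx => le_of_eq ?_
    rw [← Finset.HasAntidiagonal.mem_antidiagonal.1 hx, pow_add]
    ring
  refine ⟨fun n => ?_, F * F', rfl, fun z hz => ?_⟩
  · refine DifferentiableOn.sum fun x hx => ?_
    have := Finset.HasAntidiagonal.mem_antidiagonal.1 hx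
    exact ((h1 x.1).mono (discSector_anti hk R η (by omega))).mul
      ((h1' x.2).mono (discSector_anti hk R η (by omega)))
  · have s1 : Summable fun n => ‖f n z‖ := by
      refine (tsum_enorm_ne_top_iff_summable_norm).1 ?_
      exact ((tsum_enorm_le_repNorm hρ0 hρ f hz).trans_lt (hfa.trans_le le_top)).ne
    have s2 : Summable fun n => ‖f' n z‖ := by
      refine (tsum_enorm_ne_top_iff_summable_norm).1 ?_
      exact ((tsum_enorm_le_repNorm hρ0 hρ f' hz).trans_lt (hfb.trans_le le_top)).ne
    have s3 := (summable_norm_sum_mul_antidiagonal_of_summable_norm s1 s2).of_norm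
    have e := tsum_mul_tsum_eq_tsum_sum_antidiagonal_of_summable_norm s1 s2
    rw [(h2 z hz).tsum_eq, (h2' z hz).tsum_eq] at e
    have := s3.hasSum
    rw [← e] at this
    simpa using this

end normHelpers

/-- `‖f‖_{α,μ} = ∑_ω ‖f_ω‖_α μ^{|ω|}` for `f = ∑_ω f_ω y^ω` with `f_ω ∈ 𝒢_k` and
`α = (R, ρ, k, η)`. -/
noncomputable def gevreyAnalyticNorm {k : ℝ} {hk : 1 / 2 < k} {n : ℕ} (R η ρ μ : ℝ)
    (f : MvPowerSeries (Fin n) (gevreyRing k hk)) : ℝ≥0∞ :=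
  ∑' ω : Fin n →₀ ℕ,
    gevreyNorm k R η ρ ((MvPowerSeries.coeff ω f : gevreyRing k hk) : SectorGerm k) * ENNReal.ofReal μ ^ ω.degree

section analyticHelpers

variable {k : ℝ} {hk : 1 / 2 < k} {n : ℕ} {R R' η η' ρ ρ' μ μ' : ℝ}

lemma gevreyAnalyticNorm_mono (f : MvPowerSeries (Fin n) (gevreyRing k hk))
    (hR : R ≤ R') (hη : η ≤ η') (hρ0 : 0 < ρ') (hρ : ρ' ≤ ρ) (hμ : μ ≤ μ') :
    gevreyAnalyticNorm R η ρ μ f ≤ gevreyAnalyticNorm R' η' ρ' μ' f := by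
  refine ENNReal.tsum_le_tsum fun ω => mul_le_mul' (gevreyNorm_mono _ hR hη hρ0 hρ) ?_
  gcongr

lemma gevreyNorm_sum_le {ι : Type*} (s : Finset ι) (g : ι → SectorGerm k) :
    gevreyNorm k R η ρ (∑ i ∈ s, g i) ≤ ∑ i ∈ s, gevreyNorm k R η ρ (g i) :=
  Finset.le_sum_of_subadditive _ gevreyNorm_zero.le gevreyNorm_add_le s g

lemma gevreyAnalyticNorm_C_ne_top (c : ℂ) (g : gevreyRing k hk)
    (hg : (g : SectorGerm k) = ((fun _ => c : ℂ → ℂ) : SectorGerm k)) :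
    gevreyAnalyticNorm R η ρ μ (MvPowerSeries.C g : MvPowerSeries (Fin n) (gevreyRing k hk))
      ≠ ∞ := by
  classical
  rw [gevreyAnalyticNorm, tsum_eq_single 0]
  · simp only [MvPowerSeries.coeff_zero_C, hg, map_zero, pow_zero, mul_one]
    exact ((gevreyNorm_const_le c).trans_lt enorm_lt_top).ne
  · intro ω hω
    simp [MvPowerSeries.coeff_C, hω, gevreyNorm_zero]

lemma gevreyAnalyticNorm_mul_ne_top (hρ0 : 0 < ρ) (hρ : ρ < 1) (hμ : 0 < μ)
    (f g : MvPowerSeries (Fin n) (gevreyRing k hk))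
    (hf : gevreyAnalyticNorm R η ρ μ f ≠ ∞) (hg : gevreyAnalyticNorm R η ρ μ g ≠ ∞) :
    gevreyAnalyticNorm R η ρ μ (f * g) ≠ ∞ := by
  have hμ' : ∀ m : ℕ, ENNReal.ofReal μ ^ m ≠ 0 := fun m =>
    pow_ne_zero _ (by simpa using hμ)
  have fin : ∀ u : MvPowerSeries (Fin n) (gevreyRing k hk), gevreyAnalyticNorm R η ρ μ u ≠ ∞ →
      ∀ ω, gevreyNorm k R η ρ ((MvPowerSeries.coeff ω u : gevreyRing k hk) : SectorGerm k) ≠ ∞ := by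
    intro u hu ω h
    refine ENNReal.ne_top_of_tsum_ne_top hu ω ?_
    rw [h, ENNReal.top_mul (hμ' _)]
  refine ne_top_of_le_ne_top (ENNReal.mul_ne_top hf hg) ?_
  rw [gevreyAnalyticNorm, gevreyAnalyticNorm, gevreyAnalyticNorm, ← tsum_sum_antidiagonal]
  refine ENNReal.tsum_le_tsum fun ω => ?_
  classical
  rw [MvPowerSeries.coeff_mul]
  push_cast
  refine (mul_le_mul_left (gevreyNorm_sum_le _ _) _).trans ?_
  rw [Finset.sum_mul]
  refine Finset.sum_le_sum fun x hx => ?_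
  rw [← Finset.HasAntidiagonal.mem_antidiagonal.1 hx, map_add, pow_add]
  refine (mul_le_mul_left (gevreyNorm_mul_le hk hρ0 hρ _ _ (fin f hf _) (fin g hg _)) _).trans ?_
  exact le_of_eq (by ring)

end analyticHelpers

/-- The ring of Gevrey-analytic functions `𝒢_k{y₁, …, yₙ}`: the union (inductive limit) over
`α = (R, ρ, k, η)` and `μ > 0` of the algebras of series `∑_ω f_ω(z) y^ω` with `f_ω ∈ 𝒢_k` and
`∑_ω ‖f_ω‖_α μ^{|ω|} < ∞`. -/
def gevreyAnalytic (k : ℝ) (hk : 1 / 2 < k) (n : ℕ) :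
    Subring (MvPowerSeries (Fin n) (gevreyRing k hk)) where
  carrier := {f | ∃ R ρ η μ : ℝ, 0 < R ∧ 0 < ρ ∧ ρ < 1 ∧ 0 < η ∧ 0 < μ ∧
    gevreyAnalyticNorm R η ρ μ f ≠ ∞}
  mul_mem' := by
    rintro f g ⟨R, ρ, η, μ, hR, hρ, hρ1, hη, hμ, hf⟩ ⟨R', ρ', η', μ', hR', hρ', hρ1', hη', hμ', hg⟩
    refine ⟨min R R', max ρ ρ', min η η', min μ μ', lt_min hR hR', lt_max_of_lt_left hρ,
      max_lt hρ1 hρ1', lt_min hη hη', lt_min hμ hμ', ?_⟩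
    refine gevreyAnalyticNorm_mul_ne_top (lt_max_of_lt_left hρ) (max_lt hρ1 hρ1')
      (lt_min hμ hμ') f g ?_ ?_
    · exact ne_top_of_le_ne_top hf (gevreyAnalyticNorm_mono f (min_le_left _ _) (min_le_left _ _)
        hρ (le_max_left _ _) (min_le_left _ _))
    · exact ne_top_of_le_ne_top hg (gevreyAnalyticNorm_mono g (min_le_right _ _)
        (min_le_right _ _) hρ' (le_max_right _ _) (min_le_right _ _))
  one_mem' := ⟨1, 1 / 2, 1, 1, one_pos, by norm_num, by norm_num, one_pos, one_pos,
    gevreyAnalyticNorm_C_ne_top 1 1 rfl⟩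
  add_mem' := by
    rintro f g ⟨R, ρ, η, μ, hR, hρ, hρ1, hη, hμ, hf⟩ ⟨R', ρ', η', μ', hR', hρ', hρ1', hη', hμ', hg⟩
    refine ⟨min R R', max ρ ρ', min η η', min μ μ', lt_min hR hR', lt_max_of_lt_left hρ,
      max_lt hρ1 hρ1', lt_min hη hη', lt_min hμ hμ', ?_⟩
    have hf' := ne_top_of_le_ne_top hf (gevreyAnalyticNorm_mono f (min_le_left R R')
      (min_le_left η η') hρ (le_max_left ρ ρ') (min_le_left μ μ'))
    have hg' := ne_top_of_le_ne_top hg (gevreyAnalyticNorm_mono g (min_le_right R R')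
      (min_le_right η η') hρ' (le_max_right ρ ρ') (min_le_right μ μ'))
    refine ne_top_of_le_ne_top (ENNReal.add_ne_top.2 ⟨hf', hg'⟩) ?_
    rw [gevreyAnalyticNorm, gevreyAnalyticNorm, gevreyAnalyticNorm, ← ENNReal.tsum_add]
    refine ENNReal.tsum_le_tsum fun ω => ?_
    rw [← add_mul, map_add]
    exact mul_le_mul_left (gevreyNorm_add_le _ _) _
  zero_mem' := ⟨1, 1 / 2, 1, 1, one_pos, by norm_num, by norm_num, one_pos, one_pos, by
    simpa using gevreyAnalyticNorm_C_ne_top (n := n) (R := 1) (η := 1) (ρ := 1 / 2) (μ := 1)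
      0 (0 : gevreyRing k hk) rfl⟩
  neg_mem' := by
    rintro f ⟨R, ρ, η, μ, hR, hρ, hρ1, hη, hμ, hf⟩
    refine ⟨R, ρ, η, μ, hR, hρ, hρ1, hη, hμ, ne_top_of_le_ne_top hf ?_⟩
    refine ENNReal.tsum_le_tsum fun ω => ?_
    rw [map_neg]
    exact mul_le_mul_left (gevreyNorm_neg_le _) _

universe u

/-- The finiteness condition for integral extensions of a domain `D`: every domain `B` that
contains `D`, is integral over `D`, and whose quotient field `L` is finite over the quotient field
`K` of `D`, is a finite `D`-module. -/
def FiniteIntegralExtensions (D : Type u) [CommRing D] [IsDomain D] : Prop :=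
  ∀ (B : Type u) [CommRing B] [IsDomain B] [Algebra D B] (K L : Type u) [Field K] [Field L]
    [Algebra D K] [IsFractionRing D K] [Algebra B L] [IsFractionRing B L] [Algebra K L]
    [Algebra D L] [IsScalarTower D K L] [IsScalarTower D B L],
    Function.Injective (algebraMap D B) → Algebra.IsIntegral D B → Module.Finite K L →
      Module.Finite D B

/-- `A` is pseudo-geometric: it is noetherian, and `A ⧸ P` satisfies the finiteness condition for
integral extensions for every prime ideal `P`. -/
def IsPseudoGeometric (A : Type u) [CommRing A] : Prop :=
  IsNoetherianRing A ∧ ∀ (P : Ideal A) [P.IsPrime], FiniteIntegralExtensions (A ⧸ P)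

/-! Write `A` for the ring of Gevrey-analytic series, `ℂ{y}` for the convergent complex power series
in the same variables and `z` for the coordinate as an element of `A`. Three properties of the germs
carry the proof. The norms are complete and submultiplicative, and a germ with limit `0` can be
given arbitrarily small norm by changing `α`. A germ of finite norm with limit `0` is `z` times a
germ whose norm is controlled, at the price of a slightly larger `ρ`. A germ of finite norm
divisible by all powers of `z` is zero (Watson's lemma, since the opening of the sectors exceeds `π
/ k`).

Taking limits of coefficients maps `A` onto `ℂ{y}` with kernel `(z)`, and every nonzero `f` in `A`
is `z ^ N * g` with `g` of nonzero reduction. Hence `A` is a domain and `z` is prime. A linear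
change of the variables makes such a `g` regular in one of them, and Weierstrass division, a
contraction argument for the norms, shows that `A ⧸ (g)` is finite over the ring in one variable
less.

Now induct on the number of variables, the case of `ℂ{y}` being settled beforehand in the same way.
A nonzero prime `P` either contains `z`, and then `A ⧸ P` is a residue domain of `ℂ{y}`, or contains
some `g` as above, and then `A ⧸ P` is finite over a residue domain of the smaller ring. In both
cases `P` is finitely generated, so `A` is noetherian. For `P = 0` the ring itself is integrally
closed: it is noetherian and local, and its quotient by the prime element `z` is the integrally
closed ring `ℂ{y}`.

So every residue domain `D` of `A` is finite over a noetherian integrally closed domain `C` of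
characteristic zero. A domain `B` as in the finiteness condition embeds in the integral closure of
`C` in the fraction field of `B`, a finite separable extension of that of `C`; this closure is a
finite `C`-module, and therefore so is `B`. -/

section algebraicHelpers

/-! ### Integral closedness and finiteness of integral extensions -/

/-- In a noetherian integrally closed domain, `b` divides `a` as soon as the powers of the fraction
`a / b` have a common denominator. -/
lemma dvd_of_forall_pow_dvd_mul_pow {D : Type*} [CommRing D] [IsDomain D] [IsNoetherianRing D]
    [IsIntegrallyClosed D] {a b c : D} (hc : c ≠ 0) (hb : b ≠ 0)
    (h : ∀ m : ℕ, b ^ m ∣ c * a ^ m) : b ∣ a := by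
  let K := FractionRing D
  have hb' : algebraMap D K b ≠ 0 := by simpa using hb
  have key : IsAlmostIntegral D (algebraMap D K a / algebraMap D K b) := by
    refine ⟨c, mem_nonZeroDivisors_of_ne_zero hc, fun m => ?_⟩
    obtain ⟨d, hd⟩ := h m
    refine ⟨d, ?_⟩
    have e := congrArg (algebraMap D K) hd
    simp only [map_mul, map_pow] at e
    rw [Algebra.smul_def, div_pow, ← mul_div_assoc, e, mul_div_cancel_left₀ _ (pow_ne_zero _ hb')]
  have hle : nonZeroDivisors D ≤ (nonZeroDivisors K).comap (algebraMap D K) := by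
    intro x hx
    simpa using nonZeroDivisors.ne_zero hx
  obtain ⟨q, hq⟩ := IsIntegrallyClosed.isIntegral_iff.1
    (key.isIntegral_of_nonZeroDivisors_le_comap hle)
  refine ⟨q, IsFractionRing.injective D K ?_⟩
  rw [map_mul, hq, mul_div_cancel₀ _ hb']

/-- The hypothesis is complete integral closedness written without fractions. An integral element is
almost integral: the powers of `a / b` have a common denominator `c`. -/
lemma isIntegrallyClosed_of_forall_dvd {D : Type*} [CommRing D] [IsDomain D]
    (h : ∀ a b c : D, c ≠ 0 → b ≠ 0 → (∀ m : ℕ, b ^ m ∣ c * a ^ m) → b ∣ a) :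
    IsIntegrallyClosed D := by
  let K := FractionRing D
  rw [isIntegrallyClosed_iff K]
  intro x hx
  obtain ⟨c, hc, hcx⟩ := hx.isAlmostIntegral
  obtain ⟨a, b, hb, rfl⟩ := IsFractionRing.div_surjective (A := D) x
  have hb0 := nonZeroDivisors.ne_zero hb
  have hb' : algebraMap D K b ≠ 0 := by simpa using hb0
  obtain ⟨q, rfl⟩ := h a b c (nonZeroDivisors.ne_zero hc) hb0 fun m => by
    obtain ⟨d, hd⟩ := hcx m
    refine ⟨d, IsFractionRing.injective D K ?_⟩
    rw [Algebra.smul_def, div_pow, ← mul_div_assoc, eq_div_iff (pow_ne_zero _ hb')] at hd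
    rw [map_mul, map_mul, map_pow, map_pow, ← hd, mul_comm]
  exact ⟨q, by rw [map_mul, mul_div_cancel_left₀ _ hb']⟩

/-- A noetherian local domain is integrally closed if its quotient by a prime element is. -/
lemma isIntegrallyClosed_of_quotient_span_prime {A : Type*} [CommRing A] [IsDomain A]
    [IsNoetherianRing A] [IsLocalRing A] {x : A} (hx : Prime x)
    (hq : ∀ [IsDomain (A ⧸ Ideal.span {x})], IsIntegrallyClosed (A ⧸ Ideal.span {x})) :
    IsIntegrallyClosed A := by
  have hprime : (Ideal.span {x}).IsPrime := (Ideal.span_singleton_prime hx.ne_zero).2 hx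
  have hdom : IsDomain (A ⧸ Ideal.span {x}) := Ideal.Quotient.isDomain _
  have hic := @hq hdom
  have hxu : Ideal.span {x} ≠ ⊤ := hprime.ne_top
  have mk0 : ∀ y, Ideal.Quotient.mk (Ideal.span {x}) y = 0 ↔ x ∣ y := fun y => by
    rw [Ideal.Quotient.eq_zero_iff_mem, Ideal.mem_span_singleton]
  have strip : ∀ y : A, y ≠ 0 → ∃ (n : ℕ) (y' : A), y = x ^ n * y' ∧ ¬ x ∣ y' := fun y hy => by
    have hfin : FiniteMultiplicity x y := FiniteMultiplicity.of_not_isUnit hx.not_isUnit hy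
    obtain ⟨y', h1, h2⟩ := hfin.exists_eq_pow_mul_and_not_dvd
    exact ⟨_, y', h1, h2⟩
  have cancel : ∀ (n m : ℕ) (b c : A), ¬ x ∣ b → b ^ m ∣ x ^ n * c → b ^ m ∣ c := by
    rintro n m b c hb ⟨d, hd⟩
    have : x ^ n ∣ d := hx.pow_dvd_of_dvd_mul_left n (mt hx.dvd_of_dvd_pow hb) ⟨c, hd.symm⟩
    obtain ⟨e, rfl⟩ := this
    refine ⟨e, mul_left_cancel₀ (pow_ne_zero n hx.ne_zero) ?_⟩
    rw [hd]
    ring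
  -- the case where neither `b` nor `c` is divisible by `x`
  have main : ∀ a b c : A, ¬ x ∣ c → ¬ x ∣ b → (∀ m : ℕ, b ^ m ∣ c * a ^ m) → b ∣ a := by
    intro a b c hc hb h
    -- Successive approximation: the remainder `r` inherits the hypothesis on `a`, so the integrally
    -- closed quotient by `x` can be used again to split off one more factor `x`.
    have step : ∀ N : ℕ, ∃ q r : A, a = b * q + x ^ N * r ∧ ∀ m : ℕ, b ^ m ∣ c * r ^ m := by
      intro N
      induction N with
      | zero => exact ⟨0, a, by simp, h⟩
      | succ N ih =>
        obtain ⟨q, r, hqr, hr⟩ := ih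
        have hbr : Ideal.Quotient.mk (Ideal.span {x}) b ∣ Ideal.Quotient.mk (Ideal.span {x}) r := by
          refine dvd_of_forall_pow_dvd_mul_pow (c := Ideal.Quotient.mk (Ideal.span {x}) c)
            (by rwa [Ne, mk0]) (by rwa [Ne, mk0]) fun m => ?_
          simpa using map_dvd (Ideal.Quotient.mk (Ideal.span {x})) (hr m)
        obtain ⟨e, he⟩ := hbr
        obtain ⟨e, rfl⟩ := Ideal.Quotient.mk_surjective e
        rw [← map_mul, ← sub_eq_zero, ← map_sub, mk0] at he
        obtain ⟨r', hr'⟩ := he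
        refine ⟨q + x ^ N * e, r', ?_, fun m => ?_⟩
        · rw [hqr, eq_add_of_sub_eq hr']
          ring
        · refine cancel m m b _ hb ?_
          -- In the binomial expansion the term with `r ^ j` has a factor `b ^ (m - j)`, and `c * r
          -- ^ j` supplies `b ^ j`. Since `r - b * e = x * r'` and `x` does not divide `b`, the
          -- factor `x ^ m` cancels afterwards.
          have h1 : b ^ m ∣ c * (r - b * e) ^ m := by
            have hsub : r - b * e = r + b * (-e) := by ring
            rw [hsub, add_pow, Finset.mul_sum]
            refine Finset.dvd_sum fun j hj => ?_
            have hj' : j ≤ m := Nat.lt_succ_iff.1 (Finset.mem_range.1 hj)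
            have : b ^ m = b ^ j * b ^ (m - j) := by rw [← pow_add, Nat.add_sub_cancel' hj']
            rw [this, mul_pow]
            obtain ⟨t, ht⟩ := hr j
            refine ⟨t * (-e) ^ (m - j) * (m.choose j), ?_⟩
            calc _ = (c * r ^ j) * (b ^ (m - j) * (-e) ^ (m - j) * (m.choose j)) := by ring
              _ = _ := by rw [ht]; ring
          rw [hr', mul_pow] at h1
          convert h1 using 1
          ring
    -- By `step`, `a` lies in `(b) + (x ^ N)` for all `N`; Krull's intersection theorem in the local
    -- ring `A` then gives `a ∈ (b)`.
    have hmem : Ideal.Quotient.mk (Ideal.span {b}) a ∈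
        (⨅ i : ℕ, Ideal.span {x} ^ i • ⊤ : Submodule A (A ⧸ Ideal.span {b})) := by
      rw [Submodule.mem_iInf]
      intro N
      obtain ⟨q, r, hqr, -⟩ := step N
      have e : Ideal.Quotient.mk (Ideal.span {b}) a =
          x ^ N • Ideal.Quotient.mk (Ideal.span {b}) r := by
        have hb0 : Ideal.Quotient.mk (Ideal.span {b}) b = 0 :=
          Ideal.Quotient.eq_zero_iff_mem.2 (Ideal.mem_span_singleton_self b)
        rw [Algebra.smul_def, Ideal.Quotient.algebraMap_eq, ← map_mul, hqr, map_add, map_mul, hb0,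
          zero_mul, zero_add]
      rw [e]
      exact Submodule.smul_mem_smul (Ideal.pow_mem_pow (Ideal.mem_span_singleton_self x) N) trivial
    rw [Ideal.iInf_pow_smul_eq_bot_of_isLocalRing _ hxu, Submodule.mem_bot,
      Ideal.Quotient.eq_zero_iff_mem, Ideal.mem_span_singleton] at hmem
    exact hmem
  refine isIntegrallyClosed_of_forall_dvd fun a b c hc hb h => ?_
  obtain ⟨n, c', rfl, hc'⟩ := strip c hc
  obtain ⟨l, b', rfl, hb'⟩ := strip b hb
  have hba : b' ∣ a := main a b' c' hc' hb' fun m =>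
    cancel n m b' _ hb' <| by
      have := h m
      rw [mul_pow, mul_assoc] at this
      exact (dvd_mul_left _ _).trans this
  obtain ⟨q, rfl⟩ := hba
  have hb0 : b' ≠ 0 := right_ne_zero_of_mul hb
  have hxq : ∀ m : ℕ, (x ^ l) ^ m ∣ x ^ n * q ^ m := fun m => by
    have h1 := h m
    rw [mul_pow, mul_pow, show x ^ n * c' * (b' ^ m * q ^ m) = b' ^ m * (c' * (x ^ n * q ^ m)) by
      ring, mul_comm, mul_dvd_mul_iff_left (pow_ne_zero _ hb0)] at h1
    rw [← pow_mul] at h1 ⊢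
    exact hx.pow_dvd_of_dvd_mul_left _ hc' h1
  have hq : x ^ l ∣ q := by
    by_cases hq0 : q = 0
    · simp [hq0]
    obtain ⟨j, q', rfl, hq'⟩ := strip q hq0
    refine (pow_dvd_pow x ?_).trans (dvd_mul_right _ _)
    -- With `j` the exact order of `q` at `x`, the relation says `l * m ≤ n + j * m` for every `m`;
    -- any `m > n` forces `l ≤ j`.
    have h1 := hxq (n + 1)
    rw [mul_pow, ← pow_mul, ← pow_mul, ← mul_assoc, ← pow_add] at h1
    have h2 := hx.pow_dvd_of_dvd_mul_right _ (mt hx.dvd_of_dvd_pow hq') h1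
    rw [pow_dvd_pow_iff hx.ne_zero hx.not_isUnit] at h2
    by_contra hlt
    push Not at hlt
    nlinarith
  obtain ⟨t, rfl⟩ := hq
  exact ⟨t, by ring⟩

/-- A domain that is finite over a noetherian integrally closed domain of characteristic zero
satisfies the finiteness condition for integral extensions. -/
lemma FiniteIntegralExtensions.of_finite {C D : Type} [CommRing C] [IsDomain C] [CharZero C]
    [IsNoetherianRing C] [IsIntegrallyClosed C] [CommRing D] [IsDomain D] (φ : C →+* D)
    (hinj : Function.Injective φ) (hfin : φ.Finite) : FiniteIntegralExtensions D := by
  intro B _ _ _ K L _ _ _ _ _ _ _ _ _ _ hDB hint hKL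
  let _ : Algebra C D := φ.toAlgebra
  have _ : Module.Finite C D := hfin
  have hCD : Function.Injective (algebraMap C D) := hinj
  let _ : Algebra C B := ((algebraMap D B).comp φ).toAlgebra
  have _ : IsScalarTower C D B := IsScalarTower.of_algebraMap_eq fun _ => rfl
  let _ : Algebra C K := ((algebraMap D K).comp φ).toAlgebra
  have _ : IsScalarTower C D K := IsScalarTower.of_algebraMap_eq fun _ => rfl
  let _ : Algebra C L := ((algebraMap D L).comp φ).toAlgebra
  have _ : IsScalarTower C D L := IsScalarTower.of_algebraMap_eq fun _ => rfl
  have _ : IsScalarTower C B L := IsScalarTower.of_algebraMap_eq fun c => by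
    change algebraMap D L (φ c) = algebraMap B L (algebraMap D B (φ c))
    rw [← IsScalarTower.algebraMap_apply]
  have _ : IsScalarTower C K L := IsScalarTower.of_algebraMap_eq fun c => by
    change algebraMap D L (φ c) = algebraMap K L (algebraMap D K (φ c))
    rw [← IsScalarTower.algebraMap_apply]
  let F := FractionRing C
  have hCK : Function.Injective (algebraMap C K) := (IsFractionRing.injective D K).comp hinj
  have hCL : Function.Injective (algebraMap C L) := by
    rw [IsScalarTower.algebraMap_eq C K L]
    exact (algebraMap K L).injective.comp hCK
  have _ : FaithfulSMul C K := (faithfulSMul_iff_algebraMap_injective C K).2 hCK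
  have _ : FaithfulSMul C L := (faithfulSMul_iff_algebraMap_injective C L).2 hCL
  have _ : FaithfulSMul C D := (faithfulSMul_iff_algebraMap_injective C D).2 hCD
  let _ : Algebra F K := FractionRing.liftAlgebra C K
  let _ : Algebra F L := FractionRing.liftAlgebra C L
  have _ : IsScalarTower C F K := inferInstance
  have _ : IsScalarTower C F L := inferInstance
  have _ : IsScalarTower F K L := IsScalarTower.of_algebraMap_eq' <|
    IsLocalization.ringHom_ext (nonZeroDivisors C) <| by
      rw [RingHom.comp_assoc, ← IsScalarTower.algebraMap_eq C F K,
        ← IsScalarTower.algebraMap_eq C F L, ← IsScalarTower.algebraMap_eq C K L]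
  have _ : Algebra.IsIntegral C D := Algebra.IsIntegral.of_finite C D
  have _ : Algebra.IsAlgebraic C D := inferInstance
  -- As `D` is algebraic over `C`, inverting the nonzero elements of `C` already yields the fraction
  -- field of `D`. Hence `K` is finite over `F`.
  have hloc : IsLocalization (Algebra.algebraMapSubmonoid D (nonZeroDivisors C)) K := inferInstance
  have _ : FiniteDimensional F K := Module.Finite.of_isLocalization C D (nonZeroDivisors C)
  have _ : FiniteDimensional F L := FiniteDimensional.trans F K L
  have _ : CharZero F := charZero_of_injective_algebraMap (IsFractionRing.injective C F)
  -- Characteristic zero makes `L / F` separable, which is what the finiteness of the integral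
  -- closure needs.
  have hnoeth : IsNoetherian C (integralClosure C L) :=
    IsIntegralClosure.isNoetherian C F L (integralClosure C L)
  have _ : Algebra.IsIntegral C B := Algebra.IsIntegral.trans D
  let g : B →ₗ[C] integralClosure C L :=
    { toFun := fun b => ⟨algebraMap B L b, (Algebra.IsIntegral.isIntegral (R := C) b).algebraMap⟩
      map_add' := fun x y => Subtype.ext (map_add _ _ _)
      map_smul' := fun c x => Subtype.ext (by
        simp [Algebra.smul_def, ← IsScalarTower.algebraMap_apply C B L]) }
  have hg : Function.Injective g := fun x y h =>
    IsFractionRing.injective B L (congrArg Subtype.val h)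
  have _ : Module.Finite C B := Module.Finite.of_injective g hg
  exact Module.Finite.of_restrictScalars_finite C D B

end algebraicHelpers

/-! ### Directed families of norms and the local ring of elements of finite norm -/

/-- A directed family of complete submultiplicative extended norms on a commutative ring `R`,
together with a "value at the origin" `R → ℂ` whose kernel consists, among the elements of finite
norm, of those with arbitrarily small norms. -/
structure NormFamily (R : Type) [CommRing R] (I : Type) where
  norm : I → R → ℝ≥0∞
  nonempty : Nonempty I
  directed : ∀ i j, ∃ l, (∀ x, norm l x ≤ norm i x) ∧ ∀ x, norm l x ≤ norm j x
  norm_add_le : ∀ i x y, norm i (x + y) ≤ norm i x + norm i y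
  norm_mul_le : ∀ i x y, norm i (x * y) ≤ norm i x * norm i y
  eq_zero_of_norm : ∀ i x, norm i x = 0 → x = 0
  complete : ∀ i (x : ℕ → R), ∑' j, norm i (x j) ≠ ∞ →
    ∃ y, Filter.Tendsto (fun J => norm i (y - ∑ j ∈ Finset.range J, x j)) Filter.atTop (nhds 0)
  value : R →+* ℂ
  const : ℂ →+* R
  value_const : ∀ c, value (const c) = c
  norm_const_le : ∀ i c, norm i (const c) ≤ ‖c‖ₑ
  enorm_value_le : ∀ i x, ‖value x‖ₑ ≤ norm i x
  exists_small : ∀ i x, value x = 0 → norm i x ≠ ∞ → ∀ δ : ℝ≥0∞, δ ≠ 0 →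
    ∃ j, (∀ y, norm j y ≤ norm i y) ∧ norm j x < δ

namespace NormFamily

variable {R I : Type} [CommRing R] (F : NormFamily R I)

lemma norm_one_le (i : I) : F.norm i 1 ≤ 1 := by
  simpa using F.norm_const_le i 1

@[simp] lemma norm_zero (i : I) : F.norm i 0 = 0 := by
  simpa using F.norm_const_le i 0

lemma norm_neg (i : I) (x : R) : F.norm i (-x) = F.norm i x := by
  have key : ∀ y, F.norm i (-y) ≤ F.norm i y := fun y => by
    have h1 := F.norm_mul_le i (F.const (-1)) y
    have h2 := F.norm_const_le i (-1)
    rw [enorm_neg, enorm_one] at h2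
    rw [map_neg, map_one, neg_one_mul] at h1
    rw [map_neg, map_one] at h2
    exact h1.trans ((mul_le_mul_left h2 _).trans (one_mul _).le)
  exact le_antisymm (key x) (by simpa using key (-x))

lemma norm_sub_le (i : I) (x y : R) : F.norm i (x - y) ≤ F.norm i x + F.norm i y := by
  rw [sub_eq_add_neg, ← F.norm_neg i y]
  exact F.norm_add_le i x _

lemma norm_sum_le {ι : Type*} (i : I) (s : Finset ι) (x : ι → R) :
    F.norm i (∑ a ∈ s, x a) ≤ ∑ a ∈ s, F.norm i (x a) :=
  Finset.le_sum_of_subadditive _ (F.norm_zero i).le (F.norm_add_le i) s x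

/-- The subring of the elements that have a finite norm. -/
def fin : Subring R where
  carrier := {x | ∃ i, F.norm i x ≠ ∞}
  mul_mem' := by
    rintro x y ⟨i, hi⟩ ⟨j, hj⟩
    obtain ⟨l, h1, h2⟩ := F.directed i j
    exact ⟨l, ne_top_of_le_ne_top (ENNReal.mul_ne_top hi hj)
      ((F.norm_mul_le l x y).trans (mul_le_mul' (h1 x) (h2 y)))⟩
  one_mem' := ⟨F.nonempty.some, ne_top_of_le_ne_top ENNReal.one_ne_top (F.norm_one_le _)⟩
  add_mem' := by
    rintro x y ⟨i, hi⟩ ⟨j, hj⟩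
    obtain ⟨l, h1, h2⟩ := F.directed i j
    exact ⟨l, ne_top_of_le_ne_top (ENNReal.add_ne_top.2 ⟨hi, hj⟩)
      ((F.norm_add_le l x y).trans (add_le_add (h1 x) (h2 y)))⟩
  zero_mem' := ⟨F.nonempty.some, by simp⟩
  neg_mem' := by
    rintro x ⟨i, hi⟩
    exact ⟨i, by rwa [F.norm_neg]⟩

variable {F}

lemma const_mem_fin (c : ℂ) : F.const c ∈ F.fin :=
  ⟨F.nonempty.some, ne_top_of_le_ne_top enorm_ne_top (F.norm_const_le _ c)⟩

/-- Two elements of finite norm have a finite norm for a common index, which can be chosen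
beyond a given one. -/
lemma exists_common {x y : R} (hx : x ∈ F.fin) (hy : y ∈ F.fin) :
    ∃ i, F.norm i x ≠ ∞ ∧ F.norm i y ≠ ∞ := by
  obtain ⟨i, hi⟩ := hx
  obtain ⟨j, hj⟩ := hy
  obtain ⟨l, h1, h2⟩ := F.directed i j
  exact ⟨l, ne_top_of_le_ne_top hi (h1 x), ne_top_of_le_ne_top hj (h2 y)⟩

/-- Compare with a longer partial sum and let its length tend to infinity. This makes the
convergence from `complete` quantitative: `J = 0` bounds the limit, and general `J` gives a tail
estimate that can be summed over coefficients. -/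
lemma norm_sub_sum_le {i : I} {x : ℕ → R} {y : R}
    (h : Filter.Tendsto (fun J => F.norm i (y - ∑ j ∈ Finset.range J, x j)) Filter.atTop (nhds 0))
    (J : ℕ) : F.norm i (y - ∑ j ∈ Finset.range J, x j) ≤ ∑' j, F.norm i (x (j + J)) := by
  have key : ∀ L : ℕ, F.norm i (y - ∑ j ∈ Finset.range J, x j) ≤
      F.norm i (y - ∑ j ∈ Finset.range (L + J), x j) + ∑' j, F.norm i (x (j + J)) := fun L => by
    have e : y - ∑ j ∈ Finset.range J, x j =
        (y - ∑ j ∈ Finset.range (L + J), x j) + ∑ j ∈ Finset.range L, x (j + J) := by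
      rw [add_comm L J, Finset.sum_range_add]
      simp only [add_comm J]
      ring
    rw [e]
    refine (F.norm_add_le i _ _).trans (add_le_add le_rfl ?_)
    exact (F.norm_sum_le i _ _).trans (ENNReal.sum_le_tsum _)
  have h' := ((Filter.tendsto_add_atTop_iff_nat J).2 h).add_const (∑' j, F.norm i (x (j + J)))
  rw [zero_add] at h'
  exact ge_of_tendsto' h' key

/-- The equation `y = x + T y` has a solution of finite norm when `T` is a contraction. -/
lemma exists_eq_add_apply {i : I} (T : R →+ R) {θ : ℝ≥0∞} (hθ : θ < 1)
    (hT : ∀ v, F.norm i (T v) ≤ θ * F.norm i v) {x : R} (hx : F.norm i x ≠ ∞) :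
    ∃ y, F.norm i y ≠ ∞ ∧ y = x + T y := by
  have hb : ∀ j, F.norm i (T^[j] x) ≤ θ ^ j * F.norm i x := fun j => by
    induction j with
    | zero => simp
    | succ j ih =>
      rw [Function.iterate_succ_apply']
      refine (hT _).trans ((mul_le_mul' le_rfl ih).trans (le_of_eq ?_))
      ring
  have hsum : ∑' j, F.norm i (T^[j] x) ≠ ∞ := by
    refine ne_top_of_le_ne_top ?_ (ENNReal.tsum_le_tsum hb)
    rw [ENNReal.tsum_mul_right, ENNReal.tsum_geometric]
    refine ENNReal.mul_ne_top (ENNReal.inv_ne_top.2 ?_) hx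
    exact (tsub_pos_of_lt hθ).ne'
  -- The solution is the Neumann series `∑ T^j x`. The equation is checked by showing that the
  -- defect has norm `0`, comparing the partial sums of lengths `J + 1` and `J`.
  obtain ⟨y, hy⟩ := F.complete i _ hsum
  refine ⟨y, ?_, ?_⟩
  · have := norm_sub_sum_le hy 0
    simp only [Finset.range_zero, Finset.sum_empty, sub_zero, add_zero] at this
    exact ne_top_of_le_ne_top hsum this
  · refine sub_eq_zero.1 (F.eq_zero_of_norm i _ (le_antisymm ?_ bot_le))
    have key : ∀ J, F.norm i (y - (x + T y)) ≤
        F.norm i (y - ∑ j ∈ Finset.range (J + 1), T^[j] x) +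
          F.norm i (y - ∑ j ∈ Finset.range J, T^[j] x) := fun J => by
      have e : y - (x + T y) = (y - ∑ j ∈ Finset.range (J + 1), T^[j] x) -
          T (y - ∑ j ∈ Finset.range J, T^[j] x) := by
        rw [Finset.sum_range_succ', map_sub, map_sum]
        simp only [Function.iterate_succ_apply', Function.iterate_zero, id_eq]
        ring
      rw [e]
      refine (F.norm_sub_le i _ _).trans (add_le_add le_rfl ((hT _).trans ?_))
      exact (mul_le_mul' hθ.le le_rfl).trans (one_mul _).le
    have h' := ((Filter.tendsto_add_atTop_iff_nat 1).2 hy).add hy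
    rw [zero_add] at h'
    exact ge_of_tendsto' h' key

/-- After division by the constant `value x`, the element is `1 - h` with `value h = 0`. For a
suitable index `h` has norm less than `1`, and the geometric series inverts `1 - h`. -/
lemma exists_mul_eq_one {x : R} (hx : x ∈ F.fin) (h0 : F.value x ≠ 0) :
    ∃ y ∈ F.fin, x * y = 1 := by
  set h : R := 1 - F.const (F.value x)⁻¹ * x with hh
  have hfin : h ∈ F.fin := sub_mem (one_mem _) (mul_mem (const_mem_fin _) hx)
  have hv : F.value h = 0 := by
    simp [hh, F.value_const, inv_mul_cancel₀ h0]
  obtain ⟨i, hi⟩ := hfin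
  obtain ⟨j, -, hj⟩ := F.exists_small i h hv hi 1 one_ne_zero
  obtain ⟨y, hy, e⟩ := exists_eq_add_apply (F := F) (i := j) (AddMonoidHom.mulLeft h) hj
    (fun v => F.norm_mul_le j h v) (x := 1)
    (ne_top_of_le_ne_top ENNReal.one_ne_top (F.norm_one_le j))
  refine ⟨F.const (F.value x)⁻¹ * y, mul_mem (const_mem_fin _) ⟨j, hy⟩, ?_⟩
  rw [AddMonoidHom.coe_mulLeft, hh] at e
  linear_combination e

/-- The nonunits are thus the kernel of the value, so the ring is local, as needed for Krull's
theorem in `isIntegrallyClosed_of_quotient_span_prime`. -/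
lemma isUnit_fin_iff {x : F.fin} : IsUnit x ↔ F.value x ≠ 0 := by
  constructor
  · intro h
    exact ((h.map F.fin.subtype).map F.value).ne_zero
  · intro h
    obtain ⟨y, hy, e⟩ := exists_mul_eq_one x.2 h
    exact IsUnit.of_mul_eq_one ⟨y, hy⟩ (Subtype.ext e)

instance : Nontrivial F.fin := (F.value.comp F.fin.subtype).domain_nontrivial

instance : IsLocalRing F.fin :=
  IsLocalRing.of_nonunits_add fun a b ha hb => by
    rw [mem_nonunits_iff, isUnit_fin_iff, not_not] at *
    simp [ha, hb]

end NormFamily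

/-! ### Weighted norms on power series -/

namespace NormFamily

variable {R I σ : Type} [CommRing R] [Fintype σ] (F : NormFamily R I)

/-- The polyradii that are finite exactly in the variables of `s`. -/
abbrev Polyradius (s : Finset σ) : Type :=
  {μ : σ → ℝ≥0∞ // ∀ b, μ b ≠ 0 ∧ (μ b = ∞ ↔ b ∉ s)}

/-- The value `∏ μ_b ^ ω_b` of a monomial on a polyradius. -/
noncomputable def weight (μ : σ → ℝ≥0∞) (ω : σ →₀ ℕ) : ℝ≥0∞ := ∏ b, μ b ^ ω b

lemma weight_zero (μ : σ → ℝ≥0∞) : weight μ 0 = 1 := by simp [weight]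

lemma weight_add (μ : σ → ℝ≥0∞) (ω ω' : σ →₀ ℕ) :
    weight μ (ω + ω') = weight μ ω * weight μ ω' := by
  simp [weight, pow_add, Finset.prod_mul_distrib]

lemma weight_single (μ : σ → ℝ≥0∞) (a : σ) (j : ℕ) :
    weight μ (Finsupp.single a j) = μ a ^ j := by
  classical
  rw [weight, Finset.prod_eq_single a]
  · simp
  · intro b _ hb
    simp [Finsupp.single_eq_of_ne hb]
  · simp

lemma weight_mono {μ μ' : σ → ℝ≥0∞} (h : ∀ b, μ b ≤ μ' b) (ω : σ →₀ ℕ) :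
    weight μ ω ≤ weight μ' ω :=
  Finset.prod_le_prod' fun b _ => pow_le_pow_left' (h b) _

lemma weight_ne_zero {μ : σ → ℝ≥0∞} (h : ∀ b, μ b ≠ 0) (ω : σ →₀ ℕ) : weight μ ω ≠ 0 :=
  Finset.prod_ne_zero_iff.2 fun b _ => pow_ne_zero _ (h b)

/-- An infinite radius excludes a variable: a series of finite norm cannot involve it, while zero
coefficients cost nothing because `0 * ∞ = 0`. The rings in fewer variables therefore all live in
one ambient ring, and inductions run over subsets `s` of `σ`. -/
lemma weight_eq_top {μ : σ → ℝ≥0∞} (h : ∀ b, μ b ≠ 0) {ω : σ →₀ ℕ} {b : σ} (hb : μ b = ∞)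
    (hω : ω b ≠ 0) : weight μ ω = ∞ := by
  classical
  rw [weight, ← Finset.mul_prod_erase _ _ (Finset.mem_univ b), hb, ENNReal.top_pow hω,
    ENNReal.top_mul]
  exact Finset.prod_ne_zero_iff.2 fun c _ => pow_ne_zero _ (h c)

lemma weight_ne_top {μ : σ → ℝ≥0∞} {ω : σ →₀ ℕ} (h : ∀ b, ω b ≠ 0 → μ b ≠ ∞) :
    weight μ ω ≠ ∞ := by
  refine ENNReal.prod_ne_top fun b _ => ?_
  by_cases hb : ω b = 0
  · simp [hb]
  · exact ENNReal.pow_ne_top (h b hb)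

lemma weight_scale (t : ℝ≥0∞) (l : σ → ℕ) (μ : σ → ℝ≥0∞) (ω : σ →₀ ℕ) :
    weight (fun b => t ^ l b * μ b) ω = t ^ (∑ b, l b * ω b) * weight μ ω := by
  simp [weight, mul_pow, Finset.prod_mul_distrib, ← Finset.prod_pow_eq_pow_sum, pow_mul]

/-- The norm `∑ ‖f_ω‖ μ ^ ω` of a power series on a polyradius `μ`. -/
noncomputable def seriesNorm (i : I) (μ : σ → ℝ≥0∞) (f : MvPowerSeries σ R) : ℝ≥0∞ :=
  ∑' ω, F.norm i (MvPowerSeries.coeff ω f) * weight μ ω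

lemma norm_coeff_mul_le (i : I) (μ : σ → ℝ≥0∞) (f : MvPowerSeries σ R) (ω : σ →₀ ℕ) :
    F.norm i (MvPowerSeries.coeff ω f) * weight μ ω ≤ F.seriesNorm i μ f :=
  ENNReal.le_tsum (f := fun ω => F.norm i (MvPowerSeries.coeff ω f) * weight μ ω) ω

lemma seriesNorm_mono {i j : I} (hij : ∀ x, F.norm j x ≤ F.norm i x) {μ μ' : σ → ℝ≥0∞}
    (h : ∀ b, μ' b ≤ μ b) (f : MvPowerSeries σ R) : F.seriesNorm j μ' f ≤ F.seriesNorm i μ f :=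
  ENNReal.tsum_le_tsum fun _ => mul_le_mul' (hij _) (weight_mono h _)

lemma seriesNorm_monomial (i : I) (μ : σ → ℝ≥0∞) (ω : σ →₀ ℕ) (r : R) :
    F.seriesNorm i μ (MvPowerSeries.monomial ω r) = F.norm i r * weight μ ω := by
  classical
  rw [seriesNorm, tsum_eq_single ω]
  · rw [MvPowerSeries.coeff_monomial_same]
  · intro ω' h
    rw [MvPowerSeries.coeff_monomial_ne h, norm_zero, zero_mul]

lemma seriesNorm_C (i : I) (μ : σ → ℝ≥0∞) (r : R) :
    F.seriesNorm i μ (MvPowerSeries.C r) = F.norm i r := by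
  rw [← MvPowerSeries.monomial_zero_eq_C_apply, seriesNorm_monomial, weight_zero, mul_one]

lemma seriesNorm_add_le (i : I) (μ : σ → ℝ≥0∞) (f g : MvPowerSeries σ R) :
    F.seriesNorm i μ (f + g) ≤ F.seriesNorm i μ f + F.seriesNorm i μ g := by
  rw [seriesNorm, seriesNorm, seriesNorm, ← ENNReal.tsum_add]
  refine ENNReal.tsum_le_tsum fun ω => ?_
  rw [← add_mul, map_add]
  exact mul_le_mul' (F.norm_add_le _ _ _) le_rfl

lemma seriesNorm_mul_le (i : I) (μ : σ → ℝ≥0∞) (f g : MvPowerSeries σ R) :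
    F.seriesNorm i μ (f * g) ≤ F.seriesNorm i μ f * F.seriesNorm i μ g := by
  classical
  rw [seriesNorm, seriesNorm, seriesNorm, ← tsum_sum_antidiagonal]
  refine ENNReal.tsum_le_tsum fun ω => ?_
  rw [MvPowerSeries.coeff_mul]
  refine (mul_le_mul' (F.norm_sum_le _ _ _) le_rfl).trans ?_
  rw [Finset.sum_mul]
  refine Finset.sum_le_sum fun x hx => ?_
  rw [← Finset.HasAntidiagonal.mem_antidiagonal.1 hx, weight_add]
  refine (mul_le_mul' (F.norm_mul_le _ _ _) le_rfl).trans (le_of_eq ?_)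
  ring

lemma eq_zero_of_seriesNorm {i : I} {μ : σ → ℝ≥0∞} (hμ : ∀ b, μ b ≠ 0) {f : MvPowerSeries σ R}
    (h : F.seriesNorm i μ f = 0) : f = 0 := by
  ext ω
  have := ENNReal.tsum_eq_zero.1 h ω
  rw [mul_eq_zero, or_iff_left (weight_ne_zero hμ ω)] at this
  exact F.eq_zero_of_norm i _ this

variable {F} in
lemma norm_coeff_ne_top {i : I} {μ : σ → ℝ≥0∞} (hμ : ∀ b, μ b ≠ 0) {f : MvPowerSeries σ R}
    (h : F.seriesNorm i μ f ≠ ∞) (ω : σ →₀ ℕ) : F.norm i (MvPowerSeries.coeff ω f) ≠ ∞ := by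
  intro h'
  refine ne_top_of_le_ne_top h (F.norm_coeff_mul_le i μ f ω) ?_
  rw [h', ENNReal.top_mul (weight_ne_zero hμ ω)]

/-- The limit is formed coefficient by coefficient. The tail estimates for the coefficients, summed
with weights and with the two sums exchanged, bound the error by the tail of `∑ ‖f_j‖`. -/
lemma exists_seriesNorm_tendsto {i : I} {μ : σ → ℝ≥0∞} (hμ : ∀ b, μ b ≠ 0)
    (f : ℕ → MvPowerSeries σ R) (hf : ∑' j, F.seriesNorm i μ (f j) ≠ ∞) :
    ∃ g, Filter.Tendsto (fun J => F.seriesNorm i μ (g - ∑ j ∈ Finset.range J, f j))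
      Filter.atTop (nhds 0) := by
  have hc : ∀ ω, ∑' j, F.norm i (MvPowerSeries.coeff ω (f j)) ≠ ∞ := fun ω h => by
    refine ne_top_of_le_ne_top hf
      (ENNReal.tsum_le_tsum fun j => F.norm_coeff_mul_le i μ (f j) ω) ?_
    rw [ENNReal.tsum_mul_right, h, ENNReal.top_mul (weight_ne_zero hμ ω)]
  choose g hg using fun ω => F.complete i _ (hc ω)
  refine ⟨show MvPowerSeries σ R from g, ?_⟩
  refine tendsto_of_tendsto_of_tendsto_of_le_of_le tendsto_const_nhds
    (ENNReal.tendsto_sum_nat_add _ hf) (fun _ => zero_le) fun J => ?_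
  calc F.seriesNorm i μ ((show MvPowerSeries σ R from g) - ∑ j ∈ Finset.range J, f j)
      ≤ ∑' ω, (∑' j, F.norm i (MvPowerSeries.coeff ω (f (j + J)))) * weight μ ω := by
        refine ENNReal.tsum_le_tsum fun ω => mul_le_mul' ?_ le_rfl
        have := norm_sub_sum_le (hg ω) J
        rw [map_sub, map_sum]
        exact this
    _ = ∑' j, F.seriesNorm i μ (f (j + J)) := by
        simp_rw [seriesNorm, ← ENNReal.tsum_mul_right]
        exact ENNReal.tsum_comm

/-- The elements are made small one after another. Each new index only decreases the norms, so what
was already small stays small. A weight `∞` is harmless where the element is `0`. -/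
lemma exists_sum_mul_lt {ι : Type*} (Z : Finset ι) (i : I) (x : ι → R) (c : ι → ℝ≥0∞)
    (hx : ∀ a ∈ Z, F.value (x a) = 0) (hfin : ∀ a ∈ Z, F.norm i (x a) ≠ ∞)
    (hc : ∀ a ∈ Z, c a = ∞ → x a = 0) {ε : ℝ≥0∞} (hε : ε ≠ 0) :
    ∃ j, (∀ y, F.norm j y ≤ F.norm i y) ∧ ∑ a ∈ Z, F.norm j (x a) * c a < ε := by
  classical
  induction Z using Finset.induction_on generalizing ε with
  | empty => exact ⟨i, fun _ => le_rfl, by simpa using hε.bot_lt⟩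
  | insert a Z ha ih =>
    obtain ⟨j, hj, hlt⟩ := ih (fun b hb => hx b (Finset.mem_insert_of_mem hb))
      (fun b hb => hfin b (Finset.mem_insert_of_mem hb))
      (fun b hb => hc b (Finset.mem_insert_of_mem hb)) (ENNReal.half_pos hε).ne'
    have haZ := Finset.mem_insert_self a Z
    have key : ∃ l, (∀ y, F.norm l y ≤ F.norm j y) ∧ F.norm l (x a) * c a < ε / 2 := by
      by_cases hca : c a = ∞
      · exact ⟨j, fun _ => le_rfl, by simpa [hc a haZ hca] using (ENNReal.half_pos hε)⟩
      · obtain ⟨l, hl, hlt⟩ := F.exists_small j (x a) (hx a haZ)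
          (ne_top_of_le_ne_top (hfin a haZ) (hj _)) (ε / 2 / c a)
          (ENNReal.div_ne_zero.2 ⟨(ENNReal.half_pos hε).ne', hca⟩)
        exact ⟨l, hl, ENNReal.mul_lt_of_lt_div hlt⟩
    obtain ⟨l, hl, hlt'⟩ := key
    refine ⟨l, fun y => (hl y).trans (hj y), ?_⟩
    rw [Finset.sum_insert ha, ← ENNReal.add_halves ε]
    refine ENNReal.add_lt_add hlt' (lt_of_le_of_lt ?_ hlt)
    exact Finset.sum_le_sum fun b _ => mul_le_mul' (hl _) le_rfl

lemma finite_weighted_degree_le {l : σ → ℕ} (hl : ∀ b, 0 < l b) (d : ℕ) :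
    {ω : σ →₀ ℕ | ∑ b, l b * ω b ≤ d}.Finite := by
  classical
  refine (Set.finite_Iic (Finsupp.equivFunOnFinite.symm fun _ : σ => d)).subset fun ω hω b => ?_
  simp only [Finsupp.equivFunOnFinite_symm_apply_apply]
  calc ω b ≤ l b * ω b := Nat.le_mul_of_pos_left _ (hl b)
    _ ≤ ∑ b, l b * ω b := Finset.single_le_sum (f := fun b => l b * ω b) (by simp) (Finset.mem_univ b)
    _ ≤ d := hω

/-- If the coefficients of weighted degree at most `d` of a series take the value `0`, then the norm
of the series is of smaller order than `t ^ d` along the polyradii `t ^ l * μ`. -/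
lemma exists_seriesNorm_lt {i : I} {μ : σ → ℝ≥0∞} (hμ : ∀ b, μ b ≠ 0) {f : MvPowerSeries σ R}
    (hf : F.seriesNorm i μ f ≠ ∞) {l : σ → ℕ} (hl : ∀ b, 0 < l b) (d : ℕ)
    (h : ∀ ω : σ →₀ ℕ, ∑ b, l b * ω b ≤ d → F.value (MvPowerSeries.coeff ω f) = 0)
    {δ : ℝ≥0∞} (hδ : δ ≠ 0) :
    ∃ (j : I) (t : ℝ≥0∞), t ≠ 0 ∧ t ≤ 1 ∧ (∀ y, F.norm j y ≤ F.norm i y) ∧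
      F.seriesNorm j (fun b => t ^ l b * μ b) f < δ * t ^ d := by
  -- First `t = 1 / n` with `t * ‖f‖ < δ / 2`: the terms of weighted degree above `d` gain `t ^ (d +
  -- 1)` and contribute less than `δ / 2 * t ^ d`.
  obtain ⟨n, hn, hlt⟩ := ENNReal.exists_nat_pos_inv_mul_lt hf (ENNReal.half_pos hδ).ne'
  set t : ℝ≥0∞ := (n : ℝ≥0∞)⁻¹ with ht
  have ht0 : t ≠ 0 := ENNReal.inv_ne_zero.2 (ENNReal.natCast_ne_top n)
  have ht1 : t ≤ 1 := ENNReal.inv_le_one.2 (by exact_mod_cast hn)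
  have htt : t ≠ ∞ := ne_top_of_le_ne_top ENNReal.one_ne_top ht1
  have htd : t ^ d ≠ 0 := pow_ne_zero _ ht0
  set Z := (finite_weighted_degree_le hl d).toFinset with hZ
  have hmem : ∀ ω, ω ∈ Z ↔ ∑ b, l b * ω b ≤ d := fun ω => by simp [hZ]
  -- With `t` fixed, only finitely many coefficients remain, all of value `0`; the index `j` makes
  -- their contribution small.
  obtain ⟨j, hj, hjlt⟩ := F.exists_sum_mul_lt Z i (fun ω => MvPowerSeries.coeff ω f)
    (fun ω => t ^ (∑ b, l b * ω b) * weight μ ω) (fun ω hω => h ω ((hmem ω).1 hω))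
    (fun ω _ => norm_coeff_ne_top hμ hf ω) (fun ω _ hω => by
      have h1 := ne_top_of_le_ne_top hf (F.norm_coeff_mul_le i μ f ω)
      have hw : weight μ ω = ∞ := by
        by_contra hw
        exact ENNReal.mul_ne_top (ENNReal.pow_ne_top htt) hw hω
      refine F.eq_zero_of_norm i _ ?_
      by_contra h0
      exact h1 (by rw [hw, ENNReal.mul_top h0]))
    (ε := δ / 2 * t ^ d) (mul_ne_zero (ENNReal.half_pos hδ).ne' htd)
  refine ⟨j, t, ht0, ht1, hj, ?_⟩
  have hsplit : F.seriesNorm j (fun b => t ^ l b * μ b) f ≤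
      ∑ ω ∈ Z, F.norm j (MvPowerSeries.coeff ω f) * (t ^ (∑ b, l b * ω b) * weight μ ω) +
        t ^ (d + 1) * F.seriesNorm i μ f := by
    classical
    have e : ∑ ω ∈ Z, F.norm j (MvPowerSeries.coeff ω f) *
        (t ^ (∑ b, l b * ω b) * weight μ ω) = ∑' ω, if ω ∈ Z then
          F.norm j (MvPowerSeries.coeff ω f) * (t ^ (∑ b, l b * ω b) * weight μ ω) else 0 := by
      rw [tsum_eq_sum (s := Z) (fun ω hω => by simp [hω])]
      exact Finset.sum_congr rfl fun ω hω => by simp [hω]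
    rw [e, seriesNorm, seriesNorm, ← ENNReal.tsum_mul_left, ← ENNReal.tsum_add]
    refine ENNReal.tsum_le_tsum fun ω => ?_
    rw [weight_scale]
    by_cases hω : ω ∈ Z
    · rw [if_pos hω]
      exact le_self_add
    · rw [if_neg hω, zero_add]
      rw [hmem, not_le] at hω
      calc _ ≤ F.norm i (MvPowerSeries.coeff ω f) * (t ^ (d + 1) * weight μ ω) := by
            exact mul_le_mul' (hj _) (mul_le_mul' (pow_le_pow_of_le_one zero_le ht1 hω) le_rfl)
        _ = _ := by ring
  refine hsplit.trans_lt ?_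
  rw [← ENNReal.add_halves δ, add_mul]
  refine ENNReal.add_lt_add hjlt ?_
  rw [pow_succ, mul_assoc, mul_comm (t ^ d)]
  exact (ENNReal.mul_lt_mul_iff_left htd (ENNReal.pow_ne_top htt)).2 hlt

/-- The norms `∑ ‖f_ω‖ μ ^ ω` on the power series in the variables of `s`. -/
noncomputable def series (s : Finset σ) : NormFamily (MvPowerSeries σ R) (I × Polyradius s) where
  norm i f := F.seriesNorm i.1 i.2.1 f
  nonempty := by
    classical
    exact ⟨F.nonempty.some, fun b => if b ∈ s then 1 else ∞, fun b => by
      by_cases hb : b ∈ s <;> simp [hb]⟩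
  directed i j := by
    obtain ⟨l, h1, h2⟩ := F.directed i.1 j.1
    refine ⟨⟨l, fun b => min (i.2.1 b) (j.2.1 b), fun b => ⟨?_, ?_⟩⟩,
      fun f => F.seriesNorm_mono h1 (fun b => min_le_left _ _) f,
      fun f => F.seriesNorm_mono h2 (fun b => min_le_right _ _) f⟩
    · change min (i.2.1 b) (j.2.1 b) ≠ 0
      rcases min_choice (i.2.1 b) (j.2.1 b) with h | h <;> rw [h]
      exacts [(i.2.2 b).1, (j.2.2 b).1]
    · change min (i.2.1 b) (j.2.1 b) = ∞ ↔ _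
      rw [min_eq_top, (i.2.2 b).2, (j.2.2 b).2, and_self]
  norm_add_le i f g := F.seriesNorm_add_le _ _ f g
  norm_mul_le i f g := F.seriesNorm_mul_le _ _ f g
  eq_zero_of_norm i f h := F.eq_zero_of_seriesNorm (fun b => (i.2.2 b).1) h
  complete i f hf := F.exists_seriesNorm_tendsto (fun b => (i.2.2 b).1) f hf
  value := F.value.comp MvPowerSeries.constantCoeff
  const := MvPowerSeries.C.comp F.const
  value_const c := by simp [F.value_const]
  norm_const_le i c := by
    rw [RingHom.comp_apply, seriesNorm_C]
    exact F.norm_const_le i.1 c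
  enorm_value_le i f := by
    refine (F.enorm_value_le i.1 _).trans ?_
    have := F.norm_coeff_mul_le i.1 i.2.1 f 0
    rwa [weight_zero, mul_one] at this
  exists_small i f h0 hf δ hδ := by
    obtain ⟨j, t, ht0, ht1, hj, hlt⟩ := F.exists_seriesNorm_lt (fun b => (i.2.2 b).1) hf
      (l := fun _ => 1) (fun _ => one_pos) 0 (fun ω hω => by
        have : ω = 0 := by
          ext b
          have := Finset.sum_eq_zero_iff.1 (Nat.le_zero.1 hω) b (Finset.mem_univ b)
          simpa using this
        rw [this]
        exact h0) hδ
    have htt : t ≠ ∞ := ne_top_of_le_ne_top ENNReal.one_ne_top ht1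
    refine ⟨⟨j, fun b => t ^ 1 * i.2.1 b, fun b => ⟨?_, ?_⟩⟩, fun f => ?_, by simpa using hlt⟩
    · exact mul_ne_zero (pow_ne_zero _ ht0) (i.2.2 b).1
    · rw [← (i.2.2 b).2, ENNReal.mul_eq_top]
      simp [ht0, htt]
    · refine F.seriesNorm_mono hj (fun b => ?_) f
      change t ^ 1 * i.2.1 b ≤ i.2.1 b
      rw [pow_one]
      exact (mul_le_mul' ht1 le_rfl).trans (one_mul _).le

/-- The ring of convergent power series in the variables of `s`. -/
noncomputable abbrev conv (s : Finset σ) : Subring (MvPowerSeries σ R) := (F.series s).fin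

end NormFamily

/-! ### Weierstrass division -/

namespace NormFamily

variable {R I σ : Type} [CommRing R]

open MvPowerSeries in
/-- The part of a power series with exponents satisfying `p`. -/
def restrictExponents (p : (σ →₀ ℕ) → Prop) [DecidablePred p] (f : MvPowerSeries σ R) :
    MvPowerSeries σ R := fun ω => if p ω then coeff ω f else 0

lemma coeff_restrictExponents (p : (σ →₀ ℕ) → Prop) [DecidablePred p] (f : MvPowerSeries σ R)
    (ω : σ →₀ ℕ) : MvPowerSeries.coeff ω (restrictExponents p f) =
      if p ω then MvPowerSeries.coeff ω f else 0 := rfl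

/-- The power series with coefficients `f_{ω + d e_a}`. -/
noncomputable def shift (a : σ) (d : ℕ) : MvPowerSeries σ R →+ MvPowerSeries σ R where
  toFun f := fun ω => MvPowerSeries.coeff (ω + Finsupp.single a d) f
  map_zero' := rfl
  map_add' _ _ := rfl

lemma coeff_shift (a : σ) (d : ℕ) (f : MvPowerSeries σ R) (ω : σ →₀ ℕ) :
    MvPowerSeries.coeff ω (shift a d f) = MvPowerSeries.coeff (ω + Finsupp.single a d) f := rfl

lemma coeff_X_pow_mul (a : σ) (d : ℕ) (f : MvPowerSeries σ R) (ω : σ →₀ ℕ) :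
    MvPowerSeries.coeff (ω + Finsupp.single a d) (MvPowerSeries.X a ^ d * f) =
      MvPowerSeries.coeff ω f := by
  rw [MvPowerSeries.X_pow_eq, add_comm, MvPowerSeries.coeff_add_monomial_mul, one_mul]

lemma coeff_X_pow_mul_of_lt {a : σ} {d : ℕ} (f : MvPowerSeries σ R) {ω : σ →₀ ℕ} (h : ω a < d) :
    MvPowerSeries.coeff ω (MvPowerSeries.X a ^ d * f) = 0 := by
  rw [MvPowerSeries.X_pow_eq, MvPowerSeries.coeff_monomial_mul, if_neg]
  intro hle
  have := hle a
  rw [Finsupp.single_eq_same] at this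
  omega

lemma exists_eq_add_single {ω : σ →₀ ℕ} {a : σ} {d : ℕ} (h : d ≤ ω a) :
    ∃ ω', ω = ω' + Finsupp.single a d :=
  ⟨ω - Finsupp.single a d, (tsub_add_cancel_of_le (Finsupp.single_le_iff.2 h)).symm⟩

lemma eq_restrictExponents_add_shift (a : σ) (d : ℕ) (f : MvPowerSeries σ R) :
    f = restrictExponents (fun ω => ω a < d) f + MvPowerSeries.X a ^ d * shift a d f := by
  ext ω
  rw [map_add, coeff_restrictExponents]
  split_ifs with h
  · rw [coeff_X_pow_mul_of_lt _ h, add_zero]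
  · obtain ⟨ω', rfl⟩ := exists_eq_add_single (not_lt.1 h)
    rw [coeff_X_pow_mul, coeff_shift, zero_add]

/-- The coefficients of a product along a coordinate axis. -/
lemma coeff_single_mul [DecidableEq σ] (a : σ) (j : ℕ) (f g : MvPowerSeries σ R) :
    MvPowerSeries.coeff (Finsupp.single a j) (f * g) =
      ∑ x ∈ Finset.HasAntidiagonal.antidiagonal j, MvPowerSeries.coeff (Finsupp.single a x.1) f *
        MvPowerSeries.coeff (Finsupp.single a x.2) g := by
  rw [MvPowerSeries.coeff_mul, Finsupp.antidiagonal_single, Finset.sum_map]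
  rfl

variable [Fintype σ] {F : NormFamily R I} {s : Finset σ}

lemma seriesNorm_restrictExponents_le (p : (σ →₀ ℕ) → Prop) [DecidablePred p] (i : I)
    (μ : σ → ℝ≥0∞) (f : MvPowerSeries σ R) :
    F.seriesNorm i μ (restrictExponents p f) ≤ F.seriesNorm i μ f := by
  refine ENNReal.tsum_le_tsum fun ω => ?_
  rw [coeff_restrictExponents]
  split_ifs
  · exact le_rfl
  · simp

lemma seriesNorm_shift_mul_le (a : σ) (d : ℕ) (i : I) (μ : σ → ℝ≥0∞) (f : MvPowerSeries σ R) :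
    F.seriesNorm i μ (shift a d f) * μ a ^ d ≤ F.seriesNorm i μ f := by
  rw [seriesNorm, seriesNorm, ← ENNReal.tsum_mul_right]
  have hinj : Function.Injective fun ω : σ →₀ ℕ => ω + Finsupp.single a d :=
    add_left_injective _
  refine le_trans (le_of_eq ?_) (ENNReal.tsum_comp_le_tsum_of_injective hinj _)
  refine tsum_congr fun ω => ?_
  rw [coeff_shift, weight_add, weight_single, mul_assoc]

lemma mem_conv {f : MvPowerSeries σ R} :
    f ∈ F.conv s ↔ ∃ (i : I) (μ : σ → ℝ≥0∞),
      (∀ b, μ b ≠ 0 ∧ (μ b = ∞ ↔ b ∉ s)) ∧ F.seriesNorm i μ f ≠ ∞ :=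
  ⟨fun ⟨i, hi⟩ => ⟨i.1, i.2.1, i.2.2, hi⟩, fun ⟨i, μ, hμ, h⟩ => ⟨⟨i, ⟨μ, hμ⟩⟩, h⟩⟩

lemma restrictExponents_mem_conv (p : (σ →₀ ℕ) → Prop) [DecidablePred p]
    {f : MvPowerSeries σ R} (hf : f ∈ F.conv s) : restrictExponents p f ∈ F.conv s := by
  obtain ⟨i, hi⟩ := hf
  exact ⟨i, ne_top_of_le_ne_top hi (seriesNorm_restrictExponents_le p _ _ f)⟩

lemma shift_mem_conv {a : σ} (d : ℕ) {f : MvPowerSeries σ R}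
    (hf : f ∈ F.conv s) : shift a d f ∈ F.conv s := by
  obtain ⟨i, hi⟩ := hf
  refine ⟨i, fun h => ?_⟩
  have h1 := seriesNorm_shift_mul_le (F := F) a d i.1 i.2.1 f
  change F.seriesNorm i.1 i.2.1 (shift a d f) = ∞ at h
  rw [h, ENNReal.top_mul (pow_ne_zero _ (i.2.2 a).1), top_le_iff] at h1
  exact hi h1

lemma monomial_mem_conv {ω : σ →₀ ℕ} (hω : ∀ b, ω b ≠ 0 → b ∈ s) {r : R} (hr : r ∈ F.fin) :
    MvPowerSeries.monomial ω r ∈ F.conv s := by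
  classical
  obtain ⟨i, hi⟩ := hr
  refine mem_conv.2 ⟨i, fun b => if b ∈ s then 1 else ∞, fun b => ?_, ?_⟩
  · by_cases hb : b ∈ s <;> simp [hb]
  · rw [seriesNorm_monomial]
    refine ENNReal.mul_ne_top hi (weight_ne_top fun b hb => ?_)
    simp [hω b hb]

lemma X_mem_conv {a : σ} (ha : a ∈ s) : (MvPowerSeries.X a : MvPowerSeries σ R) ∈ F.conv s := by
  classical
  refine monomial_mem_conv (fun b hb => ?_) (one_mem _)
  rw [Finsupp.single_apply] at hb
  obtain rfl : a = b := by
    by_contra h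
    simp [h] at hb
  exact ha

lemma C_mem_conv {r : R} (hr : r ∈ F.fin) : MvPowerSeries.C r ∈ F.conv s := by
  rw [← MvPowerSeries.monomial_zero_eq_C_apply]
  exact monomial_mem_conv (by simp) hr

lemma coeff_mem_fin {f : MvPowerSeries σ R} (hf : f ∈ F.conv s) (ω : σ →₀ ℕ) :
    MvPowerSeries.coeff ω f ∈ F.fin := by
  obtain ⟨i, hi⟩ := hf
  exact ⟨i.1, norm_coeff_ne_top (fun b => (i.2.2 b).1) hi ω⟩

lemma coeff_eq_zero_of_mem_conv {f : MvPowerSeries σ R} (hf : f ∈ F.conv s) {ω : σ →₀ ℕ} {b : σ}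
    (hb : b ∉ s) (hω : ω b ≠ 0) : MvPowerSeries.coeff ω f = 0 := by
  obtain ⟨i, hi⟩ := hf
  refine F.eq_zero_of_norm i.1 _ ?_
  by_contra h0
  refine ne_top_of_le_ne_top hi (F.norm_coeff_mul_le i.1 i.2.1 f ω) ?_
  rw [weight_eq_top (fun b => (i.2.2 b).1) ((i.2.2 b).2.2 hb) hω, ENNReal.mul_top h0]

/-- Raising the radius of a variable that does not occur in `f` to `∞` leaves the norm unchanged. -/
lemma mem_conv_erase [DecidableEq σ] {f : MvPowerSeries σ R} (hf : f ∈ F.conv s) {a : σ}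
    (h : ∀ ω : σ →₀ ℕ, ω a ≠ 0 → MvPowerSeries.coeff ω f = 0) : f ∈ F.conv (s.erase a) := by
  obtain ⟨i, μ, hμ, hi⟩ := mem_conv.1 hf
  refine mem_conv.2 ⟨i, Function.update μ a ∞, fun b => ?_, ne_top_of_le_ne_top hi ?_⟩
  · by_cases hb : b = a
    · subst hb
      simp
    · simpa [hb] using hμ b
  · refine ENNReal.tsum_le_tsum fun ω => ?_
    by_cases hω : ω a = 0
    · refine mul_le_mul' le_rfl (le_of_eq (Finset.prod_congr rfl fun b _ => ?_))
      by_cases hb : b = a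
      · subst hb
        simp [hω]
      · simp [hb]
    · simp [h ω hω]

lemma conv_mono {t : Finset σ} (h : s ⊆ t) : F.conv s ≤ F.conv t := by
  classical
  intro f hf
  obtain ⟨i, μ, hμ, hi⟩ := mem_conv.1 hf
  -- The minimum with `1` gives the variables of `t` outside `s`, where `μ b = ∞`, a finite radius.
  refine mem_conv.2 ⟨i, fun b => if b ∈ t then min (μ b) 1 else ∞, fun b => ?_,
    ne_top_of_le_ne_top hi (F.seriesNorm_mono (fun _ => le_rfl) (fun b => ?_) f)⟩
  · by_cases hb : b ∈ t
    · have := (hμ b).1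
      simp only [if_pos hb]
      refine ⟨?_, ?_⟩
      · rcases min_choice (μ b) 1 with h | h <;> rw [h]
        exacts [this, one_ne_zero]
      · simp [hb]
    · simp [hb]
  · split_ifs with hb
    · exact min_le_left _ _
    · rw [(hμ b).2.2 fun hs => hb (h hs)]

/-- **Weierstrass division** by a power series that is regular in the variable `X a`. -/
theorem exists_weierstrass_division {a : σ} (ha : a ∈ s) {f : MvPowerSeries σ R}
    (hf : f ∈ F.conv s) {d : ℕ}
    (h0 : ∀ j < d, F.value (MvPowerSeries.coeff (Finsupp.single a j) f) = 0)
    (hd : F.value (MvPowerSeries.coeff (Finsupp.single a d) f) ≠ 0)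
    {g : MvPowerSeries σ R} (hg : g ∈ F.conv s) :
    ∃ q ∈ F.conv s, ∃ r ∈ F.conv s, g = q * f + r ∧
      ∀ ω : σ →₀ ℕ, d ≤ ω a → MvPowerSeries.coeff ω r = 0 := by
  classical
  -- Write `f = low + X_a ^ d * u`. The constant term of `u` is the coefficient of `X_a ^ d` in `f`,
  -- so `u` is a unit and `u' * f = X_a ^ d + p` with `p = u' * low`. On the `X_a`-axis all
  -- coefficients of `p` have value `0`.
  obtain ⟨u', hu', huu'⟩ := exists_mul_eq_one (F := F.series s) (shift_mem_conv (a := a) d hf) (by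
    change F.value (MvPowerSeries.coeff 0 (shift a d f)) ≠ 0
    rwa [coeff_shift, zero_add])
  set low := restrictExponents (fun ω => ω a < d) f with hlow
  set p := u' * low with hp
  have hpmem : p ∈ F.conv s := mul_mem hu' (restrictExponents_mem_conv _ hf)
  have hp0 : ∀ j, F.value (MvPowerSeries.coeff (Finsupp.single a j) p) = 0 := fun j => by
    rw [hp, coeff_single_mul, map_sum]
    refine Finset.sum_eq_zero fun x _ => ?_
    rw [map_mul, hlow, coeff_restrictExponents]
    split_ifs with hx
    · rw [Finsupp.single_eq_same] at hx
      rw [h0 _ hx, mul_zero]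
    · simp
  obtain ⟨⟨i, ⟨μ, hμ⟩⟩, hip, hig⟩ := exists_common hpmem hg
  change F.seriesNorm i μ p ≠ ∞ at hip
  change F.seriesNorm i μ g ≠ ∞ at hig
  have hμa : μ a ≠ ∞ := fun h => ((hμ a).2.1 h) ha
  -- Give `X_a` weight `1` and the other variables weight `d + 1`: the monomials of weighted degree
  -- at most `d` are then powers of `X_a`, where `p` has coefficients of value `0`. The result is
  -- `‖p‖ < ν_a ^ d` for the shrunken polyradius `ν`.
  obtain ⟨j, t, ht0, ht1, hj, hlt⟩ := F.exists_seriesNorm_lt (fun b => (hμ b).1) hip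
    (l := fun b => if b = a then 1 else d + 1) (fun b => by split_ifs <;> omega) d (fun ω hω => by
      have : ω = Finsupp.single a (ω a) := by
        ext b
        by_cases hb : b = a
        · rw [hb, Finsupp.single_eq_same]
        · rw [Finsupp.single_eq_of_ne hb]
          by_contra hne
          have h1 := Finset.single_le_sum (f := fun b => (if b = a then 1 else d + 1) * ω b)
            (fun _ _ => Nat.zero_le _) (Finset.mem_univ b)
          simp only [hb, if_false] at h1
          have h2 : d + 1 ≤ (d + 1) * ω b := Nat.le_mul_of_pos_right _ (Nat.pos_of_ne_zero hne)
          omega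
      rw [this]
      exact hp0 _) (pow_ne_zero d (hμ a).1)
  have htt : t ≠ ∞ := ne_top_of_le_ne_top ENNReal.one_ne_top ht1
  set ν : σ → ℝ≥0∞ := fun b => t ^ (if b = a then 1 else d + 1) * μ b with hν
  have hνle : ∀ b, ν b ≤ μ b := fun b =>
    (mul_le_mul' (pow_le_one' ht1 _) le_rfl).trans (one_mul _).le
  have hνmem : ∀ b, ν b ≠ 0 ∧ (ν b = ∞ ↔ b ∉ s) := fun b => by
    refine ⟨mul_ne_zero (pow_ne_zero _ ht0) (hμ b).1, ?_⟩
    rw [← (hμ b).2, hν, ENNReal.mul_eq_top]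
    have h1 := ENNReal.pow_ne_top (n := if b = a then 1 else d + 1) htt
    have h2 := pow_ne_zero (if b = a then 1 else d + 1) ht0
    simp only [ne_eq, h1, h2, not_false_eq_true, true_and, false_and, or_false]
  have hνa : ν a ^ d = μ a ^ d * t ^ d := by
    simp [hν, mul_pow, mul_comm]
  have hνa0 : ν a ^ d ≠ 0 := pow_ne_zero _ (hνmem a).1
  have hνat : ν a ^ d ≠ ∞ := ENNReal.pow_ne_top (ne_top_of_le_ne_top hμa (hνle a))
  rw [← hνa] at hlt
  -- Dividing `g` by `X_a ^ d + p` with quotient `v` amounts to `v = shift g - shift (v * p)`. The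
  -- shift costs a factor `1 / ν_a ^ d`, so `T` contracts by `‖p‖ / ν_a ^ d < 1`. The quotient by
  -- `f` is then `u' * v`.
  let T : MvPowerSeries σ R →+ MvPowerSeries σ R :=
    -((shift a d).comp (AddMonoidHom.mulRight p))
  have hTv : ∀ v, T v = -shift a d (v * p) := fun v => rfl
  obtain ⟨v, hv, hveq⟩ := exists_eq_add_apply (F := F.series s) (i := (j, ⟨ν, hνmem⟩)) T
    (θ := F.seriesNorm j ν p / ν a ^ d)
    (ENNReal.div_lt_of_lt_mul (by rwa [one_mul]))
    (fun v => by
      change F.seriesNorm j ν (T v) ≤ _ * F.seriesNorm j ν v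
      have h1 : F.seriesNorm j ν (T v) = F.seriesNorm j ν (shift a d (v * p)) :=
        (F.series s).norm_neg (j, ⟨ν, hνmem⟩) (shift a d (v * p))
      have h2 := (seriesNorm_shift_mul_le (F := F) a d j ν (v * p)).trans
        (F.seriesNorm_mul_le j ν v p)
      rw [h1]
      rw [← ENNReal.le_div_iff_mul_le (Or.inl hνa0) (Or.inl hνat)] at h2
      refine h2.trans (le_of_eq ?_)
      rw [div_eq_mul_inv, div_eq_mul_inv]
      ring)
    (x := shift a d g) (by
      change F.seriesNorm j ν (shift a d g) ≠ ∞
      intro h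
      have h1 := seriesNorm_shift_mul_le (F := F) a d j ν g
      rw [h, ENNReal.top_mul hνa0, top_le_iff] at h1
      exact ne_top_of_le_ne_top hig (F.seriesNorm_mono hj hνle g) h1)
  have hvmem : v ∈ F.conv s := ⟨_, hv⟩
  refine ⟨u' * v, mul_mem hu' hvmem, g - u' * v * f,
    sub_mem hg (mul_mem (mul_mem hu' hvmem) hf), by ring, fun ω hω => ?_⟩
  obtain ⟨ω', rfl⟩ := exists_eq_add_single hω
  have e : u' * v * f = v * p + MvPowerSeries.X a ^ d * v := by
    conv_lhs => rw [eq_restrictExponents_add_shift a d f, ← hlow]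
    rw [hp]
    linear_combination (MvPowerSeries.X a ^ d * v) * huu'
  have h1 := congrArg (MvPowerSeries.coeff ω') hveq
  rw [hTv, map_add, map_neg, coeff_shift, coeff_shift] at h1
  rw [e, map_sub, map_add, coeff_X_pow_mul, h1]
  ring

/-- Modulo a power series that is regular in the variable `X a`, every convergent power series is a
polynomial in `X a` with coefficients in the other variables. -/
theorem exists_eq_mul_add_sum [DecidableEq σ] {a : σ} (ha : a ∈ s) {f : MvPowerSeries σ R}
    (hf : f ∈ F.conv s) {d : ℕ}
    (h0 : ∀ j < d, F.value (MvPowerSeries.coeff (Finsupp.single a j) f) = 0)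
    (hd : F.value (MvPowerSeries.coeff (Finsupp.single a d) f) ≠ 0)
    {g : MvPowerSeries σ R} (hg : g ∈ F.conv s) :
    ∃ q ∈ F.conv s, ∃ c : ℕ → MvPowerSeries σ R, (∀ j, c j ∈ F.conv (s.erase a)) ∧
      g = q * f + ∑ j ∈ Finset.range d, c j * MvPowerSeries.X a ^ j := by
  obtain ⟨q, hq, r, hr, hgr, hr0⟩ := exists_weierstrass_division ha hf h0 hd hg
  refine ⟨q, hq, fun j => restrictExponents (fun ω => ω a = 0) (shift a j r), fun j => ?_, ?_⟩
  · refine mem_conv_erase (restrictExponents_mem_conv _ (shift_mem_conv j hr)) fun ω hω => ?_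
    rw [coeff_restrictExponents, if_neg hω]
  · rw [hgr]
    congr 1
    ext ω
    rw [map_sum]
    have hterm : ∀ j, MvPowerSeries.coeff ω (restrictExponents (fun ω => ω a = 0) (shift a j r) *
        MvPowerSeries.X a ^ j) = if ω a = j then MvPowerSeries.coeff ω r else 0 := fun j => by
      rw [mul_comm]
      rcases lt_or_ge (ω a) j with h | h
      · rw [coeff_X_pow_mul_of_lt _ h, if_neg h.ne]
      · obtain ⟨ω', rfl⟩ := exists_eq_add_single h
        rw [coeff_X_pow_mul, coeff_restrictExponents, coeff_shift]
        simp
    rw [Finset.sum_congr rfl fun j _ => hterm j, Finset.sum_ite_eq]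
    split_ifs with h
    · rfl
    · exact hr0 ω (by simpa using h)

end NormFamily

/-! ### Shears, regularity and finiteness of hypersurface quotients -/

namespace NormFamily

section shear

variable {R σ : Type} [CommRing R]

/-- The linear forms `X b + c b * X a` of a shear in the direction of the variable `X a`. -/
noncomputable def shearVar (a : σ) (c : σ → R) (b : σ) : MvPowerSeries σ R :=
  MvPowerSeries.X b + MvPowerSeries.C (c b) * MvPowerSeries.X a

/-- The restriction of a power series to a coordinate axis. -/
noncomputable def axis (a : σ) : MvPowerSeries σ R →+* PowerSeries R where
  toFun f := PowerSeries.mk fun j => MvPowerSeries.coeff (Finsupp.single a j) f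
  map_one' := by
    classical
    ext j
    rw [PowerSeries.coeff_mk, MvPowerSeries.coeff_one, PowerSeries.coeff_one]
    simp
  map_zero' := rfl
  map_add' _ _ := rfl
  map_mul' f g := by
    classical
    ext j
    rw [PowerSeries.coeff_mk, coeff_single_mul, PowerSeries.coeff_mul]
    simp

lemma coeff_axis (a : σ) (f : MvPowerSeries σ R) (j : ℕ) :
    PowerSeries.coeff j (axis a f) = MvPowerSeries.coeff (Finsupp.single a j) f :=
  PowerSeries.coeff_mk j fun j => MvPowerSeries.coeff (Finsupp.single a j) f

lemma axis_C (a : σ) (r : R) : axis a (MvPowerSeries.C r) = PowerSeries.C r := by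
  classical
  ext j
  rw [coeff_axis, MvPowerSeries.coeff_C, PowerSeries.coeff_C]
  simp

lemma axis_X_self (a : σ) : axis a (MvPowerSeries.X a : MvPowerSeries σ R) = PowerSeries.X := by
  classical
  ext j
  rw [coeff_axis, MvPowerSeries.coeff_X, PowerSeries.coeff_X]
  simp only [(Finsupp.single_injective a).eq_iff]

lemma axis_X_of_ne {a b : σ} (h : b ≠ a) :
    axis a (MvPowerSeries.X b : MvPowerSeries σ R) = 0 := by
  classical
  ext j
  rw [coeff_axis, MvPowerSeries.coeff_X, if_neg, map_zero]
  intro h'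
  have := DFunLike.congr_fun h' b
  rw [Finsupp.single_eq_same, Finsupp.single_eq_of_ne h] at this
  omega

lemma axis_shearVar [DecidableEq σ] (a : σ) {c : σ → R} (hc : c a = 0) (b : σ) :
    axis a (shearVar a c b) = PowerSeries.C (if b = a then 1 else c b) * PowerSeries.X := by
  rw [shearVar, map_add, map_mul, axis_C, axis_X_self]
  split_ifs with h
  · subst h
    simp [axis_X_self, hc]
  · rw [axis_X_of_ne h, zero_add]

variable [Fintype σ]

lemma hasSubst_shearVar (a : σ) (c : σ → R) : MvPowerSeries.HasSubst (shearVar a c) :=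
  MvPowerSeries.hasSubst_of_constantCoeff_zero fun b => by simp [shearVar]

/-- The substitution `X b ↦ X b + c b * X a`. -/
noncomputable def shear (a : σ) (c : σ → R) : MvPowerSeries σ R →ₐ[R] MvPowerSeries σ R :=
  MvPowerSeries.substAlgHom (hasSubst_shearVar a c)

lemma shear_C (a : σ) (c : σ → R) (r : R) : shear a c (MvPowerSeries.C r) = MvPowerSeries.C r :=
  (shear a c).commutes r

lemma shear_X (a : σ) (c : σ → R) (b : σ) : shear a c (MvPowerSeries.X b) = shearVar a c b :=
  MvPowerSeries.substAlgHom_X _ b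

/-- Because `c a = 0`, both shears fix `X a`, and the two multiples of `X a` added to `X b` cancel.
-/
lemma shear_neg_shear (a : σ) {c : σ → R} (hc : c a = 0) (f : MvPowerSeries σ R) :
    shear a (-c) (shear a c f) = f := by
  rw [shear, shear, MvPowerSeries.substAlgHom_comp_substAlgHom_apply,
    MvPowerSeries.substAlgHom_apply]
  have : (fun b => MvPowerSeries.substAlgHom (hasSubst_shearVar a (-c)) (shearVar a c b)) =
      (MvPowerSeries.X : σ → MvPowerSeries σ R) := by
    funext b
    change shear a (-c) (shearVar a c b) = _
    rw [shearVar, map_add, map_mul, shear_C, shear_X, shear_X, shearVar, shearVar, Pi.neg_apply,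
      Pi.neg_apply, hc]
    simp
  rw [this, MvPowerSeries.subst_self]
  rfl

lemma coeff_shear (a : σ) (c : σ → R) (f : MvPowerSeries σ R) (e : σ →₀ ℕ) :
    MvPowerSeries.coeff e (shear a c f) = ∑ᶠ ω : σ →₀ ℕ, MvPowerSeries.coeff ω f *
      MvPowerSeries.coeff e (∏ b, shearVar a c b ^ ω b) := by
  rw [shear, MvPowerSeries.substAlgHom_apply,
    MvPowerSeries.coeff_subst (hasSubst_shearVar a c)]
  refine finsum_congr fun ω => ?_
  rw [smul_eq_mul, Finsupp.prod_fintype _ _ fun b => pow_zero _]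

/-- On the axis every substituted form is a multiple of `X`, so a monomial becomes its value at the
point `(c, 1 at a)` times `X ^ |ω|`. Only the part of degree `d` of a series thus reaches the
coefficient of `X_a ^ d`. -/
lemma coeff_single_prod_shearVar [DecidableEq σ] (a : σ) {c : σ → R} (hc : c a = 0)
    (ω : σ →₀ ℕ) (d : ℕ) :
    MvPowerSeries.coeff (Finsupp.single a d) (∏ b, shearVar a c b ^ ω b) =
      if ω.degree = d then ∏ b, (if b = a then 1 else c b) ^ ω b else 0 := by
  rw [← coeff_axis, map_prod]
  simp_rw [map_pow, axis_shearVar a hc, mul_pow, Finset.prod_mul_distrib, ← map_pow, ← map_prod]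
  rw [Finset.prod_pow_eq_pow_sum, PowerSeries.coeff_C_mul_X_pow, Finsupp.degree_eq_sum]
  simp [eq_comm]

end shear

variable {R I σ : Type} [CommRing R] [Fintype σ] {F : NormFamily R I} {s : Finset σ}

/-- The hypothesis bounds the norm of each substituted form by `μ b`; submultiplicativity bounds the
image of a monomial by its weight at `μ`, and the double sum is rearranged. -/
lemma seriesNorm_shear_le (a : σ) (c : σ → R) (i : I) {μ ν : σ → ℝ≥0∞}
    (h : ∀ b, ν b + F.norm i (c b) * ν a ≤ μ b) (f : MvPowerSeries σ R) :
    F.seriesNorm i ν (shear a c f) ≤ F.seriesNorm i μ f := by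
  classical
  have hX : ∀ b, F.seriesNorm i ν (MvPowerSeries.X b) ≤ ν b := fun b => by
    rw [MvPowerSeries.X, seriesNorm_monomial, weight_single, pow_one]
    exact (mul_le_mul' (F.norm_one_le i) le_rfl).trans (one_mul _).le
  have hv : ∀ b, F.seriesNorm i ν (shearVar a c b) ≤ μ b := fun b => by
    refine (F.seriesNorm_add_le i ν _ _).trans (le_trans (add_le_add (hX b) ?_) (h b))
    refine (F.seriesNorm_mul_le i ν _ _).trans (mul_le_mul' ?_ (hX a))
    rw [seriesNorm_C]
  have hone : F.seriesNorm i ν 1 ≤ 1 := by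
    rw [← map_one (MvPowerSeries.C (σ := σ) (R := R)), seriesNorm_C]
    exact F.norm_one_le i
  have hpow : ∀ b n, F.seriesNorm i ν (shearVar a c b ^ n) ≤ μ b ^ n := fun b n => by
    induction n with
    | zero => simpa using hone
    | succ n ih =>
      rw [pow_succ, pow_succ]
      exact (F.seriesNorm_mul_le i ν _ _).trans (mul_le_mul' ih (hv b))
  have hprod : ∀ (ω : σ →₀ ℕ) (Z : Finset σ), F.seriesNorm i ν (∏ b ∈ Z, shearVar a c b ^ ω b) ≤
      ∏ b ∈ Z, μ b ^ ω b := fun ω Z => by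
    induction Z using Finset.induction_on with
    | empty => simpa using hone
    | insert b Z hb ih =>
      rw [Finset.prod_insert hb, Finset.prod_insert hb]
      exact (F.seriesNorm_mul_le i ν _ _).trans (mul_le_mul' (hpow b _) ih)
  calc F.seriesNorm i ν (shear a c f)
      ≤ ∑' e, (∑' ω : σ →₀ ℕ, F.norm i (MvPowerSeries.coeff ω f) *
          F.norm i (MvPowerSeries.coeff e (∏ b, shearVar a c b ^ ω b))) * weight ν e := by
        refine ENNReal.tsum_le_tsum fun e => mul_le_mul' ?_ le_rfl
        rw [coeff_shear]
        by_cases hfin : (Function.support fun ω : σ →₀ ℕ => MvPowerSeries.coeff ω f *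
            MvPowerSeries.coeff e (∏ b, shearVar a c b ^ ω b)).Finite
        · rw [finsum_eq_sum _ hfin]
          refine (F.norm_sum_le i _ _).trans (le_trans ?_ (ENNReal.sum_le_tsum hfin.toFinset))
          exact Finset.sum_le_sum fun ω _ => F.norm_mul_le i _ _
        -- A `finsum` of infinite support is `0` by convention, so the estimate needs no finiteness
        -- proof.
        · rw [finsum_of_infinite_support hfin, norm_zero]
          exact zero_le
    _ = ∑' ω : σ →₀ ℕ, F.norm i (MvPowerSeries.coeff ω f) *
          F.seriesNorm i ν (∏ b, shearVar a c b ^ ω b) := by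
        simp_rw [← ENNReal.tsum_mul_right]
        rw [ENNReal.tsum_comm]
        refine tsum_congr fun ω => ?_
        rw [seriesNorm, ← ENNReal.tsum_mul_left]
        refine tsum_congr fun e => ?_
        ring
    _ ≤ F.seriesNorm i μ f := ENNReal.tsum_le_tsum fun ω => mul_le_mul' le_rfl (hprod ω _)

lemma shear_mem_conv {a : σ} (ha : a ∈ s) (c : σ → ℂ) {f : MvPowerSeries σ R}
    (hf : f ∈ F.conv s) : shear a (fun b => F.const (c b)) f ∈ F.conv s := by
  classical
  obtain ⟨i, μ, hμ, hi⟩ := mem_conv.1 hf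
  have hμa : μ a ≠ ∞ := fun h => ((hμ a).2.1 h) ha
  -- a radius in the variable `X a` for which all the substituted forms are small
  have hex : ∃ r : ℝ≥0∞, r ≠ 0 ∧ r ≠ ∞ ∧ ∀ b, ‖c b‖ₑ * r ≤ μ b / 2 ∧ r ≤ μ b / 2 := by
    have h1 : ∀ b, ∃ r : ℝ≥0∞, r ≠ 0 ∧ r ≠ ∞ ∧ ‖c b‖ₑ * r ≤ μ b / 2 ∧ r ≤ μ b / 2 := fun b => by
      obtain ⟨n, hn, hlt⟩ := ENNReal.exists_nat_pos_inv_mul_lt (a := ‖c b‖ₑ + 1) (b := μ b / 2)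
        (ENNReal.add_ne_top.2 ⟨enorm_ne_top, ENNReal.one_ne_top⟩)
        (ENNReal.half_pos (hμ b).1).ne'
      refine ⟨(n : ℝ≥0∞)⁻¹, ENNReal.inv_ne_zero.2 (ENNReal.natCast_ne_top n),
        ENNReal.inv_ne_top.2 (by exact_mod_cast hn.ne'), ?_, ?_⟩
      · rw [mul_comm]
        exact (mul_le_mul' le_rfl le_self_add).trans hlt.le
      · refine le_trans ?_ hlt.le
        rw [mul_add, mul_one]
        exact le_add_self
    choose r hr0 hrt h2 h3 using h1
    have hne : (Finset.univ : Finset σ).Nonempty := ⟨a, Finset.mem_univ a⟩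
    obtain ⟨b₀, -, hb₀⟩ := Finset.exists_min_image Finset.univ r hne
    refine ⟨r b₀, hr0 _, hrt _, fun b => ⟨?_, ?_⟩⟩
    · exact (mul_le_mul' le_rfl (hb₀ b (Finset.mem_univ b))).trans (h2 b)
    · exact (hb₀ b (Finset.mem_univ b)).trans (h3 b)
  obtain ⟨r, hr0, hrt, hr⟩ := hex
  refine mem_conv.2 ⟨i, fun b => if b ∈ s then r else ∞, fun b => ?_,
    ne_top_of_le_ne_top hi (seriesNorm_shear_le a _ i (fun b => ?_) f)⟩
  · by_cases hb : b ∈ s <;> simp [hb, hr0, hrt]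
  · by_cases hb : b ∈ s
    · simp only [hb, ha, if_true]
      calc r + F.norm i (F.const (c b)) * r ≤ μ b / 2 + μ b / 2 :=
            add_le_add (hr b).2 ((mul_le_mul' (F.norm_const_le i _) le_rfl).trans (hr b).1)
        _ = μ b := ENNReal.add_halves _
    · rw [(hμ b).2.2 hb]
      exact le_top

/-- After a suitable shear, a power series with a coefficient of non-zero value is regular in the
variable `X a`. -/
lemma exists_shear_regular [DecidableEq σ] (a : σ) {f : MvPowerSeries σ R}
    (hf : ∃ ω, F.value (MvPowerSeries.coeff ω f) ≠ 0) :
    ∃ c : σ → ℂ, c a = 0 ∧ ∃ d, F.value (MvPowerSeries.coeff (Finsupp.single a d)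
      (shear a (fun b => F.const (c b)) f)) ≠ 0 := by
  obtain ⟨ω₀, hω₀⟩ := hf
  set d := ω₀.degree with hd
  have hfinite : {ω : σ →₀ ℕ | ω.degree = d}.Finite :=
    (finite_weighted_degree_le (l := fun _ : σ => 1) (fun _ => one_pos) d).subset fun ω hω => by
      have h : ω.degree = d := hω
      rw [Finsupp.degree_eq_sum] at h
      simp [h]
  set Z := hfinite.toFinset with hZ
  have hmem : ∀ ω, ω ∈ Z ↔ ω.degree = d := fun ω => by simp [hZ]
  -- `P` is the homogeneous part of degree `d` of the reduction of `f`. Choose `x` with `P(x) ≠ 0`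
  -- and `x_a ≠ 0` and set `c_b = x_b / x_a`. By homogeneity the coefficient of `X_a ^ d` in the
  -- sheared series has value `P(x) / x_a ^ d`.
  let P : MvPolynomial σ ℂ := ∑ ω ∈ Z, MvPolynomial.monomial ω (F.value (MvPowerSeries.coeff ω f))
  have hevP : ∀ x : σ → ℂ, MvPolynomial.eval x P =
      ∑ ω ∈ Z, F.value (MvPowerSeries.coeff ω f) * ∏ b, x b ^ ω b := fun x => by
    rw [map_sum]
    refine Finset.sum_congr rfl fun ω _ => ?_
    rw [MvPolynomial.eval_monomial, Finsupp.prod_fintype _ _ fun b => pow_zero _]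
  have hP : P ≠ 0 := fun h => by
    have h1 := congrArg (MvPolynomial.coeff ω₀) h
    rw [MvPolynomial.coeff_sum] at h1
    simp only [MvPolynomial.coeff_monomial, Finset.sum_ite_eq', hmem, MvPolynomial.coeff_zero] at h1
    rw [if_pos hd.symm] at h1
    exact hω₀ h1
  obtain ⟨x, hx⟩ : ∃ x : σ → ℂ, MvPolynomial.eval x (P * MvPolynomial.X a) ≠ 0 := by
    by_contra! h
    exact mul_ne_zero hP (MvPolynomial.X_ne_zero a)
      (MvPolynomial.funext fun x => by rw [h x, map_zero])
  rw [map_mul, MvPolynomial.eval_X, mul_ne_zero_iff] at hx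
  obtain ⟨hxP, hxa⟩ := hx
  refine ⟨fun b => if b = a then 0 else x b / x a, if_pos rfl, d, ?_⟩
  set c : σ → ℂ := fun b => if b = a then 0 else x b / x a with hc
  have hca : F.const (c a) = 0 := by simp [hc]
  rw [coeff_shear, finsum_eq_sum_of_support_subset (s := Z)]
  · have e : F.value (∑ ω ∈ Z, MvPowerSeries.coeff ω f *
        MvPowerSeries.coeff (Finsupp.single a d)
          (∏ b, shearVar a (fun b => F.const (c b)) b ^ ω b)) * x a ^ d =
        MvPolynomial.eval x P := by
      rw [hevP, map_sum, Finset.sum_mul]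
      refine Finset.sum_congr rfl fun ω hω => ?_
      rw [coeff_single_prod_shearVar a (c := fun b => F.const (c b)) hca, if_pos ((hmem ω).1 hω),
        map_mul, map_prod, mul_assoc]
      congr 1
      rw [← (hmem ω).1 hω, Finsupp.degree_eq_sum, ← Finset.prod_pow_eq_pow_sum,
        ← Finset.prod_mul_distrib]
      refine Finset.prod_congr rfl fun b _ => ?_
      rw [map_pow, ← mul_pow]
      congr 1
      by_cases hb : b = a
      · simp [hb]
      · simp [hb, hc, F.value_const, div_mul_cancel₀ _ hxa]
    intro h
    rw [h, zero_mul] at e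
    exact hxP e.symm
  · intro ω hω
    rw [Function.mem_support] at hω
    rw [Finset.mem_coe, hmem]
    by_contra hne
    apply hω
    rw [coeff_single_prod_shearVar a (c := fun b => F.const (c b)) hca, if_neg hne, mul_zero]

/-- **Local Noether normalisation for a hypersurface**: modulo a power series with a coefficient of
non-zero value, the convergent power series are finite over those in one variable less. -/
theorem exists_finite_quotient [DecidableEq σ] {a : σ} (ha : a ∈ s) (f : F.conv s)
    (hf : ∃ ω, F.value (MvPowerSeries.coeff ω (f : MvPowerSeries σ R)) ≠ 0) :
    ∃ φ : F.conv (s.erase a) →+* F.conv s,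
      ((Ideal.Quotient.mk (Ideal.span {f})).comp φ).Finite := by
  classical
  obtain ⟨c, hca, hreg⟩ := exists_shear_regular (F := F) a hf
  have hca' : F.const (c a) = 0 := by simp [hca]
  have hneg : (-fun b => F.const (c b)) = fun b => F.const ((-c) b) := by
    funext b
    simp
  have hmem := fun {g : MvPowerSeries σ R} (hg : g ∈ F.conv s) =>
    shear_mem_conv (F := F) ha (-c) hg
  rw [← hneg] at hmem
  -- The division takes place after the shear, so the small ring is embedded through the inverse
  -- shear `Φ`, which fixes `X a`.
  let Φ : F.conv s →+* F.conv s :=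
    ((shear a (-fun b => F.const (c b))).toRingHom.comp (F.conv s).subtype).codRestrict (F.conv s)
      fun g => hmem g.2
  let φ : F.conv (s.erase a) →+* F.conv s := Φ.comp
    (Subring.inclusion (conv_mono (Finset.erase_subset a s)))
  refine ⟨φ, ?_⟩
  -- The least exponent with nonzero value is needed here: Weierstrass division requires all lower
  -- axis coefficients to have value `0`.
  have hd := Nat.find_spec hreg
  set d := Nat.find hreg
  have hlt : ∀ j < d, F.value (MvPowerSeries.coeff (Finsupp.single a j)
      (shear a (fun b => F.const (c b)) (f : MvPowerSeries σ R))) = 0 := fun j hj => by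
    simpa using Nat.find_min hreg hj
  let x : F.conv s := ⟨MvPowerSeries.X a, X_mem_conv ha⟩
  let ψ := (Ideal.Quotient.mk (Ideal.span {f})).comp φ
  let _ : Algebra (F.conv (s.erase a)) (F.conv s ⧸ Ideal.span {f}) := ψ.toAlgebra
  refine ⟨⟨(Finset.range d).image fun j => Ideal.Quotient.mk (Ideal.span {f}) (x ^ j), ?_⟩⟩
  rw [eq_top_iff]
  rintro y -
  obtain ⟨g, rfl⟩ := Ideal.Quotient.mk_surjective y
  obtain ⟨q, hq, e, he, hge⟩ := exists_eq_mul_add_sum ha (shear_mem_conv ha c f.2) hlt hd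
    (shear_mem_conv ha c g.2)
  have hg : g = Φ ⟨q, hq⟩ * f + ∑ j ∈ Finset.range d, φ ⟨e j, he j⟩ * x ^ j := by
    refine Subtype.ext ?_
    have h1 := congrArg (shear a (-fun b => F.const (c b))) hge
    rw [shear_neg_shear a hca', map_add, map_mul, shear_neg_shear a hca', map_sum] at h1
    push_cast
    refine h1.trans ?_
    congr 1
    refine Finset.sum_congr rfl fun j _ => ?_
    rw [map_mul, map_pow, shear_X, shearVar]
    simp [hca, x, φ, Φ]
  rw [hg, map_add, map_mul, Ideal.Quotient.eq_zero_iff_mem.2 (Ideal.mem_span_singleton_self f),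
    mul_zero, zero_add, map_sum]
  refine Submodule.sum_mem _ fun j hj => ?_
  rw [map_mul]
  exact Submodule.smul_mem _ (⟨e j, he j⟩ : F.conv (s.erase a))
    (Submodule.subset_span (Finset.mem_coe.2 (Finset.mem_image_of_mem _ hj)))

end NormFamily

/-! ### Residue domains finite over integrally closed domains -/

section normalization

/-- A prime ideal `P` of `A` such that `A ⧸ P` is finite over a noetherian integrally closed domain
of characteristic zero. -/
def HasNormalization {A : Type} [CommRing A] (P : Ideal A) : Prop :=
  ∃ (C : Type) (_ : CommRing C) (_ : IsDomain C) (_ : CharZero C) (_ : IsNoetherianRing C)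
    (_ : IsIntegrallyClosed C) (φ : C →+* A ⧸ P), Function.Injective φ ∧ φ.Finite

/-- A noetherian ring all of whose primes have a normalization. -/
structure IsNormalizable (A : Type) [CommRing A] : Prop where
  noetherian : IsNoetherianRing A
  hasNormalization : ∀ P : Ideal A, P.IsPrime → HasNormalization P

lemma IsNormalizable.isPseudoGeometric {A : Type} [CommRing A] (h : IsNormalizable A) :
    IsPseudoGeometric A := by
  refine ⟨h.noetherian, fun P hP => ?_⟩
  obtain ⟨C, _, _, _, _, _, φ, h1, h2⟩ := h.hasNormalization P hP
  exact FiniteIntegralExtensions.of_finite φ h1 h2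

variable {A B : Type} [CommRing A] [CommRing B]

lemma HasNormalization.bot [IsDomain A] [CharZero A] [IsNoetherianRing A] [IsIntegrallyClosed A] :
    HasNormalization (⊥ : Ideal A) := by
  refine ⟨A, inferInstance, inferInstance, inferInstance, inferInstance, inferInstance,
    Ideal.Quotient.mk ⊥, ?_, RingHom.Finite.of_surjective _ Ideal.Quotient.mk_surjective⟩
  rw [RingHom.injective_iff_ker_eq_bot, Ideal.mk_ker]

/-- The residue domain of `B` at the contracted prime embeds in `A ⧸ P`, which is finite over it;
finite injective maps compose. -/
lemma HasNormalization.of_comap {P : Ideal A} {φ : B →+* A}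
    (hfin : ((Ideal.Quotient.mk P).comp φ).Finite) (h : HasNormalization (P.comap φ)) :
    HasNormalization P := by
  obtain ⟨C, _, _, _, _, _, ψ, hinj, hψ⟩ := h
  have h1 : (Ideal.quotientMap P φ le_rfl).Finite := by
    refine RingHom.Finite.of_comp_finite (f := Ideal.Quotient.mk (P.comap φ)) ?_
    rwa [Ideal.quotientMap_comp_mk]
  exact ⟨C, inferInstance, inferInstance, inferInstance, inferInstance, inferInstance,
    (Ideal.quotientMap P φ le_rfl).comp ψ, Ideal.quotientMap_injective.comp hinj, h1.comp hψ⟩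

lemma HasNormalization.of_surjective (hB : IsNormalizable B) {θ : A →+* B}
    (hθ : Function.Surjective θ) {P : Ideal A} (hP : P.IsPrime) (hker : RingHom.ker θ ≤ P) :
    HasNormalization P := by
  have hQ : (P.map θ).IsPrime := Ideal.map_isPrime_of_surjective hθ hker
  obtain ⟨C, _, _, _, _, _, ψ, hinj, hψ⟩ := hB.hasNormalization _ hQ
  let e : A ⧸ P ≃+* B ⧸ P.map θ := RingEquiv.ofBijective
    (Ideal.quotientMap (P.map θ) θ Ideal.le_comap_map)
    ⟨Ideal.quotientMap_injective' (by rw [Ideal.comap_map_of_surjective' θ hθ, sup_eq_left.2 hker]),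
      Ideal.quotientMap_surjective hθ⟩
  refine ⟨C, inferInstance, inferInstance, inferInstance, inferInstance, inferInstance,
    e.symm.toRingHom.comp ψ, e.symm.injective.comp hinj, RingHom.Finite.comp ?_ hψ⟩
  exact RingHom.Finite.of_surjective _ e.symm.surjective

/-- Generators of `J` together with lifts of generators of `I / J` generate `I`. -/
lemma Ideal.fg_of_isNoetherianRing_quotient {I J : Ideal A} (hJ : J.FG) (h : J ≤ I)
    (hn : IsNoetherianRing (A ⧸ J)) : I.FG := by
  refine Submodule.fg_of_fg_map_of_fg_inf_ker (Submodule.mkQ J) ?_ ?_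
  · have h1 : (I.map (Ideal.Quotient.mk J)).FG := (isNoetherianRing_iff_ideal_fg _).1 hn _
    have h2 := Submodule.FG.restrictScalars (R := A) h1
    have e : Submodule.map (Submodule.mkQ J) I =
        (I.map (Ideal.Quotient.mk J)).restrictScalars A := by
      ext y
      rw [Submodule.mem_map, Submodule.restrictScalars_mem,
        Ideal.mem_map_iff_of_surjective _ Ideal.Quotient.mk_surjective]
      rfl
    rw [e]
    exact h2
  · rwa [Submodule.ker_mkQ, inf_eq_right.2 h]

lemma Ideal.fg_of_surjective {I : Ideal A} [IsNoetherianRing B] {θ : A →+* B}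
    (hθ : Function.Surjective θ) (hfg : (RingHom.ker θ).FG) (hker : RingHom.ker θ ≤ I) : I.FG :=
  Ideal.fg_of_isNoetherianRing_quotient hfg hker
    (isNoetherianRing_of_ringEquiv B (RingHom.quotientKerEquivOfSurjective hθ).symm)

lemma Ideal.isNoetherianRing_quotient_of_finite [IsNoetherianRing B] {J : Ideal A} {φ : B →+* A}
    (hfin : ((Ideal.Quotient.mk J).comp φ).Finite) : IsNoetherianRing (A ⧸ J) := by
  let _ : Algebra B (A ⧸ J) := ((Ideal.Quotient.mk J).comp φ).toAlgebra
  have _ : Module.Finite B (A ⧸ J) := hfin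
  exact IsNoetherianRing.of_finite B (A ⧸ J)

end normalization

/-! ### Convergent complex power series and the inductive steps -/

namespace NormFamily

variable {R I σ : Type} [CommRing R] [Fintype σ] {F : NormFamily R I} {s : Finset σ}

/-- Without variables only the constant coefficient can be nonzero. This starts the inductions on
`s`. -/
lemma isUnit_of_conv_empty {f : F.conv (∅ : Finset σ)}
    (hf : ∃ ω, F.value (MvPowerSeries.coeff ω (f : MvPowerSeries σ R)) ≠ 0) : IsUnit f := by
  obtain ⟨ω, hω⟩ := hf
  obtain rfl : ω = 0 := by
    by_contra h
    obtain ⟨b, hb⟩ := Finsupp.ne_iff.1 h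
    exact hω (by rw [coeff_eq_zero_of_mem_conv f.2 (Finset.notMem_empty b) hb, map_zero])
  exact isUnit_fin_iff.2 hω

instance : CharZero (F.conv s) := ((F.series s).value.comp (F.conv s).subtype).charZero

/-- The variable `X a` as a convergent power series. -/
noncomputable def convX {a : σ} (ha : a ∈ s) : F.conv s := ⟨MvPowerSeries.X a, X_mem_conv ha⟩

lemma convX_ne_zero {a : σ} (ha : a ∈ s) : convX (F := F) ha ≠ 0 := by
  intro h
  have h1 := congrArg (MvPowerSeries.coeff (Finsupp.single a 1)) (congrArg Subtype.val h)
  have h2 : (1 : R) = 0 := by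
    simpa [convX] using h1
  have h3 := congrArg F.value h2
  simp at h3

/-- The absolute value on `ℂ`. -/
noncomputable def complex : NormFamily ℂ Unit where
  norm _ x := ‖x‖ₑ
  nonempty := inferInstance
  directed _ _ := ⟨(), fun _ => le_rfl, fun _ => le_rfl⟩
  norm_add_le _ := enorm_add_le
  norm_mul_le _ x y := (enorm_mul x y).le
  eq_zero_of_norm _ _ := enorm_eq_zero.1
  complete _ x hx := by
    have hs : Summable x := ((tsum_enorm_ne_top_iff_summable_norm).1 hx).of_norm
    refine ⟨∑' j, x j, ?_⟩
    have h1 := (hs.hasSum.tendsto_sum_nat.const_sub (∑' j, x j)).enorm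
    rwa [sub_self, enorm_zero] at h1
  value := RingHom.id ℂ
  const := RingHom.id ℂ
  value_const _ := rfl
  norm_const_le _ _ := le_rfl
  enorm_value_le _ _ := le_rfl
  exists_small _ x hx _ δ hδ := ⟨(), fun _ => le_rfl, by
    change x = 0 at hx
    simpa [hx] using hδ.bot_lt⟩

instance : IsDomain (complex.conv s) := NoZeroDivisors.to_isDomain _

lemma exists_coeff_ne_zero {f : complex.conv s} (hf : f ≠ 0) :
    ∃ ω, complex.value (MvPowerSeries.coeff ω (f : MvPowerSeries σ ℂ)) ≠ 0 := by
  by_contra! h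
  exact hf (Subtype.ext (MvPowerSeries.ext h))

variable [DecidableEq σ]

/-- Modulo `f` the ring is finite over the noetherian ring in one variable less, so every ideal
containing `f` is finitely generated. -/
lemma fg_of_mem {f : F.conv s}
    (hf : ∃ ω, F.value (MvPowerSeries.coeff ω (f : MvPowerSeries σ R)) ≠ 0)
    (ih : ∀ a ∈ s, IsNormalizable (F.conv (s.erase a))) {J : Ideal (F.conv s)} (hJ : f ∈ J) :
    J.FG := by
  rcases s.eq_empty_or_nonempty with rfl | ⟨a, ha⟩
  · rw [Ideal.eq_top_of_isUnit_mem J hJ (isUnit_of_conv_empty hf)]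
    exact ⟨{1}, by simp⟩
  · obtain ⟨φ, hφ⟩ := exists_finite_quotient ha f hf
    have := (ih a ha).noetherian
    exact Ideal.fg_of_isNoetherianRing_quotient (Submodule.fg_span_singleton f)
      ((Ideal.span_singleton_le_iff_mem _).2 hJ) (Ideal.isNoetherianRing_quotient_of_finite hφ)

lemma hasNormalization_of_mem {f : F.conv s}
    (hf : ∃ ω, F.value (MvPowerSeries.coeff ω (f : MvPowerSeries σ R)) ≠ 0)
    (ih : ∀ a ∈ s, IsNormalizable (F.conv (s.erase a))) {P : Ideal (F.conv s)} (hP : P.IsPrime)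
    (hfP : f ∈ P) : HasNormalization P := by
  rcases s.eq_empty_or_nonempty with rfl | ⟨a, ha⟩
  · exact absurd (Ideal.eq_top_of_isUnit_mem P hfP (isUnit_of_conv_empty hf)) hP.ne_top
  · obtain ⟨φ, hφ⟩ := exists_finite_quotient ha f hf
    refine HasNormalization.of_comap (φ := φ) ?_
      ((ih a ha).hasNormalization _ (Ideal.IsPrime.comap φ))
    have hle : Ideal.span {f} ≤ P := (Ideal.span_singleton_le_iff_mem _).2 hfP
    have e : (Ideal.Quotient.mk P).comp φ = (Ideal.Quotient.factor hle).comp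
        ((Ideal.Quotient.mk (Ideal.span {f})).comp φ) := by
      rw [← RingHom.comp_assoc, Ideal.Quotient.factor_comp_mk]
    rw [e]
    exact (RingHom.Finite.of_surjective _ (Ideal.Quotient.factor_surjective hle)).comp hφ

/-- Setting the variable `X a` to zero. -/
noncomputable def quotientXEquiv {a : σ} (ha : a ∈ s) :
    F.conv (s.erase a) ≃+* F.conv s ⧸ Ideal.span {convX (F := F) ha} :=
  RingEquiv.ofBijective ((Ideal.Quotient.mk (Ideal.span {convX ha})).comp
    (Subring.inclusion (conv_mono (Finset.erase_subset a s)))) <| by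
  constructor
  · rw [injective_iff_map_eq_zero]
    intro f hf
    have hdvd : convX (F := F) ha ∣ Subring.inclusion (conv_mono (Finset.erase_subset a s)) f :=
      Ideal.mem_span_singleton.1 (Ideal.Quotient.eq_zero_iff_mem.1 hf)
    obtain ⟨g, hg⟩ := hdvd
    have hg' : (f : MvPowerSeries σ R) = MvPowerSeries.X a ^ 1 * (g : MvPowerSeries σ R) := by
      rw [pow_one]
      exact congrArg Subtype.val hg
    refine Subtype.ext (MvPowerSeries.ext fun ω => ?_)
    by_cases hω : ω a = 0
    · rw [hg', coeff_X_pow_mul_of_lt _ (by omega)]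
      rfl
    · rw [coeff_eq_zero_of_mem_conv f.2 (Finset.notMem_erase a s) hω]
      rfl
  · intro y
    obtain ⟨f, rfl⟩ := Ideal.Quotient.mk_surjective y
    have hmem : restrictExponents (fun ω => ω a < 1) (f : MvPowerSeries σ R) ∈
        F.conv (s.erase a) :=
      mem_conv_erase (restrictExponents_mem_conv _ f.2) fun ω hω => by
        rw [coeff_restrictExponents, if_neg (by omega)]
    refine ⟨⟨_, hmem⟩, ?_⟩
    rw [RingHom.comp_apply, eq_comm, Ideal.Quotient.eq, Ideal.mem_span_singleton]
    refine ⟨⟨_, shift_mem_conv (a := a) 1 f.2⟩, Subtype.ext ?_⟩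
    have := eq_restrictExponents_add_shift a 1 (f : MvPowerSeries σ R)
    rw [pow_one] at this
    exact sub_eq_iff_eq_add'.2 this

/-- The ring of convergent complex power series is noetherian, integrally closed, and its residue
domains are finite over integrally closed noetherian domains. -/
theorem complex_isNormalizable (s : Finset σ) :
    IsNormalizable (complex.conv s) ∧ IsIntegrallyClosed (complex.conv s) := by
  induction s using Finset.strongInduction with
  | H s ih =>
  have ih' := fun a (ha : a ∈ s) => ih _ (Finset.erase_ssubset ha)
  have hnoeth : IsNoetherianRing (complex.conv s) := by
    refine IsNoetherianRing.of_prime fun P hP => ?_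
    by_cases h : P = ⊥
    · rw [h]
      exact Submodule.fg_bot
    · obtain ⟨f, hfP, hf⟩ := P.ne_bot_iff.1 h
      exact fg_of_mem (exists_coeff_ne_zero hf) (fun a ha => (ih' a ha).1) hfP
  have hic : IsIntegrallyClosed (complex.conv s) := by
    rcases s.eq_empty_or_nonempty with rfl | ⟨a, ha⟩
    · refine isIntegrallyClosed_of_forall_dvd fun _ b _ _ hb _ => ?_
      exact (isUnit_of_conv_empty (exists_coeff_ne_zero hb)).dvd
    -- `X a` is a prime element whose quotient is the ring in one variable less, integrally closed
    -- by induction.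
    · have e := quotientXEquiv (F := complex) ha
      have hdom : IsDomain (complex.conv s ⧸ Ideal.span {convX (F := complex) ha}) :=
        e.symm.toMulEquiv.isDomain (complex.conv (s.erase a))
      have := (ih' a ha).2
      refine isIntegrallyClosed_of_quotient_span_prime (x := convX (F := complex) ha)
        ((Ideal.span_singleton_prime (convX_ne_zero ha)).1
          ((Ideal.Quotient.isDomain_iff_prime _).1 hdom)) (IsIntegrallyClosed.of_equiv e)
  refine ⟨⟨hnoeth, fun P hP => ?_⟩, hic⟩
  by_cases h : P = ⊥
  · subst h
    exact HasNormalization.bot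
  · obtain ⟨f, hfP, hf⟩ := P.ne_bot_iff.1 h
    exact hasNormalization_of_mem (exists_coeff_ne_zero hf) (fun a ha => (ih' a ha).1) hP hfP

end NormFamily

/-! ### Iterated slopes on discs and sectors -/

section iteratedSlope

variable {k R η ρ : ℝ}

lemma isOpen_discSector (k R η : ℝ) (m : ℕ) : IsOpen (discSector k R η m) :=
  Metric.isOpen_ball.union (isOpen_gevreySector k R η)

lemma zero_mem_discSector (k R η : ℝ) (m : ℕ) : (0 : ℂ) ∈ discSector k R η m :=
  Or.inl (Metric.mem_ball_self (by positivity))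

lemma mem_discSector {z : ℂ} (hz : z ∈ insert 0 (gevreySector k R η)) (m : ℕ) :
    z ∈ discSector k R η m := by
  rcases hz with rfl | hz
  exacts [zero_mem_discSector k R η m, Or.inr hz]

/-- The supremum of `|f|` on `D_m ∪ S`. -/
noncomputable def discSup (k R η : ℝ) (m : ℕ) (f : ℂ → ℂ) : ℝ≥0∞ :=
  ⨆ z ∈ discSector k R η m, ‖f z‖ₑ

lemma enorm_le_discSup {m : ℕ} (f : ℂ → ℂ) {z : ℂ} (hz : z ∈ discSector k R η m) :
    ‖f z‖ₑ ≤ discSup k R η m f :=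
  le_iSup₂ (f := fun z (_ : z ∈ discSector k R η m) => ‖f z‖ₑ) z hz

lemma discSup_le {m : ℕ} {f : ℂ → ℂ} {b : ℝ≥0∞} (h : ∀ z ∈ discSector k R η m, ‖f z‖ₑ ≤ b) :
    discSup k R η m f ≤ b := iSup₂_le h

/-- Four times the inverse of the radius of the disc with index `m`. -/
noncomputable def slopeFactor (k : ℝ) (m : ℕ) : ℝ := 4 * ((m : ℝ) + 1) ^ (1 / k)

lemma slopeFactor_pos (k : ℝ) (m : ℕ) : 0 < slopeFactor k m := by
  unfold slopeFactor
  positivity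

lemma differentiableOn_dslope_discSector {m : ℕ} {f : ℂ → ℂ}
    (hf : DifferentiableOn ℂ f (discSector k R η m)) :
    DifferentiableOn ℂ (dslope f 0) (discSector k R η m) :=
  (Complex.differentiableOn_dslope
    ((isOpen_discSector k R η m).mem_nhds (zero_mem_discSector k R η m))).2 hf

/-- With `r` the radius of the disc, both bounds are `2 * B / r`: inside the disc by the Schwarz
lemma for `f - f 0`, outside it because `|z| ≥ r`. -/
lemma norm_dslope_le {m : ℕ} {f : ℂ → ℂ} (hf : DifferentiableOn ℂ f (discSector k R η m)) {B : ℝ}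
    (hB : ∀ z ∈ discSector k R η m, ‖f z‖ ≤ B) {z : ℂ} (hz : z ∈ discSector k R η m) :
    ‖dslope f 0 z‖ ≤ slopeFactor k m * B := by
  set r : ℝ := ((m : ℝ) + 1) ^ (-(1 / k)) / 2 with hr
  have hr0 : 0 < r := by positivity
  have e : slopeFactor k m * B = 2 * B / r := by
    have : (0 : ℝ) < (m : ℝ) + 1 := by positivity
    rw [slopeFactor, hr, Real.rpow_neg this.le]
    field_simp
    ring
  have hsub : ∀ w ∈ discSector k R η m, ‖f w - f 0‖ ≤ 2 * B := fun w hw => by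
    have h1 := norm_sub_le (f w) (f 0)
    have h2 := hB w hw
    have h3 := hB 0 (zero_mem_discSector k R η m)
    linarith
  have hB0 : 0 ≤ 2 * B := (norm_nonneg _).trans (hsub z hz)
  rw [e]
  by_cases hzr : z ∈ Metric.ball (0 : ℂ) r
  · refine Complex.norm_dslope_le_div_of_mapsTo_ball (hf.mono Set.subset_union_left)
      (fun w hw => ?_) hzr
    rw [mem_closedBall_iff_norm]
    exact hsub w (Or.inl hw)
  · rw [mem_ball_zero_iff, not_lt] at hzr
    have hz0 : z ≠ 0 := norm_pos_iff.1 (hr0.trans_le hzr)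
    rw [dslope_of_ne _ hz0, slope_def_field, norm_div, sub_zero]
    exact div_le_div₀ hB0 (hsub z hz) hr0 hzr

lemma discSup_dslope_le {m : ℕ} {f : ℂ → ℂ} (hf : DifferentiableOn ℂ f (discSector k R η m)) :
    discSup k R η m (dslope f 0) ≤ ENNReal.ofReal (slopeFactor k m) * discSup k R η m f := by
  by_cases h : discSup k R η m f = ∞
  · rw [h, ENNReal.mul_top]
    · exact le_top
    · simpa using slopeFactor_pos k m
  · refine discSup_le fun z hz => ?_
    have hB : ∀ w ∈ discSector k R η m, ‖f w‖ ≤ (discSup k R η m f).toReal := fun w hw => by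
      rw [← toReal_enorm]
      exact ENNReal.toReal_mono h (enorm_le_discSup f hw)
    rw [← ofReal_norm, ← ENNReal.ofReal_toReal h, ← ENNReal.ofReal_mul (slopeFactor_pos k m).le]
    exact ENNReal.ofReal_le_ofReal (norm_dslope_le hf hB hz)

/-- The `N`-th iterate of `f ↦ (f - f 0) / z`. -/
noncomputable def iterSlope (N : ℕ) (f : ℂ → ℂ) : ℂ → ℂ := (fun g => dslope g 0)^[N] f

lemma iterSlope_succ (N : ℕ) (f : ℂ → ℂ) : iterSlope (N + 1) f = dslope (iterSlope N f) 0 :=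
  Function.iterate_succ_apply' _ _ _

lemma iterSlope_eq (N : ℕ) (f : ℂ → ℂ) (z : ℂ) :
    iterSlope N f z = iterSlope N f 0 + z * iterSlope (N + 1) f z := by
  have := sub_smul_dslope (iterSlope N f) 0 z
  rw [sub_zero, smul_eq_mul] at this
  rw [iterSlope_succ, this]
  ring

lemma differentiableOn_iterSlope {m : ℕ} {f : ℂ → ℂ}
    (hf : DifferentiableOn ℂ f (discSector k R η m)) (N : ℕ) :
    DifferentiableOn ℂ (iterSlope N f) (discSector k R η m) := by
  induction N with
  | zero => exact hf
  | succ N ih =>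
    rw [iterSlope_succ]
    exact differentiableOn_dslope_discSector ih

lemma discSup_iterSlope_le {m : ℕ} {f : ℂ → ℂ} (hf : DifferentiableOn ℂ f (discSector k R η m))
    (N : ℕ) : discSup k R η m (iterSlope N f) ≤
      ENNReal.ofReal (slopeFactor k m) ^ N * discSup k R η m f := by
  induction N with
  | zero => simp [iterSlope]
  | succ N ih =>
    rw [iterSlope_succ]
    refine (discSup_dslope_le (differentiableOn_iterSlope hf N)).trans ?_
    refine (mul_le_mul' le_rfl ih).trans (le_of_eq ?_)
    ring

/-- Growth of the powers of the slope factors. -/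
lemma slopeFactor_pow_le (hk : 0 < k) {θ : ℝ} (hθ : 1 < θ) :
    ∃ M : ℝ, 0 < M ∧ ∀ N m : ℕ, slopeFactor k m ^ N ≤
      θ * M ^ N * (N.factorial : ℝ) ^ (1 / k) * θ ^ m := by
  -- This `t` turns `x ^ N / N! ≤ exp x` at `x = t * (m + 1)`, raised to the power `1 / k`, into an
  -- estimate with exactly `θ ^ (m + 1)` on the right.
  set t := k * Real.log θ with ht
  have ht0 : 0 < t := mul_pos hk (Real.log_pos hθ)
  refine ⟨4 * (t ^ (1 / k))⁻¹, by positivity, fun N m => ?_⟩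
  have hm : (0 : ℝ) < (m : ℝ) + 1 := by positivity
  have h1 := Real.pow_div_factorial_le_exp (x := t * ((m : ℝ) + 1)) (by positivity) N
  have hfac : (0 : ℝ) < N.factorial := by exact_mod_cast N.factorial_pos
  rw [div_le_iff₀ hfac] at h1
  have h2 := Real.rpow_le_rpow (by positivity) h1 (z := 1 / k) (by positivity)
  rw [Real.mul_rpow (Real.exp_pos _).le hfac.le, mul_pow,
    Real.mul_rpow (by positivity) (by positivity), ← Real.exp_mul] at h2
  have h3 : t * ((m : ℝ) + 1) * (1 / k) = Real.log θ * ((m + 1 : ℕ) : ℝ) := by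
    rw [ht]
    push_cast
    field_simp
  rw [h3, Real.exp_mul, Real.exp_log (by linarith), Real.rpow_natCast] at h2
  have h4 : (t ^ N) ^ (1 / k) = (t ^ (1 / k)) ^ N := by
    rw [← Real.rpow_natCast, ← Real.rpow_natCast, ← Real.rpow_mul ht0.le, ← Real.rpow_mul ht0.le,
      mul_comm]
  have h5 : (((m : ℝ) + 1) ^ N) ^ (1 / k) = (((m : ℝ) + 1) ^ (1 / k)) ^ N := by
    rw [← Real.rpow_natCast, ← Real.rpow_natCast, ← Real.rpow_mul hm.le, ← Real.rpow_mul hm.le,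
      mul_comm]
  rw [h4, h5] at h2
  have htk : 0 < (t ^ (1 / k)) ^ N := by positivity
  rw [slopeFactor, mul_pow, mul_pow, inv_pow]
  calc 4 ^ N * (((m : ℝ) + 1) ^ (1 / k)) ^ N
      = 4 ^ N * ((t ^ (1 / k)) ^ N)⁻¹ * ((t ^ (1 / k)) ^ N * (((m : ℝ) + 1) ^ (1 / k)) ^ N) := by
        field_simp
    _ ≤ 4 ^ N * ((t ^ (1 / k)) ^ N)⁻¹ * (θ ^ (m + 1) * (N.factorial : ℝ) ^ (1 / k)) := by gcongr
    _ = _ := by rw [pow_succ]; ring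

end iteratedSlope

/-! ### Gevrey estimates for sums of representations -/

section repSum

variable {k R η ρ : ℝ} {f : ℕ → ℂ → ℂ}

lemma repNorm_eq (k R η ρ : ℝ) (f : ℕ → ℂ → ℂ) :
    repNorm k R η ρ f = ∑' m, discSup k R η m (f m) * ENNReal.ofReal ρ⁻¹ ^ m := rfl

/-- The sum of the `N`-th iterated slopes of the terms of a representation. -/
noncomputable def repSum (f : ℕ → ℂ → ℂ) (N : ℕ) (z : ℂ) : ℂ := ∑' m, iterSlope N (f m) z

/-- Here the radii of the discs produce the Gevrey order. Taking `N` slopes of the `m`-th term costs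
the `N`-th power of its slope factor, at most a constant times `M ^ N * (N!) ^ (1 / k) * θ ^ m`;
with `θ = 1 / ρ` the last factor is the weight in `repNorm`. -/
lemma exists_tsum_discSup_iterSlope_le (hk : 0 < k) (hρ0 : 0 < ρ) (hρ : ρ < 1) :
    ∃ c M : ℝ, 0 < c ∧ 0 < M ∧ ∀ f : ℕ → ℂ → ℂ,
      (∀ m, DifferentiableOn ℂ (f m) (discSector k R η m)) → ∀ N : ℕ,
      ∑' m, discSup k R η m (iterSlope N (f m)) ≤
        ENNReal.ofReal (c * M ^ N * (N.factorial : ℝ) ^ (1 / k)) * repNorm k R η ρ f := by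
  obtain ⟨M, hM, h⟩ := slopeFactor_pow_le hk ((one_lt_inv₀ hρ0).2 hρ)
  refine ⟨ρ⁻¹, M, by positivity, hM, fun f hf N => ?_⟩
  rw [repNorm_eq, ← ENNReal.tsum_mul_left]
  refine ENNReal.tsum_le_tsum fun m => (discSup_iterSlope_le (hf m) N).trans ?_
  rw [mul_comm (discSup k R η m (f m)), ← mul_assoc, ← ENNReal.ofReal_pow (slopeFactor_pos k m).le,
    ← ENNReal.ofReal_pow (by positivity), ← ENNReal.ofReal_mul (by positivity)]
  exact mul_le_mul' (ENNReal.ofReal_le_ofReal (h N m)) le_rfl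

lemma exists_repSum_bound (hk : 0 < k) (hρ0 : 0 < ρ) (hρ : ρ < 1)
    (hf : ∀ m, DifferentiableOn ℂ (f m) (discSector k R η m)) (hfin : repNorm k R η ρ f ≠ ∞) :
    ∃ K M : ℝ, 0 < K ∧ 0 < M ∧ (∀ N, Summable fun m => (discSup k R η m (iterSlope N (f m))).toReal) ∧
      (∀ N m, discSup k R η m (iterSlope N (f m)) ≠ ∞) ∧
      ∀ N : ℕ, ∑' m, (discSup k R η m (iterSlope N (f m))).toReal ≤
        K * M ^ N * (N.factorial : ℝ) ^ (1 / k) := by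
  obtain ⟨c, M, hc, hM, h⟩ := exists_tsum_discSup_iterSlope_le (R := R) (η := η) hk hρ0 hρ
  have hne : ∀ N, ∑' m, discSup k R η m (iterSlope N (f m)) ≠ ∞ := fun N =>
    ne_top_of_le_ne_top (ENNReal.mul_ne_top ENNReal.ofReal_ne_top hfin) (h f hf N)
  refine ⟨c * ((repNorm k R η ρ f).toReal + 1), M, by positivity, hM,
    fun N => ENNReal.summable_toReal (hne N), fun N => ENNReal.ne_top_of_tsum_ne_top (hne N),
    fun N => ?_⟩
  rw [← ENNReal.tsum_toReal_eq (ENNReal.ne_top_of_tsum_ne_top (hne N))]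
  have h1 := ENNReal.toReal_mono (ENNReal.mul_ne_top ENNReal.ofReal_ne_top hfin) (h f hf N)
  rw [ENNReal.toReal_mul, ENNReal.toReal_ofReal (by positivity)] at h1
  have h2 : 0 < c * M ^ N * (N.factorial : ℝ) ^ (1 / k) := by
    have : (0 : ℝ) < N.factorial := by exact_mod_cast N.factorial_pos
    positivity
  nlinarith

lemma norm_le_toReal_discSup {m : ℕ} {g : ℂ → ℂ} (h : discSup k R η m g ≠ ∞) {z : ℂ}
    (hz : z ∈ discSector k R η m) : ‖g z‖ ≤ (discSup k R η m g).toReal := by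
  rw [← toReal_enorm]
  exact ENNReal.toReal_mono h (enorm_le_discSup g hz)

/-- The Gevrey estimates of the sum of a representation of finite norm. -/
lemma exists_gevrey_bound (hk : 0 < k) (hρ0 : 0 < ρ) (hρ : ρ < 1)
    (hf : ∀ m, DifferentiableOn ℂ (f m) (discSector k R η m)) (hfin : repNorm k R η ρ f ≠ ∞) :
    (∃ K M : ℝ, 0 < K ∧ 0 < M ∧ ∀ N : ℕ, ∀ z ∈ insert 0 (gevreySector k R η),
      ‖repSum f N z‖ ≤ K * M ^ N * (N.factorial : ℝ) ^ (1 / k)) ∧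
    (∀ N, DifferentiableOn ℂ (repSum f N) (gevreySector k R η)) ∧
    (∀ N, ∀ z ∈ insert 0 (gevreySector k R η),
      HasSum (fun m => iterSlope N (f m) z) (repSum f N z)) ∧
    ∀ N, ∀ z ∈ insert 0 (gevreySector k R η),
      repSum f N z = repSum f N 0 + z * repSum f (N + 1) z := by
  -- The origin is not in the sector but lies in every disc, so the sums are also controlled there;
  -- their values at `0` are the coefficients of the asymptotic expansion.
  obtain ⟨K, M, hK, hM, hs, hne, hle⟩ := exists_repSum_bound hk hρ0 hρ hf hfin
  have hb : ∀ N m, ∀ z ∈ insert 0 (gevreySector k R η), ‖iterSlope N (f m) z‖ ≤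
      (discSup k R η m (iterSlope N (f m))).toReal := fun N m z hz =>
    norm_le_toReal_discSup (hne N m) (mem_discSector hz m)
  have hsum : ∀ N, ∀ z ∈ insert 0 (gevreySector k R η),
      HasSum (fun m => iterSlope N (f m) z) (repSum f N z) := fun N z hz =>
    (Summable.of_norm_bounded (hs N) fun m => hb N m z hz).hasSum
  refine ⟨⟨K, M, hK, hM, fun N z hz => ?_⟩, fun N => ?_, hsum, fun N z hz => ?_⟩
  · exact (tsum_of_norm_bounded (hs N).hasSum fun m => hb N m z hz).trans (hle N)
  · exact Complex.differentiableOn_tsum_of_summable_norm (hs N)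
      (fun m => (differentiableOn_iterSlope (hf m) N).mono Set.subset_union_right)
      (isOpen_gevreySector k R η) fun m z hz => hb N m z (Or.inr hz)
  · refine (hsum N z hz).unique ?_
    have h1 := (hsum N 0 (Or.inl rfl)).add ((hsum (N + 1) z hz).mul_left z)
    refine h1.congr_fun ?_
    intro m
    exact iterSlope_eq N (f m) z

/-- Iterating the one-step relation identifies `repSum f N` as the Taylor remainder of order `N`
divided by `z ^ N`. -/
lemma repSum_zero_eq_taylor {s : Set ℂ}
    (h : ∀ N, ∀ z ∈ s, repSum f N z = repSum f N 0 + z * repSum f (N + 1) z) (N : ℕ)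
    {z : ℂ} (hz : z ∈ s) :
    repSum f 0 z = ∑ p ∈ Finset.range N, repSum f p 0 * z ^ p + z ^ N * repSum f N z := by
  induction N with
  | zero => simp
  | succ N ih =>
    rw [ih, Finset.sum_range_succ, h N z hz]
    ring

end repSum

/-! ### Geometry of the sectors -/

section sectorGeometry

variable {k R R' η η' : ℝ}

lemma mem_gevreySector_iff {z : ℂ} :
    z ∈ gevreySector k R η ↔ z ≠ 0 ∧ ‖z‖ < R ∧ |z.arg| < Real.pi / (2 * k) + η := by
  rw [gevreySector, sector, Set.mem_ofPred_eq, norm_pos_iff, abs_lt]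

/-- Discs of radius proportional to the distance to the origin stay in a larger sector. -/
lemma exists_closedBall_subset (hR : R' < R) (hη : η' < η)
    (hpi : Real.pi / (2 * k) + η < Real.pi) :
    ∃ c : ℝ, 0 < c ∧ ∀ z ∈ gevreySector k R' η', Metric.closedBall z (c * ‖z‖) ⊆
      gevreySector k R η := by
  -- For `w` in the disc, `w / z` is within `c` of `1`, hence of small argument. The total angle
  -- stays below `π`, so principal arguments add.
  have hcont : ContinuousAt Complex.arg 1 := Complex.continuousAt_arg (by simp)
  rw [Metric.continuousAt_iff] at hcont
  obtain ⟨δ, hδ, hδ'⟩ := hcont (η - η') (by linarith)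
  by_cases hR' : 0 < R'
  swap
  · refine ⟨1, one_pos, fun z hz => ?_⟩
    have := (mem_gevreySector_iff.1 hz).2.1
    linarith [norm_nonneg z]
  set c := min (min (δ / 2) (1 / 2)) ((R - R') / R') with hc
  have hc0 : 0 < c := lt_min (lt_min (by linarith) (by norm_num)) (div_pos (by linarith) hR')
  have hcδ : c < δ := by
    have : c ≤ δ / 2 := (min_le_left _ _).trans (min_le_left _ _)
    linarith
  have hc1 : c ≤ 1 / 2 := (min_le_left _ _).trans (min_le_right _ _)
  have hcR : c * R' ≤ R - R' := by
    have : c ≤ (R - R') / R' := min_le_right _ _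
    rwa [le_div_iff₀ hR'] at this
  refine ⟨c, hc0, fun z hz w hw => ?_⟩
  obtain ⟨hz0, hzR, hza⟩ := mem_gevreySector_iff.1 hz
  rw [mem_closedBall_iff_norm] at hw
  have hzn : 0 < ‖z‖ := norm_pos_iff.2 hz0
  have hu : ‖w / z - 1‖ ≤ c := by
    rw [div_sub_one hz0, norm_div, div_le_iff₀ hzn]
    exact hw
  have hw0 : w / z ≠ 0 := fun h => by
    rw [h, zero_sub, norm_neg, norm_one] at hu
    linarith
  have harg : |(w / z).arg| < η - η' := by
    have := hδ' (x := w / z) (by rw [dist_eq_norm]; exact hu.trans_lt hcδ)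
    rwa [Complex.arg_one, dist_zero_right, Real.norm_eq_abs] at this
  have hwe : w = z * (w / z) := by field_simp
  have habs := abs_add_le z.arg (w / z).arg
  have hlt : |z.arg + (w / z).arg| < Real.pi / (2 * k) + η := by linarith
  rw [mem_gevreySector_iff]
  refine ⟨fun h => hw0 (by rw [h, zero_div]), ?_, ?_⟩
  · have h1 : ‖w‖ ≤ ‖w - z‖ + ‖z‖ := by simpa using norm_add_le (w - z) z
    nlinarith
  · have h2 := abs_lt.1 (hlt.trans hpi)
    rw [hwe, Complex.arg_mul hz0 hw0 ⟨h2.1, h2.2.le⟩]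
    exact hlt

lemma closure_gevreySector_subset (hR : R' < R) (hη : η' < η)
    (hpi : Real.pi / (2 * k) + η < Real.pi) :
    closure (gevreySector k R' η') ⊆ insert 0 (gevreySector k R η) := by
  obtain ⟨c, hc, h⟩ := exists_closedBall_subset hR hη hpi
  intro z hz
  by_cases hz0 : z = 0
  · exact Or.inl hz0
  right
  rw [Metric.mem_closure_iff] at hz
  have hzn : 0 < ‖z‖ := norm_pos_iff.2 hz0
  obtain ⟨w, hw, hzw⟩ := hz (min (c / 2 * ‖z‖) (‖z‖ / 2))
    (lt_min (by positivity) (by positivity))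
  refine h w hw ?_
  rw [Metric.mem_closedBall]
  have h1 := hzw.le.trans (min_le_left _ _)
  have h2 := hzw.le.trans (min_le_right _ _)
  have h3 : ‖z‖ ≤ dist z w + ‖w‖ := by
    rw [dist_eq_norm]
    simpa using norm_add_le (z - w) w
  have h4 : ‖z‖ / 2 ≤ ‖w‖ := by linarith
  nlinarith

lemma pi_div_lt (hk : 1 / 2 < k) : Real.pi / (2 * k) < Real.pi :=
  div_lt_self Real.pi_pos (by linarith)

lemma pi_div_pos (hk : 1 / 2 < k) : 0 < Real.pi / (2 * k) :=
  div_pos Real.pi_pos (by linarith)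

lemma tendsto_ofReal_sectorFilter (hk : 1 / 2 < k) :
    Filter.Tendsto (fun x : ℝ => (x : ℂ)) (nhdsWithin 0 (Set.Ioi 0)) (sectorFilter k) := by
  simp only [sectorFilter, Filter.tendsto_iInf, Filter.tendsto_principal]
  intro R hR η hη
  filter_upwards [Ioo_mem_nhdsGT hR] with x hx
  rw [mem_gevreySector_iff]
  refine ⟨by exact_mod_cast hx.1.ne', ?_, ?_⟩
  · rw [Complex.norm_real, Real.norm_of_nonneg hx.1.le]
    exact hx.2
  · rw [Complex.arg_ofReal_of_nonneg hx.1.le, abs_zero]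
    linarith [pi_div_pos hk]

lemma sectorFilter_neBot (hk : 1 / 2 < k) : (sectorFilter k).NeBot :=
  (tendsto_ofReal_sectorFilter hk).neBot

lemma eventually_mem_gevreySector (hR : 0 < R) (hη : 0 < η) :
    ∀ᶠ z in sectorFilter k, z ∈ gevreySector k R η := mem_sectorFilter hR hη

lemma tendsto_id_sectorFilter : Filter.Tendsto (fun z : ℂ => z) (sectorFilter k) (nhds 0) := by
  rw [Metric.tendsto_nhds]
  intro ε hε
  filter_upwards [eventually_mem_gevreySector (k := k) hε one_pos] with z hz
  rw [dist_zero_right]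
  exact (mem_gevreySector_iff.1 hz).2.1

lemma isSubsector_gevreySector (hR : R' < R) (hη : η' < η) :
    IsSubsector k R η (gevreySector k R' η') :=
  ⟨R', _, _, hR, by linarith, by linarith, rfl⟩

end sectorGeometry

/-! ### Sums of representations are Gevrey functions -/

section gevreySum

variable {k R R' η η' ρ : ℝ} {f : ℕ → ℂ → ℂ}

/-- The sum of a representation of finite norm is Gevrey on smaller sectors. -/
lemma isGevrey_repSum (hk : 0 < k) (hR : R' < R) (hη : η' < η)
    (hpi : Real.pi / (2 * k) + η < Real.pi) (hρ0 : 0 < ρ) (hρ : ρ < 1)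
    (hf : ∀ m, DifferentiableOn ℂ (f m) (discSector k R η m)) (hfin : repNorm k R η ρ f ≠ ∞) :
    IsGevrey k R' η' (repSum f 0) := by
  obtain ⟨⟨K, M, hK, hM, hb⟩, hd, -, hstep⟩ := exists_gevrey_bound hk hρ0 hρ hf hfin
  have hsub := gevreySector_mono (k := k) hR.le hη.le
  have htaylor : ∀ N, ∀ z ∈ insert 0 (gevreySector k R η),
      ‖repSum f 0 z - ∑ p ∈ Finset.range N, repSum f p 0 * z ^ p‖ ≤
        K * M ^ N * (N.factorial : ℝ) ^ (1 / k) * ‖z‖ ^ N := fun N z hz => by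
    rw [repSum_zero_eq_taylor hstep N hz, add_sub_cancel_left, norm_mul, norm_pow, mul_comm]
    exact mul_le_mul_of_nonneg_right (hb N z hz) (by positivity)
  refine ⟨(hd 0).mono hsub, ?_, ⟨PowerSeries.mk fun p => repSum f p 0, ?_⟩, ?_⟩
  · refine ContinuousOn.mono (s := insert 0 (gevreySector k R η)) ?_
      (closure_gevreySector_subset hR hη hpi)
    intro z hz
    rcases hz with rfl | hz
    · rw [ContinuousWithinAt, tendsto_iff_norm_sub_tendsto_zero]
      have h1 : Filter.Tendsto (fun z : ℂ => K * M ^ 1 * (Nat.factorial 1 : ℝ) ^ (1 / k) * ‖z‖ ^ 1)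
          (nhdsWithin 0 (insert 0 (gevreySector k R η))) (nhds 0) := by
        have h2 : Continuous fun z : ℂ => K * M ^ 1 * (Nat.factorial 1 : ℝ) ^ (1 / k) * ‖z‖ ^ 1 := by
          fun_prop
        have h3 := h2.tendsto 0
        rw [norm_zero, pow_one, pow_one, mul_zero] at h3
        simpa only [pow_one] using h3.mono_left nhdsWithin_le_nhds
      refine squeeze_zero' (Filter.Eventually.of_forall fun _ => norm_nonneg _) ?_ h1
      filter_upwards [self_mem_nhdsWithin] with z hz
      simpa using htaylor 1 z hz
    · exact ((hd 0).differentiableAt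
        ((isOpen_gevreySector k R η).mem_nhds hz)).continuousAt.continuousWithinAt
  · intro T hT N
    refine ⟨K * M ^ N * (N.factorial : ℝ) ^ (1 / k), fun z hz => ?_⟩
    simp only [PowerSeries.coeff_mk]
    exact htaylor N z (Or.inr (hsub (hT.subset hz)))
  · intro T hT
    obtain ⟨c, hc, hball⟩ := exists_closedBall_subset hR hη hpi
    refine ⟨K, M * ((1 + c) / c), hK, by positivity, fun N z hz => ?_⟩
    have hzS := hT.subset hz
    have hz0 : 0 < ‖z‖ := norm_pos_iff.2 (mem_gevreySector_iff.1 hzS).1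
    have hcz : 0 < c * ‖z‖ := by positivity
    -- The Taylor polynomial of degree less than `N` is killed by the `N`-th derivative. Cauchy's
    -- estimate for the remainder on the circle of radius `c * |z|`, where `|w| ≤ (1 + c) * |z|`,
    -- gives the factor `((1 + c) / c) ^ N`; the powers of `|z|` cancel.
    set g : ℂ → ℂ := fun w => ∑ p ∈ Finset.range N, repSum f p 0 * w ^ p with hg
    have hgd : Differentiable ℂ g := by
      rw [hg]
      fun_prop
    have hzmem : gevreySector k R η ∈ nhds z := (isOpen_gevreySector k R η).mem_nhds (hsub hzS)
    have hFan : ContDiffAt ℂ N (repSum f 0) z := ((hd 0).analyticAt hzmem).contDiffAt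
    have hgan : ContDiffAt ℂ N g z := hgd.contDiff.contDiffAt
    have hg0 : iteratedDeriv N g z = 0 := by
      let Q : Polynomial ℂ := ∑ p ∈ Finset.range N, Polynomial.C (repSum f p 0) * Polynomial.X ^ p
      have hQ : g = fun w => Q.eval w := by
        funext w
        simp [Q, hg, Polynomial.eval_finsetSum]
      have hder : ∀ (m : ℕ) (Q : Polynomial ℂ), iteratedDeriv m (fun w => Q.eval w) =
          fun w => ((Polynomial.derivative^[m]) Q).eval w := by
        intro m
        induction m with
        | zero => intro Q; simp
        | succ m ih =>
          intro Q
          rw [iteratedDeriv_succ', Function.iterate_succ_apply, ← ih]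
          congr 1
          funext w
          exact Q.deriv
      rw [hQ, hder, Polynomial.iterate_derivative_eq_zero_of_degree_lt]
      · exact Polynomial.eval_zero
      refine (Polynomial.degree_lt_iff_coeff_zero _ _).2 fun m hm => ?_
      simp only [Q, Polynomial.finsetSum_coeff, Polynomial.coeff_C_mul_X_pow]
      refine Finset.sum_eq_zero fun p hp => if_neg ?_
      have := Finset.mem_range.1 hp
      omega
    have hsubder : iteratedDeriv N (repSum f 0) z = iteratedDeriv N (repSum f 0 - g) z := by
      rw [iteratedDeriv_sub hFan hgan, hg0, sub_zero]
    have hcauchy := Complex.norm_iteratedDeriv_le_of_forall_mem_sphere_norm_le N hcz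
      (f := repSum f 0 - g) (c := z)
      (C := K * M ^ N * (N.factorial : ℝ) ^ (1 / k) * ((1 + c) * ‖z‖) ^ N)
      (DifferentiableOn.diffContOnCl <| by
        rw [closure_ball z hcz.ne']
        exact ((hd 0).mono (hball z hzS)).sub hgd.differentiableOn)
      (fun w hw => by
        have hw' : w ∈ gevreySector k R η := hball z hzS (Metric.sphere_subset_closedBall hw)
        refine (htaylor N w (Or.inr hw')).trans ?_
        have hwn : ‖w‖ ≤ (1 + c) * ‖z‖ := by
          rw [mem_sphere_iff_norm] at hw
          have := norm_add_le (w - z) z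
          rw [sub_add_cancel] at this
          linarith
        gcongr)
    have hfac : (0 : ℝ) < N.factorial := by exact_mod_cast N.factorial_pos
    rw [hsubder, norm_div, Complex.norm_natCast, div_le_iff₀ hfac]
    refine hcauchy.trans (le_of_eq ?_)
    rw [mul_pow, mul_pow, mul_pow, div_pow]
    field_simp

end gevreySum

/-! ### Watson's lemma -/

section watson

open Filter

/-- The exponentially small bound that results from the Gevrey bounds of all orders. -/
lemma exists_exp_bound {k K M : ℝ} (hk : 0 < k) (hK : 0 < K) (hM : 0 < M) :
    ∃ L : ℝ, 0 < L ∧ ∀ t a : ℝ, 0 < t → (∀ N : ℕ, a ≤ K * M ^ N * (N.factorial : ℝ) ^ (1 / k) *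
      (1 / t) ^ N) → a ≤ K * Real.exp 1 * Real.exp (-(L * t ^ k)) := by
  set L := (M * Real.exp 1)⁻¹ ^ k with hL
  have hL0 : 0 < L := by positivity
  refine ⟨L, hL0, fun t a ht h => ?_⟩
  -- The nearly optimal order: with this `L`, `N ^ (1 / k) ≤ t / (M * e)`, so the `N`-th bound is at
  -- most `K * exp (-N)`. The factor `exp 1` in the conclusion pays for the floor.
  set N := ⌊L * t ^ k⌋₊ with hN
  have hN1 : (N : ℝ) ≤ L * t ^ k := Nat.floor_le (by positivity)
  have hN2 : L * t ^ k < N + 1 := Nat.lt_floor_add_one _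
  have h1 : (N : ℝ) ^ (1 / k) ≤ (M * Real.exp 1)⁻¹ * t := by
    have := Real.rpow_le_rpow (by positivity) hN1 (z := 1 / k) (by positivity)
    refine this.trans (le_of_eq ?_)
    rw [hL, ← Real.mul_rpow (by positivity) ht.le, ← Real.rpow_mul (by positivity),
      mul_one_div_cancel hk.ne', Real.rpow_one]
  have h2 : (N.factorial : ℝ) ^ (1 / k) ≤ ((N : ℝ) ^ (1 / k)) ^ N := by
    have h3 : (N.factorial : ℝ) ≤ (N : ℝ) ^ N := by exact_mod_cast N.factorial_le_pow
    refine (Real.rpow_le_rpow (by positivity) h3 (by positivity)).trans (le_of_eq ?_)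
    rw [← Real.rpow_natCast, ← Real.rpow_natCast, ← Real.rpow_mul (by positivity),
      ← Real.rpow_mul (by positivity), mul_comm]
  calc a ≤ K * M ^ N * (N.factorial : ℝ) ^ (1 / k) * (1 / t) ^ N := h N
    _ ≤ K * M ^ N * ((M * Real.exp 1)⁻¹ * t) ^ N * (1 / t) ^ N := by
        have := h2.trans (pow_le_pow_left₀ (by positivity) h1 N)
        gcongr
    _ = K * Real.exp (-N) := by
        rw [mul_assoc, mul_assoc, ← mul_pow, ← mul_pow, Real.exp_neg, ← Real.exp_one_pow, ← inv_pow]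
        congr 2
        field_simp
    _ ≤ K * (Real.exp 1 * Real.exp (-(L * t ^ k))) := by
        rw [← Real.exp_add]
        gcongr
        linarith
    _ = _ := by ring

/-- **Watson's lemma**: a holomorphic function on a sector of opening larger than `π / k` that
satisfies the Gevrey bounds with zero asymptotic expansion vanishes. -/
theorem watson {k R η K M : ℝ} (hk : 1 / 2 < k) (hR : 0 < R) (hη : 0 < η) (hK : 0 < K)
    (hM : 0 < M) {F : ℂ → ℂ} (hF : DifferentiableOn ℂ F (gevreySector k R η))
    (h : ∀ N : ℕ, ∀ z ∈ gevreySector k R η,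
      ‖F z‖ ≤ K * M ^ N * (N.factorial : ℝ) ^ (1 / k) * ‖z‖ ^ N) :
    ∀ᶠ z in sectorFilter k, F z = 0 := by
  have hk0 : 0 < k := by linarith
  have hpi := Real.pi_pos
  set β₀ := Real.pi / (2 * k) with hβ₀
  have hβ₀0 : 0 < β₀ := pi_div_pos hk
  -- The map `ζ ↦ (ζ + A) ^ (-q)` with `q = 2 * β / π` sends the right half plane into a sector of
  -- half-angle `β`. As `β > π / (2k)`, `q * k > 1`, and a bound `exp (-L / |z| ^ k)` becomes
  -- superexponential decay in `ζ`. A large `A` keeps the image within radius `R`.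
  obtain ⟨β, hβ1, hβ2⟩ : ∃ β, β₀ < β ∧ β < min (β₀ + η) Real.pi :=
    exists_between (lt_min (by linarith) (pi_div_lt hk))
  have hβη : β < β₀ + η := hβ2.trans_le (min_le_left _ _)
  have hβpi : β < Real.pi := hβ2.trans_le (min_le_right _ _)
  have hβ0 : 0 < β := hβ₀0.trans hβ1
  set q := 2 * β / Real.pi with hq
  have hq0 : 0 < q := by positivity
  have hqβ : q * (Real.pi / 2) = β := by
    rw [hq]
    field_simp
  have hqk : 1 < q * k := by
    have : q * k * β₀ = β := by
      rw [hβ₀, ← hqβ]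
      field_simp
    by_contra hle
    push Not at hle
    nlinarith
  obtain ⟨A, hA0, hAR⟩ : ∃ A : ℝ, 0 < A ∧ A ^ (-q) < R := by
    have := (tendsto_rpow_neg_atTop hq0).eventually (gt_mem_nhds hR)
    obtain ⟨A, h1, h2⟩ := (this.and (eventually_gt_atTop 0)).exists
    exact ⟨A, h2, h1⟩
  set ψ : ℂ → ℂ := fun ζ => Complex.exp (-q * Complex.log (ζ + A)) with hψ
  have hre : ∀ ζ : ℂ, 0 ≤ ζ.re → 0 < (ζ + A).re := fun ζ hζ => by
    rw [Complex.add_re, Complex.ofReal_re]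
    linarith
  have hnorm : ∀ ζ : ℂ, 0 ≤ ζ.re → A ≤ ‖ζ + A‖ := fun ζ hζ => by
    refine le_trans ?_ (Complex.re_le_norm _)
    rw [Complex.add_re, Complex.ofReal_re]
    linarith
  have hψn : ∀ ζ : ℂ, 0 ≤ ζ.re → ‖ψ ζ‖ = ‖ζ + A‖ ^ (-q) := fun ζ hζ => by
    have h0 : 0 < ‖ζ + A‖ := hA0.trans_le (hnorm ζ hζ)
    rw [hψ, Complex.norm_exp, Real.rpow_def_of_pos h0]
    congr 1
    rw [← Complex.ofReal_neg, Complex.re_ofReal_mul, Complex.log_re, mul_comm]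
  have hψS : ∀ ζ : ℂ, 0 ≤ ζ.re → ψ ζ ∈ gevreySector k R η := fun ζ hζ => by
    rw [mem_gevreySector_iff]
    refine ⟨Complex.exp_ne_zero _, ?_, ?_⟩
    · rw [hψn ζ hζ]
      exact (Real.rpow_le_rpow_of_nonpos hA0 (hnorm ζ hζ) (by linarith)).trans_lt hAR
    · have him : (-q * Complex.log (ζ + A)).im = -(q * (ζ + A).arg) := by
        rw [← Complex.ofReal_neg, Complex.im_ofReal_mul, Complex.log_im]
        ring
      have harg : |(ζ + A).arg| < Real.pi / 2 := Complex.abs_arg_lt_pi_div_two_iff.2 (Or.inl (hre ζ hζ))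
      have hlt : |q * (ζ + A).arg| < β := by
        rw [abs_mul, abs_of_pos hq0, ← hqβ]
        exact mul_lt_mul_of_pos_left harg hq0
      have hlt' := abs_lt.1 hlt
      have e : (ψ ζ).arg = -(q * (ζ + A).arg) := by
        rw [← Complex.log_im, hψ, Complex.log_exp, him]
        · rw [him]
          linarith
        · rw [him]
          linarith
      rw [e, abs_neg]
      exact hlt.trans hβη
  obtain ⟨L, hL, hexp⟩ := exists_exp_bound hk0 hK hM
  have hbound : ∀ ζ : ℂ, 0 ≤ ζ.re → ‖F (ψ ζ)‖ ≤ K := fun ζ hζ => by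
    simpa using h 0 _ (hψS ζ hζ)
  have hzero : Set.EqOn (F ∘ ψ) 0 {ζ : ℂ | 0 ≤ ζ.re} := by
    refine PhragmenLindelof.eq_zero_on_right_half_plane_of_superexponential_decay ?_ ?_ ?_ ?_
    · refine DifferentiableOn.diffContOnCl ?_
      rw [Complex.closure_setOfPred_lt_re]
      refine hF.comp (fun ζ hζ => ?_) fun ζ hζ => hψS ζ hζ
      have hs : ζ + A ∈ Complex.slitPlane := Or.inl (hre ζ hζ)
      have : DifferentiableAt ℂ ψ ζ := by
        rw [hψ]
        fun_prop (disch := assumption)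
      exact this.differentiableWithinAt
    -- The growth condition with exponent `1` and constant `0` is boundedness, the bound of order `N
    -- = 0`.
    · refine ⟨1, one_lt_two, 0, Asymptotics.IsBigO.of_bound K ?_⟩
      refine mem_inf_of_right ?_
      rw [mem_principal]
      intro ζ hζ
      have : (0 : ℝ) < ζ.re := hζ
      simpa using hbound ζ this.le
    · intro n
      have hlim : Tendsto (fun x : ℝ => K * Real.exp 1 * Real.exp (-(x * (L * x ^ (q * k - 1) - n))))
          atTop (nhds 0) := by
        have h1 : Tendsto (fun x : ℝ => x * (L * x ^ (q * k - 1) - n)) atTop atTop :=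
          tendsto_id.atTop_mul_atTop₀ (tendsto_atTop_add_const_right _ _
            ((tendsto_rpow_atTop (by linarith)).const_mul_atTop hL))
        simpa using (Real.tendsto_exp_neg_atTop_nhds_zero.comp h1).const_mul (K * Real.exp 1)
      refine squeeze_zero' (Eventually.of_forall fun x => by positivity) ?_ hlim
      filter_upwards [eventually_gt_atTop 0] with x hx
      have hx0 : 0 ≤ ((x : ℂ)).re := by simpa using hx.le
      have hn : ‖(x : ℂ) + A‖ = x + A := by
        rw [← Complex.ofReal_add, Complex.norm_real, Real.norm_of_nonneg (by positivity)]
      have hb := hexp ((x + A) ^ q) ‖F (ψ x)‖ (by positivity) fun N => by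
        have := h N _ (hψS x hx0)
        rwa [hψn x hx0, hn, Real.rpow_neg (by positivity), ← one_div] at this
      rw [← Real.rpow_mul (by positivity)] at hb
      have hmono : x ^ (q * k) ≤ (x + A) ^ (q * k) := by
        apply Real.rpow_le_rpow hx.le <;> linarith
      have hsplit : x ^ (q * k) = x * x ^ (q * k - 1) := by
        rw [Real.rpow_sub_one hx.ne']
        field_simp
      calc Real.exp x ^ n * ‖(F ∘ ψ) x‖
          ≤ Real.exp x ^ n * (K * Real.exp 1 * Real.exp (-(L * (x + A) ^ (q * k)))) := by
            gcongr
            exact hb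
        _ ≤ Real.exp x ^ n * (K * Real.exp 1 * Real.exp (-(L * x ^ (q * k)))) := by gcongr
        _ = K * Real.exp 1 * (Real.exp (n * x) * Real.exp (-(L * x ^ (q * k)))) := by
            rw [← Real.exp_nat_mul]
            ring
        _ = _ := by
            rw [← Real.exp_add, hsplit]
            congr 2
            ring
    · exact ⟨K, fun x => hbound _ (by simp)⟩
  -- every point of a small sector is in the image of the right half plane
  set η₁ := (β - β₀) / 2 with hη₁
  have hη₁0 : 0 < η₁ := by linarith
  -- For `w = z ^ (-1 / q)` one has `Re w ≥ |z| ^ (-1 / q) * c₀`, which is at least `A` once `|z| <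
  -- (c₀ / A) ^ q`; then `w - A` is a preimage of `z` in the half plane.
  set c₀ := Real.cos ((β₀ + η₁) / q) with hc₀
  have hang : (β₀ + η₁) / q < Real.pi / 2 := by
    rw [div_lt_iff₀ hq0, mul_comm, hqβ]
    linarith
  have hang0 : 0 < (β₀ + η₁) / q := by positivity
  have hc₀0 : 0 < c₀ := Real.cos_pos_of_mem_Ioo ⟨by linarith, hang⟩
  filter_upwards [eventually_mem_gevreySector (k := k) (R := (c₀ / A) ^ q) (η := η₁)
    (by positivity) hη₁0] with z hz
  obtain ⟨hz0, hzR, hza⟩ := mem_gevreySector_iff.1 hz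
  have hzn : 0 < ‖z‖ := norm_pos_iff.2 hz0
  set w : ℂ := Complex.exp (-(q⁻¹ : ℝ) * Complex.log z) with hw
  have him : (-(q⁻¹ : ℝ) * Complex.log z).im = -(z.arg / q) := by
    rw [← Complex.ofReal_neg, Complex.im_ofReal_mul, Complex.log_im]
    ring
  have hre' : (-(q⁻¹ : ℝ) * Complex.log z).re = Real.log ‖z‖ * -q⁻¹ := by
    rw [← Complex.ofReal_neg, Complex.re_ofReal_mul, Complex.log_re, mul_comm]
  have hza' : |z.arg / q| < (β₀ + η₁) / q := by
    rw [abs_div, abs_of_pos hq0]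
    exact div_lt_div_of_pos_right hza hq0
  have hlt := abs_lt.1 hza'
  have hlogw : Complex.log w = -(q⁻¹ : ℝ) * Complex.log z := by
    rw [hw, Complex.log_exp]
    · rw [him]
      linarith
    · rw [him]
      linarith
  have hwre : A ≤ w.re := by
    rw [hw, Complex.exp_re, him, hre', ← Real.rpow_def_of_pos hzn, Real.cos_neg,
      ← Real.cos_abs (z.arg / q)]
    have h1 : c₀ ≤ Real.cos |z.arg / q| :=
      Real.cos_le_cos_of_nonneg_of_le_pi (abs_nonneg _) (by linarith) hza'.le
    have h2 : A / c₀ ≤ ‖z‖ ^ (-q⁻¹) := by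
      have h3 := Real.rpow_le_rpow_of_nonpos hzn hzR.le (z := -q⁻¹) (by
        rw [Left.neg_nonpos_iff]; positivity)
      refine le_trans (le_of_eq ?_) h3
      rw [← Real.rpow_mul (by positivity), mul_neg, mul_inv_cancel₀ hq0.ne', Real.rpow_neg_one,
        inv_div]
    calc A = A / c₀ * c₀ := by field_simp
      _ ≤ _ := mul_le_mul h2 h1 hc₀0.le (by positivity)
  have hψw : ψ (w - A) = z := by
    rw [hψ]
    simp only [sub_add_cancel]
    rw [hlogw, ← mul_assoc]
    have : (-(q : ℂ)) * -((q⁻¹ : ℝ) : ℂ) = 1 := by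
      rw [neg_mul_neg, ← Complex.ofReal_mul, mul_inv_cancel₀ hq0.ne', Complex.ofReal_one]
    rw [this, one_mul, Complex.exp_log hz0]
  have := hzero (show w - A ∈ {ζ : ℂ | 0 ≤ ζ.re} by
    rw [Set.mem_ofPred_eq, Complex.sub_re, Complex.ofReal_re]
    linarith)
  rwa [Function.comp_apply, hψw] at this

end watson

/-! ### The norms on Gevrey germs: division by the coordinate -/

section gevreyFamily

variable {k R R' η η' ρ ρ' : ℝ} {f : ℕ → ℂ → ℂ} {g : SectorGerm k}

lemma exists_isRep_repNorm_lt {b : ℝ≥0∞} (h : gevreyNorm k R η ρ g < b) :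
    ∃ f, IsRep k R η f g ∧ repNorm k R η ρ f < b := by
  simpa only [gevreyNorm, iInf_lt_iff, exists_prop] using h

lemma IsRep.coe_repSum (h : IsRep k R η f g) (hR : 0 < R) (hη : 0 < η) :
    ((repSum f 0 : ℂ → ℂ) : SectorGerm k) = g := by
  obtain ⟨-, F, rfl, hF⟩ := h
  refine Filter.Germ.coe_eq.2 ?_
  filter_upwards [eventually_mem_gevreySector (k := k) hR hη] with z hz
  exact (hF z hz).tsum_eq

/-- A finite norm alone makes a germ Gevrey. This puts quotients by `z` and limits of series back
into the ring. The angle is first reduced below `π`, as the sector geometry requires. -/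
lemma mem_gevreyRing_of_gevreyNorm (hk : 1 / 2 < k) (hR : 0 < R) (hη : 0 < η) (hρ0 : 0 < ρ)
    (hρ : ρ < 1) (h : gevreyNorm k R η ρ g ≠ ∞) : g ∈ gevreyRing k hk := by
  obtain ⟨f, hf, hlt⟩ := exists_isRep_repNorm_lt h.lt_top
  have hpi := pi_div_lt hk
  set η₁ := min η ((Real.pi - Real.pi / (2 * k)) / 2) with hη₁
  have hη₁0 : 0 < η₁ := lt_min hη (by linarith)
  have hη₁le : η₁ ≤ (Real.pi - Real.pi / (2 * k)) / 2 := min_le_right _ _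
  have hle : η₁ ≤ η := min_le_left _ _
  have hfin : repNorm k R η₁ ρ f ≠ ∞ :=
    ne_top_of_le_ne_top hlt.ne (repNorm_mono f le_rfl hle hρ0 le_rfl)
  exact ⟨R / 2, η₁ / 2, by positivity, by positivity, repSum f 0,
    isGevrey_repSum (by linarith) (by linarith) (by linarith) (by linarith) hρ0 hρ
      (hf.mono le_rfl hle).1 hfin, hf.coe_repSum hR hη⟩

lemma tendsto_of_isGevrey (hR : 0 < R) (hη : 0 < η) {F : ℂ → ℂ} (hF : IsGevrey k R η F) :
    ∃ c, Filter.Tendsto F (sectorFilter k) (nhds c) := by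
  obtain ⟨a, ha⟩ := hF.expansion
  obtain ⟨C, hC⟩ := ha _ (isSubsector_gevreySector (R' := R / 2) (η' := η / 2)
    (by linarith) (by linarith)) 1
  refine ⟨PowerSeries.coeff 0 a, tendsto_iff_norm_sub_tendsto_zero.2 ?_⟩
  have h1 := (tendsto_id_sectorFilter (k := k)).norm.const_mul C
  rw [norm_zero, mul_zero] at h1
  refine squeeze_zero' (Filter.Eventually.of_forall fun _ => norm_nonneg _) ?_ h1
  filter_upwards [eventually_mem_gevreySector (k := k) (half_pos hR) (half_pos hη)] with z hz
  simpa using hC z hz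

lemma exists_gevreyValue {hk : 1 / 2 < k} (g : gevreyRing k hk) :
    ∃ c, ∀ F : ℂ → ℂ, (F : SectorGerm k) = g →
      Filter.Tendsto F (sectorFilter k) (nhds c) := by
  obtain ⟨_, R, η, hR, hη, F, hF, rfl⟩ := g
  obtain ⟨c, hc⟩ := tendsto_of_isGevrey hR hη hF
  exact ⟨c, fun F' hF' => hc.congr' (Filter.Germ.coe_eq.1 hF').symm⟩

/-- The limit of a Gevrey germ at the origin. -/
noncomputable def gevreyLimit {hk : 1 / 2 < k} (g : gevreyRing k hk) : ℂ :=
  (exists_gevreyValue g).choose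

lemma tendsto_gevreyLimit {hk : 1 / 2 < k} {g : gevreyRing k hk} {F : ℂ → ℂ}
    (hF : (F : SectorGerm k) = g) :
    Filter.Tendsto F (sectorFilter k) (nhds (gevreyLimit g)) :=
  (exists_gevreyValue g).choose_spec F hF

lemma gevreyLimit_eq {hk : 1 / 2 < k} {g : gevreyRing k hk} {F : ℂ → ℂ}
    (hF : (F : SectorGerm k) = g) {c : ℂ} (hc : Filter.Tendsto F (sectorFilter k) (nhds c)) :
    gevreyLimit g = c :=
  have := sectorFilter_neBot hk
  tendsto_nhds_unique (tendsto_gevreyLimit hF) hc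

lemma exists_coe_eq {hk : 1 / 2 < k} (g : gevreyRing k hk) :
    ∃ F : ℂ → ℂ, (F : SectorGerm k) = g := by
  obtain ⟨_, R, η, hR, hη, F, hF, rfl⟩ := g
  exact ⟨F, rfl⟩

/-- The limit at the origin as a ring homomorphism. -/
noncomputable def gevreyValue (k : ℝ) (hk : 1 / 2 < k) : gevreyRing k hk →+* ℂ where
  toFun := gevreyLimit
  map_one' := gevreyLimit_eq (F := fun _ => 1) rfl tendsto_const_nhds
  map_zero' := gevreyLimit_eq (F := fun _ => 0) rfl tendsto_const_nhds
  map_mul' g h := by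
    obtain ⟨F, hF⟩ := exists_coe_eq g
    obtain ⟨H, hH⟩ := exists_coe_eq h
    refine gevreyLimit_eq (F := F * H) ?_ ((tendsto_gevreyLimit hF).mul (tendsto_gevreyLimit hH))
    rw [Subring.coe_mul, ← hF, ← hH]
    rfl
  map_add' g h := by
    obtain ⟨F, hF⟩ := exists_coe_eq g
    obtain ⟨H, hH⟩ := exists_coe_eq h
    refine gevreyLimit_eq (F := F + H) ?_ ((tendsto_gevreyLimit hF).add (tendsto_gevreyLimit hH))
    rw [Subring.coe_add, ← hF, ← hH]
    rfl

/-- The constant germs. -/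
noncomputable def gevreyConst (k : ℝ) (hk : 1 / 2 < k) : ℂ →+* gevreyRing k hk where
  toFun c := ⟨((fun _ => c : ℂ → ℂ) : SectorGerm k),
    1, 1, one_pos, one_pos, _, IsGevrey.const k 1 1 c, rfl⟩
  map_one' := rfl
  map_zero' := rfl
  map_mul' _ _ := rfl
  map_add' _ _ := rfl

lemma tendsto_repSum (hk : 0 < k) (hR : 0 < R) (hη : 0 < η) (hρ0 : 0 < ρ) (hρ : ρ < 1)
    (hf : ∀ m, DifferentiableOn ℂ (f m) (discSector k R η m)) (hfin : repNorm k R η ρ f ≠ ∞)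
    (N : ℕ) : Filter.Tendsto (repSum f N) (sectorFilter k) (nhds (repSum f N 0)) := by
  obtain ⟨⟨K, M, hK, hM, hb⟩, -, -, hstep⟩ := exists_gevrey_bound hk hρ0 hρ hf hfin
  rw [tendsto_iff_norm_sub_tendsto_zero]
  have h1 := (tendsto_id_sectorFilter (k := k)).norm.mul_const
    (K * M ^ (N + 1) * ((N + 1).factorial : ℝ) ^ (1 / k))
  rw [norm_zero, zero_mul] at h1
  refine squeeze_zero' (Filter.Eventually.of_forall fun _ => norm_nonneg _) ?_ h1
  filter_upwards [eventually_mem_gevreySector (k := k) hR hη] with z hz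
  rw [hstep N z (Or.inr hz), add_sub_cancel_left, norm_mul]
  exact mul_le_mul_of_nonneg_left (hb (N + 1) z (Or.inr hz)) (norm_nonneg _)

lemma gevreyValue_eq_repSum {hk : 1 / 2 < k} {g : gevreyRing k hk} (hR : 0 < R) (hη : 0 < η)
    (hρ0 : 0 < ρ) (hρ : ρ < 1) (h : IsRep k R η f g) (hfin : repNorm k R η ρ f ≠ ∞) :
    gevreyValue k hk g = repSum f 0 0 :=
  gevreyLimit_eq (h.coe_repSum hR hη)
    (tendsto_repSum (by linarith) hR hη hρ0 hρ h.1 hfin 0)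

lemma enorm_gevreyValue_le {hk : 1 / 2 < k} (hR : 0 < R) (hη : 0 < η) (hρ0 : 0 < ρ) (hρ : ρ < 1)
    (g : gevreyRing k hk) : ‖gevreyValue k hk g‖ₑ ≤ gevreyNorm k R η ρ (g : SectorGerm k) := by
  refine le_iInf₂ fun f hf => ?_
  have := sectorFilter_neBot hk
  obtain ⟨-, F, hF, hsum⟩ := hf
  refine le_of_tendsto (tendsto_gevreyLimit hF).enorm ?_
  filter_upwards [eventually_mem_gevreySector (k := k) hR hη] with z hz
  rw [← (hsum z hz).tsum_eq]
  exact enorm_tsum_le_tsum_enorm.trans (tsum_enorm_le_repNorm hρ0 hρ f hz)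

/-- The coordinate `z` has arbitrarily small norms. -/
lemma exists_gevreyNorm_id_lt (hk : 0 < k) (hR : 0 < R) (hρ : ρ < 1) {δ : ℝ≥0∞} (hδ : δ ≠ 0) :
    ∃ R' ρ', 0 < R' ∧ R' ≤ R ∧ ρ ≤ ρ' ∧ 0 < ρ' ∧ ρ' < 1 ∧ ∀ η,
      gevreyNorm k R' η ρ' ((fun z : ℂ => z : ℂ → ℂ) : SectorGerm k) < δ := by
  obtain ⟨ε, hε0, hεδ⟩ := ENNReal.lt_iff_exists_nnreal_btwn.1 hδ.bot_lt
  have hε' : (0 : ℝ≥0∞) < ε := hε0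
  have hε : (0 : ℝ) < ε := by exact_mod_cast hε'
  -- Represent `z` by the single term with index `N`: its disc and the new sector have radius at
  -- most `ε / 2`. By Bernoulli's inequality, `ρ'` close to `1` gives `ρ' ^ (-N) ≤ 2`, so the norm
  -- is at most `ε`.
  obtain ⟨N, hN⟩ : ∃ N : ℕ, ((N : ℝ) + 1) ^ (-(1 / k)) < ε := by
    have h1 := (tendsto_rpow_neg_atTop (y := 1 / k) (by positivity)).comp
      (Filter.tendsto_atTop_add_const_right _ 1 (tendsto_natCast_atTop_atTop (R := ℝ)))
    exact (h1.eventually (gt_mem_nhds hε)).exists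
  set ρ' := max ρ (1 - 1 / (2 * ((N : ℝ) + 1))) with hρ'
  have hN0 : (0 : ℝ) < 2 * ((N : ℝ) + 1) := by positivity
  have hfrac : 1 / (2 * ((N : ℝ) + 1)) ≤ 1 / 2 := by
    apply one_div_le_one_div_of_le <;> linarith [(Nat.cast_nonneg N : (0 : ℝ) ≤ N)]
  have hfrac0 : 0 < 1 / (2 * ((N : ℝ) + 1)) := by positivity
  have hρ'0 : 0 < ρ' := lt_max_of_lt_right (by linarith)
  have hpow : 1 / 2 ≤ ρ' ^ N := by
    have h1 := one_add_mul_le_pow (a := -(1 / (2 * ((N : ℝ) + 1)))) (by linarith) N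
    have h2 : (1 - 1 / (2 * ((N : ℝ) + 1))) ^ N ≤ ρ' ^ N :=
      pow_le_pow_left₀ (by linarith) (le_max_right _ _) N
    have h3 : (N : ℝ) * (1 / (2 * ((N : ℝ) + 1))) ≤ 1 / 2 := by
      rw [mul_one_div, div_le_iff₀ hN0]
      linarith
    rw [← sub_eq_add_neg] at h1
    linarith
  refine ⟨min R (ε / 2), ρ', lt_min hR (by positivity), min_le_left _ _, le_max_left _ _, hρ'0,
    max_lt hρ (by linarith), fun η => lt_of_le_of_lt ?_ hεδ⟩
  have hrep : IsRep k (min R (ε / 2)) η (fun m z => if m = N then z else 0)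
      ((fun z : ℂ => z : ℂ → ℂ) : SectorGerm k) := by
    refine ⟨fun m => ?_, _, rfl, fun z _ => hasSum_ite_eq N z⟩
    by_cases h : m = N
    · simp only [h, if_true]
      exact differentiableOn_id
    · simp only [h, if_false]
      exact differentiableOn_const 0
  refine (gevreyNorm_le hrep).trans ?_
  rw [repNorm_eq, tsum_eq_single N]
  · have hsup : discSup k (min R (ε / 2)) η N (fun z => if N = N then z else 0) ≤
        ENNReal.ofReal (ε / 2) := by
      refine discSup_le fun z hz => ?_
      rw [if_pos rfl, ← ofReal_norm]
      refine ENNReal.ofReal_le_ofReal ?_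
      rcases hz with hz | hz
      · rw [mem_ball_zero_iff] at hz
        linarith
      · exact (mem_gevreySector_iff.1 hz).2.1.le.trans (min_le_right _ _)
    refine (mul_le_mul' hsup le_rfl).trans ?_
    rw [← ENNReal.ofReal_pow (by positivity), ← ENNReal.ofReal_mul (by positivity),
      ← ENNReal.ofReal_coe_nnreal]
    refine ENNReal.ofReal_le_ofReal ?_
    rw [inv_pow, ← div_eq_mul_inv, div_le_iff₀ (by positivity)]
    nlinarith
  · intro m hm
    have : discSup k (min R (ε / 2)) η m (fun z => if m = N then z else 0) = 0 :=
      le_antisymm (discSup_le fun z _ => by simp [hm]) bot_le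
    rw [this, zero_mul]

/-- The coordinate `z` as a Gevrey germ. -/
noncomputable def gevreyVar (k : ℝ) (hk : 1 / 2 < k) : gevreyRing k hk :=
  ⟨((fun z : ℂ => z : ℂ → ℂ) : SectorGerm k), by
    obtain ⟨R, ρ, hR, -, -, hρ0, hρ, h⟩ := exists_gevreyNorm_id_lt (k := k) (by linarith)
      one_pos (by norm_num : (1 / 2 : ℝ) < 1) (δ := ∞) ENNReal.top_ne_zero
    exact mem_gevreyRing_of_gevreyNorm hk hR one_pos hρ0 hρ (h 1).ne⟩

lemma gevreyValue_gevreyVar (hk : 1 / 2 < k) : gevreyValue k hk (gevreyVar k hk) = 0 :=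
  gevreyLimit_eq rfl tendsto_id_sectorFilter

/-- The germ of `z⁻¹`. -/
noncomputable def invVar (k : ℝ) : SectorGerm k := ((fun z : ℂ => z⁻¹ : ℂ → ℂ) : SectorGerm k)

lemma gevreyVar_mul_invVar (hk : 1 / 2 < k) :
    (gevreyVar k hk : SectorGerm k) * invVar k = 1 := by
  refine Filter.Germ.coe_eq.2 ?_
  filter_upwards [eventually_mem_gevreySector (k := k) one_pos one_pos] with z hz
  exact mul_inv_cancel₀ (mem_gevreySector_iff.1 hz).1

/-- Division by `z` of the germs with value `0`, with a bound that is uniform in the germ. -/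
lemma exists_gevreyNorm_mul_invVar_le (hk : 1 / 2 < k) (hR : 0 < R) (hη : 0 < η) (hρ0 : 0 < ρ)
    (hρ : ρ < ρ') (hρ' : ρ' < 1) :
    ∃ c : ℝ≥0∞, c ≠ ∞ ∧ ∀ g : gevreyRing k hk, gevreyValue k hk g = 0 →
      gevreyNorm k R η ρ' ((g : SectorGerm k) * invVar k) ≤
        c * gevreyNorm k R η ρ (g : SectorGerm k) := by
  have hk0 : 0 < k := by linarith
  have hρ'0 : 0 < ρ' := hρ0.trans hρ
  -- One slope costs at most `c * (ρ' / ρ) ^ m` in the `m`-th term, exactly what passing from `ρ` to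
  -- `ρ'` absorbs.
  obtain ⟨M, hM, hle⟩ := slopeFactor_pow_le hk0 ((one_lt_div hρ0).2 hρ)
  set c : ℝ := ρ' / ρ * M ^ 1 * (Nat.factorial 1 : ℝ) ^ (1 / k) with hc
  have hc0 : 0 < c := by
    rw [hc]
    simp only [Nat.factorial_one, Nat.cast_one, Real.one_rpow]
    positivity
  refine ⟨ENNReal.ofReal c, ENNReal.ofReal_ne_top, fun g hg => ?_⟩
  refine ENNReal.le_mul_of_forall_lt (Or.inl (by simpa using hc0)) (Or.inl ENNReal.ofReal_ne_top)
    fun a ha b hb => ?_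
  refine le_trans ?_ (mul_le_mul' ha.le le_rfl)
  obtain ⟨f, hf, hfb⟩ := exists_isRep_repNorm_lt hb
  have hfin : repNorm k R η ρ f ≠ ∞ := hfb.ne_top
  have hv := gevreyValue_eq_repSum hR hη hρ0 (hρ.trans hρ') hf hfin
  rw [hg] at hv
  obtain ⟨-, -, hsum, hstep⟩ := exists_gevrey_bound hk0 hρ0 (hρ.trans hρ') hf.1 hfin
  -- The values `f_m(0)` need not vanish singly, but their sum is the value of `g`, which is `0`;
  -- hence the slopes sum to `g / z`.
  have hrep : IsRep k R η (fun m => iterSlope 1 (f m)) ((g : SectorGerm k) * invVar k) := by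
    refine ⟨fun m => differentiableOn_iterSlope (hf.1 m) 1, fun z => repSum f 0 z * z⁻¹, ?_,
      fun z hz => ?_⟩
    · rw [← hf.coe_repSum hR hη]
      rfl
    · have h1 := hsum 1 z (Or.inr hz)
      have h2 := hstep 0 z (Or.inr hz)
      have hz0 := (mem_gevreySector_iff.1 hz).1
      rw [← hv, zero_add, zero_add] at h2
      change HasSum (fun m => iterSlope 1 (f m) z) (repSum f 0 z * z⁻¹)
      rwa [h2, mul_comm z, mul_assoc, mul_inv_cancel₀ hz0, mul_one]
  refine (gevreyNorm_le hrep).trans (le_trans ?_ (mul_le_mul' le_rfl hfb.le))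
  rw [repNorm_eq, repNorm_eq, ← ENNReal.tsum_mul_left]
  refine ENNReal.tsum_le_tsum fun m => ?_
  have hq : 0 ≤ ρ' / ρ := by positivity
  have h1 : discSup k R η m (iterSlope 1 (f m)) ≤
      ENNReal.ofReal c * ENNReal.ofReal (ρ' / ρ) ^ m * discSup k R η m (f m) := by
    refine (discSup_iterSlope_le (hf.1 m) 1).trans (mul_le_mul' ?_ le_rfl)
    rw [← ENNReal.ofReal_pow (slopeFactor_pos k m).le, ← ENNReal.ofReal_pow hq,
      ← ENNReal.ofReal_mul hc0.le]
    exact ENNReal.ofReal_le_ofReal (hle 1 m)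
  have h2 : ENNReal.ofReal (ρ' / ρ) * ENNReal.ofReal ρ'⁻¹ = ENNReal.ofReal ρ⁻¹ := by
    rw [← ENNReal.ofReal_mul hq]
    congr 1
    field_simp
  calc _ ≤ ENNReal.ofReal c * ENNReal.ofReal (ρ' / ρ) ^ m * discSup k R η m (f m) *
        ENNReal.ofReal ρ'⁻¹ ^ m := mul_le_mul' h1 le_rfl
    _ = ENNReal.ofReal c * (discSup k R η m (f m) *
        (ENNReal.ofReal (ρ' / ρ) * ENNReal.ofReal ρ'⁻¹) ^ m) := by rw [mul_pow]; ring
    _ = _ := by rw [h2]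

end gevreyFamily

/-! ### The norms on Gevrey germs: separation and completeness -/

section gevreyFamily

variable {k R R' η η' ρ ρ' : ℝ} {hk : 1 / 2 < k}

/-- Division by `z` in the ring of Gevrey germs. -/
lemma exists_eq_gevreyVar_mul (hk : 1 / 2 < k) (hR : 0 < R) (hη : 0 < η) (hρ0 : 0 < ρ)
    (hρ : ρ < ρ') (hρ' : ρ' < 1) :
    ∃ c : ℝ≥0∞, c ≠ ∞ ∧ ∀ g : gevreyRing k hk, gevreyValue k hk g = 0 →
      gevreyNorm k R η ρ (g : SectorGerm k) ≠ ∞ → ∃ h : gevreyRing k hk,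
        g = gevreyVar k hk * h ∧ gevreyNorm k R η ρ' (h : SectorGerm k) ≤
          c * gevreyNorm k R η ρ (g : SectorGerm k) := by
  obtain ⟨c, hc, h⟩ := exists_gevreyNorm_mul_invVar_le hk hR hη hρ0 hρ hρ'
  refine ⟨c, hc, fun g hg hfin => ⟨⟨(g : SectorGerm k) * invVar k,
    mem_gevreyRing_of_gevreyNorm hk hR hη (hρ0.trans hρ) hρ'
      (ne_top_of_le_ne_top (ENNReal.mul_ne_top hc hfin) (h g hg))⟩, ?_, h g hg⟩⟩
  refine Subtype.ext ?_
  rw [Subring.coe_mul, mul_left_comm, gevreyVar_mul_invVar, mul_one]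

/-- A germ of finite norm that is divisible by all powers of `z` vanishes. -/
lemma eq_zero_of_forall_gevreyVar_pow_dvd (hR : 0 < R) (hη : 0 < η) (hρ0 : 0 < ρ) (hρ : ρ < 1)
    {g : gevreyRing k hk} (hfin : gevreyNorm k R η ρ (g : SectorGerm k) ≠ ∞)
    (hdvd : ∀ N : ℕ, gevreyVar k hk ^ N ∣ g) : g = 0 := by
  have hk0 : 0 < k := by linarith
  have := sectorFilter_neBot hk
  obtain ⟨f, hf, hlt⟩ := exists_isRep_repNorm_lt hfin.lt_top
  have hcoe := hf.coe_repSum hR hη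
  obtain ⟨⟨K, M, hK, hM, hb⟩, hdiff, -, hstep⟩ := exists_gevrey_bound hk0 hρ0 hρ hf.1 hlt.ne
  -- Divisibility by `z ^ (p + 1)` kills the `p`-th coefficient of the expansion once the earlier
  -- ones vanish. Watson's lemma then applies to the flat function.
  have hzero : ∀ p, repSum f p 0 = 0 := by
    intro p
    induction p using Nat.strong_induction_on with
    | _ p ih =>
      obtain ⟨h, hh⟩ := hdvd (p + 1)
      obtain ⟨H, hH⟩ := exists_coe_eq h
      have h1 : repSum f 0 =ᶠ[sectorFilter k] fun z => z ^ (p + 1) * H z := by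
        refine Filter.Germ.coe_eq.1 ?_
        rw [hcoe, hh, Subring.coe_mul, Subring.coe_pow, ← hH]
        rfl
      have h2 : repSum f p =ᶠ[sectorFilter k] fun z => z * H z := by
        filter_upwards [h1, eventually_mem_gevreySector (k := k) hR hη] with z hz1 hz
        have hz0 := (mem_gevreySector_iff.1 hz).1
        rw [repSum_zero_eq_taylor hstep p (Or.inr hz), Finset.sum_eq_zero (fun q hq => by
          rw [ih q (Finset.mem_range.1 hq), zero_mul]), zero_add, pow_succ, mul_assoc] at hz1
        exact mul_left_cancel₀ (pow_ne_zero p hz0) hz1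
      have h3 := (tendsto_id_sectorFilter (k := k)).mul (tendsto_gevreyLimit hH)
      rw [zero_mul] at h3
      exact tendsto_nhds_unique (tendsto_repSum hk0 hR hη hρ0 hρ hf.1 hlt.ne p)
        (h3.congr' h2.symm)
  have hflat : ∀ᶠ z in sectorFilter k, repSum f 0 z = 0 := by
    refine watson hk hR hη hK hM (hdiff 0) fun N z hz => ?_
    rw [repSum_zero_eq_taylor hstep N (Or.inr hz), Finset.sum_eq_zero (fun q _ => by
      rw [hzero q, zero_mul]), zero_add, norm_mul, norm_pow, mul_comm]
    exact mul_le_mul_of_nonneg_right (hb N z (Or.inr hz)) (by positivity)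
  refine Subtype.ext ?_
  rw [← hcoe]
  exact Filter.Germ.coe_eq.2 hflat

/-- A germ of norm `0` has value `0`, and its quotient by `z` again has norm `0` for a slightly
larger `ρ < 1`. So all powers of `z` divide it, and the preceding vanishing criterion applies. -/
lemma eq_zero_of_gevreyNorm (hR : 0 < R) (hη : 0 < η) (hρ0 : 0 < ρ) (hρ : ρ < 1)
    {g : gevreyRing k hk} (hg : gevreyNorm k R η ρ (g : SectorGerm k) = 0) : g = 0 := by
  refine eq_zero_of_forall_gevreyVar_pow_dvd hR hη hρ0 hρ (by simp [hg]) fun N => ?_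
  obtain ⟨ρ₁, h, -, -, hh, -⟩ : ∃ (ρ₁ : ℝ) (h : gevreyRing k hk), 0 < ρ₁ ∧ ρ₁ < 1 ∧
      g = gevreyVar k hk ^ N * h ∧ gevreyNorm k R η ρ₁ (h : SectorGerm k) = 0 := by
    induction N with
    | zero => exact ⟨ρ, g, hρ0, hρ, by simp, hg⟩
    | succ N ih =>
      obtain ⟨ρ₁, h, h0, h1, hh, hn⟩ := ih
      obtain ⟨ρ₂, h12, h2⟩ := exists_between h1
      have hv : gevreyValue k hk h = 0 := by
        have := enorm_gevreyValue_le hR hη h0 h1 h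
        rwa [hn, nonpos_iff_eq_zero, enorm_eq_zero] at this
      obtain ⟨c, hc, hdiv⟩ := exists_eq_gevreyVar_mul hk hR hη h0 h12 h2
      obtain ⟨h', hh', hn'⟩ := hdiv h hv (by simp [hn])
      rw [hn, mul_zero, nonpos_iff_eq_zero] at hn'
      exact ⟨ρ₂, h', h0.trans h12, h2, by rw [hh, hh', pow_succ, mul_assoc], hn'⟩
  exact ⟨h, hh⟩

/-- The inequality for finite norms extends to infinite ones because only the zero germ has norm
`0`, so `0 * ∞` on the right never bounds a nonzero product. -/
lemma gevreyNorm_mul_le' (hR : 0 < R) (hη : 0 < η) (hρ0 : 0 < ρ) (hρ : ρ < 1)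
    (g h : gevreyRing k hk) :
    gevreyNorm k R η ρ ((g * h : gevreyRing k hk) : SectorGerm k) ≤
      gevreyNorm k R η ρ (g : SectorGerm k) * gevreyNorm k R η ρ (h : SectorGerm k) := by
  rcases eq_or_ne g 0 with rfl | hg
  · simp [gevreyNorm_zero]
  rcases eq_or_ne h 0 with rfl | hh
  · simp [gevreyNorm_zero]
  have hg' : gevreyNorm k R η ρ (g : SectorGerm k) ≠ 0 :=
    fun h0 => hg (eq_zero_of_gevreyNorm hR hη hρ0 hρ h0)
  have hh' : gevreyNorm k R η ρ (h : SectorGerm k) ≠ 0 :=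
    fun h0 => hh (eq_zero_of_gevreyNorm hR hη hρ0 hρ h0)
  by_cases h1 : gevreyNorm k R η ρ (g : SectorGerm k) = ∞
  · rw [h1, ENNReal.top_mul hh']
    exact le_top
  by_cases h2 : gevreyNorm k R η ρ (h : SectorGerm k) = ∞
  · rw [h2, ENNReal.mul_top hg']
    exact le_top
  exact gevreyNorm_mul_le hk hρ0 hρ _ _ h1 h2

lemma differentiableOn_tsum_discSector {m : ℕ} {F : ℕ → ℂ → ℂ}
    (hF : ∀ j, DifferentiableOn ℂ (F j) (discSector k R η m))
    (h : ∑' j, discSup k R η m (F j) ≠ ∞) :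
    DifferentiableOn ℂ (fun z => ∑' j, F j z) (discSector k R η m) :=
  Complex.differentiableOn_tsum_of_summable_norm (ENNReal.summable_toReal h) hF
    (isOpen_discSector k R η m) fun j _ hz =>
      norm_le_toReal_discSup (ENNReal.ne_top_of_tsum_ne_top h j) hz

lemma tsum_repNorm_eq (F : ℕ → ℕ → ℂ → ℂ) : ∑' j, repNorm k R η ρ (F j) =
    ∑' m, (∑' j, discSup k R η m (F j m)) * ENNReal.ofReal ρ⁻¹ ^ m := by
  simp_rw [repNorm_eq, ← ENNReal.tsum_mul_right]
  exact ENNReal.tsum_comm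

lemma discSup_tsum_le {m : ℕ} (F : ℕ → ℂ → ℂ) :
    discSup k R η m (fun z => ∑' j, F j z) ≤ ∑' j, discSup k R η m (F j) :=
  discSup_le fun _ hz => enorm_tsum_le_tsum_enorm.trans
    (ENNReal.tsum_le_tsum fun j => enorm_le_discSup (F j) hz)

lemma isRep_tsum (hρ0 : 0 < ρ) (hρ : ρ < 1) {F : ℕ → ℕ → ℂ → ℂ}
    (hF : ∀ j m, DifferentiableOn ℂ (F j m) (discSector k R η m))
    (h : ∑' j, repNorm k R η ρ (F j) ≠ ∞) :
    IsRep k R η (fun m z => ∑' j, F j m z)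
      ((fun z => ∑' j, repSum (F j) 0 z : ℂ → ℂ) : SectorGerm k) := by
  have hm : ∀ m, ∑' j, discSup k R η m (F j m) ≠ ∞ := by
    intro m hm
    rw [tsum_repNorm_eq] at h
    refine ENNReal.ne_top_of_tsum_ne_top h m ?_
    rw [hm, ENNReal.top_mul (pow_ne_zero _ (by simpa using hρ0))]
  refine ⟨fun m => differentiableOn_tsum_discSector (fun j => hF j m) (hm m), _, rfl,
    fun z hz => ?_⟩
  have h1 : ∑' p : ℕ × ℕ, ‖F p.1 p.2 z‖ₑ ≠ ∞ := by
    rw [ENNReal.tsum_prod (f := fun j m => ‖F j m z‖ₑ)]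
    exact ne_top_of_le_ne_top h (ENNReal.tsum_le_tsum fun j =>
      tsum_enorm_le_repNorm hρ0 hρ (F j) hz)
  have h2 : Summable fun p : ℕ × ℕ => F p.1 p.2 z :=
    (tsum_enorm_ne_top_iff_summable_norm.1 h1).of_norm
  have h3 := h2.prod_symm.hasSum.prod_fiberwise fun m => (h2.prod_symm.prod_factor m).hasSum
  have h4 : ∑' p : ℕ × ℕ, F p.swap.1 p.swap.2 z = ∑' j, repSum (F j) 0 z := by
    exact ((Equiv.prodComm ℕ ℕ).tsum_eq (fun p : ℕ × ℕ => F p.1 p.2 z)).trans h2.tsum_prod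
  rw [← h4]
  exact h3

lemma repNorm_tsum_le (F : ℕ → ℕ → ℂ → ℂ) :
    repNorm k R η ρ (fun m z => ∑' j, F j m z) ≤ ∑' j, repNorm k R η ρ (F j) := by
  rw [tsum_repNorm_eq, repNorm_eq]
  exact ENNReal.tsum_le_tsum fun m => mul_le_mul' (discSup_tsum_le fun j => F j m) le_rfl

/-- Choose representations that are optimal up to summable errors, since the infimum need not be
attained, and add them termwise. The same construction for the shifted sequence represents the
remainder, whose norm is bounded by a tail. -/
lemma exists_gevreyNorm_tendsto (hR : 0 < R) (hη : 0 < η) (hρ0 : 0 < ρ) (hρ : ρ < 1)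
    (x : ℕ → gevreyRing k hk) (hx : ∑' j, gevreyNorm k R η ρ (x j : SectorGerm k) ≠ ∞) :
    ∃ y : gevreyRing k hk, Filter.Tendsto (fun J => gevreyNorm k R η ρ
      ((y - ∑ j ∈ Finset.range J, x j : gevreyRing k hk) : SectorGerm k)) Filter.atTop (nhds 0) := by
  obtain ⟨ε, hε0, hε⟩ := ENNReal.exists_pos_sum_of_countable' one_ne_zero ℕ
  have hrep : ∀ j, ∃ f, IsRep k R η f (x j : SectorGerm k) ∧
      repNorm k R η ρ f < gevreyNorm k R η ρ (x j : SectorGerm k) + ε j := fun j =>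
    exists_isRep_repNorm_lt (ENNReal.lt_add_right (ENNReal.ne_top_of_tsum_ne_top hx j) (hε0 j).ne')
  choose F hF hlt using hrep
  have hfin : ∑' j, repNorm k R η ρ (F j) ≠ ∞ := by
    refine ne_top_of_le_ne_top ?_ (ENNReal.tsum_le_tsum fun j => (hlt j).le)
    rw [ENNReal.tsum_add]
    exact ENNReal.add_ne_top.2 ⟨hx, hε.ne_top⟩
  set y : SectorGerm k := ((fun z => ∑' j, repSum (F j) 0 z : ℂ → ℂ) : SectorGerm k) with hy
  have hmem : y ∈ gevreyRing k hk := mem_gevreyRing_of_gevreyNorm hk hR hη hρ0 hρ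
    (ne_top_of_le_ne_top hfin ((gevreyNorm_le
      (isRep_tsum hρ0 hρ (fun j => (hF j).1) hfin)).trans (repNorm_tsum_le F)))
  refine ⟨⟨y, hmem⟩, tendsto_of_tendsto_of_tendsto_of_le_of_le tendsto_const_nhds
    (ENNReal.tendsto_sum_nat_add _ hfin) (fun _ => bot_le) fun J => ?_⟩
  have hfin' : ∑' j, repNorm k R η ρ (F (j + J)) ≠ ∞ :=
    ne_top_of_le_ne_top hfin (ENNReal.tsum_comp_le_tsum_of_injective (add_left_injective J) _)
  have hgerm : ((fun z => ∑' j, repSum (F (j + J)) 0 z : ℂ → ℂ) : SectorGerm k) =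
      y - ∑ j ∈ Finset.range J, (x j : SectorGerm k) := by
    have hsum : ∀ J, ((fun z => ∑ j ∈ Finset.range J, repSum (F j) 0 z : ℂ → ℂ) :
        SectorGerm k) = ∑ j ∈ Finset.range J, (x j : SectorGerm k) := by
      intro J
      induction J with
      | zero => simp; rfl
      | succ J ih =>
        simp_rw [Finset.sum_range_succ, ← ih, ← (hF J).coe_repSum hR hη]
        rfl
    rw [← hsum, hy]
    refine Filter.Germ.coe_eq.2 ?_
    filter_upwards [eventually_mem_gevreySector (k := k) hR hη] with z hz
    have hs : Summable fun j => repSum (F j) 0 z := by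
      refine (tsum_enorm_ne_top_iff_summable_norm.1 (ne_top_of_le_ne_top hfin
        (ENNReal.tsum_le_tsum fun j => ?_))).of_norm
      exact enorm_tsum_le_tsum_enorm.trans (tsum_enorm_le_repNorm hρ0 hρ (F j) hz)
    exact eq_sub_of_add_eq' (hs.sum_add_tsum_nat_add J)
  have := (gevreyNorm_le (isRep_tsum hρ0 hρ (fun j => (hF (j + J)).1) hfin')).trans
    (repNorm_tsum_le (ρ := ρ) fun j => F (j + J))
  rw [hgerm] at this
  simpa using this

/-- The parameters `α = (R, ρ, k, η)` for a fixed `k`. -/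
structure GevreyIndex : Type where
  R : ℝ
  ρ : ℝ
  η : ℝ
  R_pos : 0 < R
  ρ_pos : 0 < ρ
  ρ_lt_one : ρ < 1
  η_pos : 0 < η

/-- The norms `‖·‖_α` on the ring of Gevrey germs. -/
noncomputable def gevreyFamily (k : ℝ) (hk : 1 / 2 < k) :
    NormFamily (gevreyRing k hk) GevreyIndex where
  norm α g := gevreyNorm k α.R α.η α.ρ (g : SectorGerm k)
  nonempty := ⟨⟨1, 1 / 2, 1, one_pos, by norm_num, by norm_num, one_pos⟩⟩
  directed α β := ⟨⟨min α.R β.R, max α.ρ β.ρ, min α.η β.η, lt_min α.R_pos β.R_pos,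
    lt_max_of_lt_left α.ρ_pos, max_lt α.ρ_lt_one β.ρ_lt_one, lt_min α.η_pos β.η_pos⟩,
    fun _ => gevreyNorm_mono _ (min_le_left _ _) (min_le_left _ _) α.ρ_pos (le_max_left _ _),
    fun _ => gevreyNorm_mono _ (min_le_right _ _) (min_le_right _ _) β.ρ_pos (le_max_right _ _)⟩
  norm_add_le _ _ _ := gevreyNorm_add_le _ _
  norm_mul_le α := gevreyNorm_mul_le' α.R_pos α.η_pos α.ρ_pos α.ρ_lt_one
  eq_zero_of_norm α _ := eq_zero_of_gevreyNorm α.R_pos α.η_pos α.ρ_pos α.ρ_lt_one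
  complete α := exists_gevreyNorm_tendsto α.R_pos α.η_pos α.ρ_pos α.ρ_lt_one
  value := gevreyValue k hk
  const := gevreyConst k hk
  value_const _ := gevreyLimit_eq (F := fun _ => _) rfl tendsto_const_nhds
  norm_const_le _ := gevreyNorm_const_le
  enorm_value_le α := enorm_gevreyValue_le α.R_pos α.η_pos α.ρ_pos α.ρ_lt_one
  exists_small α g hg hfin δ hδ := by
    -- Factor `g = z * h`: the norm of `z` can be made as small as desired while that of `h` stays
    -- below its norm `B` at `ρ₁`.
    obtain ⟨ρ₁, hρ₁, hρ₁'⟩ := exists_between α.ρ_lt_one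
    obtain ⟨c, hc, hdiv⟩ := exists_eq_gevreyVar_mul hk α.R_pos α.η_pos α.ρ_pos hρ₁ hρ₁'
    obtain ⟨h, rfl, hh⟩ := hdiv g hg hfin
    set B := gevreyNorm k α.R α.η ρ₁ (h : SectorGerm k) with hB
    have hBfin : B ≠ ∞ := ne_top_of_le_ne_top (ENNReal.mul_ne_top hc hfin) hh
    obtain ⟨δ', hδ', hlt⟩ : ∃ δ' : ℝ≥0∞, δ' ≠ 0 ∧ δ' * B < δ := by
      rcases eq_or_ne B 0 with h0 | h0
      · exact ⟨1, one_ne_zero, by rw [h0, mul_zero]; exact hδ.bot_lt⟩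
      · obtain ⟨δ₁, h1, h2⟩ := exists_between hδ.bot_lt
        exact ⟨δ₁ / B, (ENNReal.div_pos h1.ne' hBfin).ne', by rwa [ENNReal.div_mul_cancel h0 hBfin]⟩
    obtain ⟨R', ρ', hR', hR'le, hρle, hρ'0, hρ', hz⟩ :=
      exists_gevreyNorm_id_lt (k := k) (by linarith) α.R_pos hρ₁' hδ'
    refine ⟨⟨R', ρ', α.η, hR', hρ'0, hρ', α.η_pos⟩, fun y =>
      gevreyNorm_mono _ hR'le le_rfl α.ρ_pos (hρ₁.le.trans hρle), ?_⟩
    refine lt_of_le_of_lt ((gevreyNorm_mul_le' hR' α.η_pos hρ'0 hρ' _ h).trans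
      (mul_le_mul' (hz α.η).le ?_)) hlt
    exact gevreyNorm_mono _ hR'le le_rfl (α.ρ_pos.trans hρ₁) hρle

end gevreyFamily

/-! ### Convergent power series over a ring with a uniformizer -/

namespace NormFamily

variable {R I σ : Type} [CommRing R] [Fintype σ]

/-- A nonzerodivisor `x` that generates the kernel of the value, with norm estimates for the
division by `x`, and such that `⋂ (x ^ N)` contains no nonzero element of finite norm. -/
structure IsUniformizer (F : NormFamily R I) (x : R) : Prop where
  mem_fin : x ∈ F.fin
  value_eq_zero : F.value x = 0
  eq_zero_of_mul : ∀ h, x * h = 0 → h = 0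
  exists_eq_mul : ∀ i, ∃ (j : I) (c : ℝ≥0∞), c ≠ ∞ ∧ ∀ g, F.value g = 0 → F.norm i g ≠ ∞ →
    ∃ h, g = x * h ∧ F.norm j h ≤ c * F.norm i g
  eq_zero_of_forall_pow_dvd : ∀ g ∈ F.fin, (∀ N : ℕ, x ^ N ∣ g) → g = 0

variable (F : NormFamily R I) (s : Finset σ)

lemma map_value_mem_conv {f : MvPowerSeries σ R} (hf : f ∈ F.conv s) :
    MvPowerSeries.map F.value f ∈ complex.conv s := by
  obtain ⟨i, μ, hμ, h⟩ := mem_conv.1 hf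
  exact mem_conv.2 ⟨(), μ, hμ, ne_top_of_le_ne_top h (ENNReal.tsum_le_tsum fun ω =>
    mul_le_mul' (F.enorm_value_le i _) le_rfl)⟩

lemma map_const_mem_conv {f : MvPowerSeries σ ℂ} (hf : f ∈ complex.conv s) :
    MvPowerSeries.map F.const f ∈ F.conv s := by
  obtain ⟨_, μ, hμ, h⟩ := mem_conv.1 hf
  exact mem_conv.2 ⟨F.nonempty.some, μ, hμ, ne_top_of_le_ne_top h (ENNReal.tsum_le_tsum fun ω =>
    mul_le_mul' (F.norm_const_le _ _) le_rfl)⟩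

/-- Taking the values of the coefficients. -/
noncomputable def reduction : F.conv s →+* complex.conv s :=
  ((MvPowerSeries.map F.value).comp (F.conv s).subtype).codRestrict _
    fun f => F.map_value_mem_conv s f.2

variable {F s}

lemma reduction_surjective : Function.Surjective (F.reduction s) := fun g =>
  ⟨⟨MvPowerSeries.map F.const g, F.map_const_mem_conv s g.2⟩,
    Subtype.ext (MvPowerSeries.ext fun _ => F.value_const _)⟩

lemma exists_value_coeff_ne_zero {f : F.conv s} (hf : F.reduction s f ≠ 0) :
    ∃ ω, F.value (MvPowerSeries.coeff ω (f : MvPowerSeries σ R)) ≠ 0 :=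
  exists_coeff_ne_zero hf

namespace IsUniformizer

variable {x : R} (hx : F.IsUniformizer x)

/-- The uniformizer as a constant power series. -/
noncomputable def toConv (s : Finset σ) : F.conv s := ⟨MvPowerSeries.C x, C_mem_conv hx.mem_fin⟩

lemma coe_toConv_mul (h : F.conv s) (ω : σ →₀ ℕ) :
    MvPowerSeries.coeff ω ((hx.toConv s * h : F.conv s) : MvPowerSeries σ R) =
      x * MvPowerSeries.coeff ω (h : MvPowerSeries σ R) :=
  MvPowerSeries.coeff_C_mul _ _ _

lemma eq_zero_of_toConv_mul {h : F.conv s} (hh : hx.toConv s * h = 0) : h = 0 := by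
  refine Subtype.ext (MvPowerSeries.ext fun ω => hx.eq_zero_of_mul _ ?_)
  rw [← hx.coe_toConv_mul, hh]
  rfl

lemma eq_zero_of_toConv_pow_mul {h : F.conv s} (N : ℕ) (hh : hx.toConv s ^ N * h = 0) : h = 0 := by
  induction N with
  | zero => simpa using hh
  | succ N ih =>
    rw [pow_succ', mul_assoc] at hh
    exact ih (hx.eq_zero_of_toConv_mul hh)

lemma toConv_ne_zero : hx.toConv s ≠ 0 := fun h =>
  one_ne_zero (hx.eq_zero_of_toConv_mul (s := s) (h := 1) (by rw [mul_one, h]))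

lemma reduction_toConv : F.reduction s (hx.toConv s) = 0 := by
  refine Subtype.ext ?_
  change MvPowerSeries.map F.value (MvPowerSeries.C x) = 0
  rw [MvPowerSeries.map_C, hx.value_eq_zero, map_zero]

/-- Divide each coefficient by `x`. One index `j` and one constant `c` serve all coefficients, so
the quotient series converges on the same polyradius. -/
lemma toConv_dvd {f : F.conv s} (hf : F.reduction s f = 0) : hx.toConv s ∣ f := by
  obtain ⟨i, μ, hμ, hfin⟩ := mem_conv.1 f.2
  obtain ⟨j, c, hc, hdiv⟩ := hx.exists_eq_mul i
  have h0 : ∀ ω, F.value (MvPowerSeries.coeff ω (f : MvPowerSeries σ R)) = 0 := fun ω =>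
    congrArg (MvPowerSeries.coeff ω) (congrArg Subtype.val hf)
  choose h hh hle using fun ω => hdiv _ (h0 ω) (norm_coeff_ne_top (fun b => (hμ b).1) hfin ω)
  have hmem : (h : MvPowerSeries σ R) ∈ F.conv s := by
    refine mem_conv.2 ⟨j, μ, hμ, ne_top_of_le_ne_top (ENNReal.mul_ne_top hc hfin) ?_⟩
    unfold seriesNorm
    rw [← ENNReal.tsum_mul_left]
    refine ENNReal.tsum_le_tsum fun ω => ?_
    rw [← mul_assoc]
    exact mul_le_mul' (hle ω) le_rfl
  refine ⟨⟨h, hmem⟩, Subtype.ext (MvPowerSeries.ext fun ω => ?_)⟩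
  rw [hx.coe_toConv_mul]
  exact hh ω

lemma ker_reduction : RingHom.ker (F.reduction s) = Ideal.span {hx.toConv s} := by
  refine le_antisymm (fun f hf => Ideal.mem_span_singleton.2 (hx.toConv_dvd hf)) ?_
  rw [Ideal.span_singleton_le_iff_mem]
  exact hx.reduction_toConv

/-- Otherwise `x` could be split off indefinitely, and every coefficient of `f` would be divisible
by all powers of `x`, hence zero. -/
lemma exists_eq_toConv_pow_mul {f : F.conv s} (hf : f ≠ 0) :
    ∃ (N : ℕ) (g : F.conv s), f = hx.toConv s ^ N * g ∧ F.reduction s g ≠ 0 := by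
  by_contra! hcon
  have key : ∀ N : ℕ, hx.toConv s ^ N ∣ f := by
    intro N
    induction N with
    | zero => simp
    | succ N ih =>
      obtain ⟨g, hg⟩ := ih
      rw [hg, pow_succ]
      exact mul_dvd_mul_left _ (hx.toConv_dvd (hcon N g hg))
  refine hf (Subtype.ext (MvPowerSeries.ext fun ω =>
    hx.eq_zero_of_forall_pow_dvd _ (coeff_mem_fin f.2 ω) fun N => ?_))
  obtain ⟨g, rfl⟩ := key N
  refine ⟨MvPowerSeries.coeff ω (g : MvPowerSeries σ R), ?_⟩
  rw [Subring.coe_mul, Subring.coe_pow, toConv, ← map_pow, MvPowerSeries.coeff_C_mul]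

/-- Strip powers of `x` from both factors, cancel them in the product and reduce to the domain of
complex power series. -/
lemma isDomain_conv (hx : F.IsUniformizer x) (s : Finset σ) : IsDomain (F.conv s) := by
  have : NoZeroDivisors (F.conv s) := by
    refine ⟨fun {f g} hfg => ?_⟩
    by_contra! h
    obtain ⟨M, f', rfl, hf⟩ := hx.exists_eq_toConv_pow_mul h.1
    obtain ⟨N, g', rfl, hg⟩ := hx.exists_eq_toConv_pow_mul h.2
    rw [mul_mul_mul_comm, ← pow_add] at hfg
    refine mul_ne_zero hf hg ?_
    rw [← map_mul, hx.eq_zero_of_toConv_pow_mul _ hfg, map_zero]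
  exact NoZeroDivisors.to_isDomain _

variable [DecidableEq σ]

/-- The convergent power series over a ring with a uniformizer: the ring is noetherian and its
residue domains are finite over integrally closed noetherian domains. -/
theorem isNormalizable_conv (hx : F.IsUniformizer x) (s : Finset σ) : IsNormalizable (F.conv s) := by
  induction s using Finset.strongInduction with
  | H s ih =>
  have ih' := fun a (ha : a ∈ s) => ih _ (Finset.erase_ssubset ha)
  have hdom := hx.isDomain_conv s
  obtain ⟨hC, hCic⟩ := complex_isNormalizable s
  have hCn := hC.noetherian
  have hker : ∀ {P : Ideal (F.conv s)}, hx.toConv s ∈ P → RingHom.ker (F.reduction s) ≤ P :=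
    fun h => by rwa [hx.ker_reduction, Ideal.span_singleton_le_iff_mem]
  have hmem : ∀ {P : Ideal (F.conv s)}, P.IsPrime → P ≠ ⊥ → hx.toConv s ∉ P →
      ∃ f ∈ P, ∃ ω, F.value (MvPowerSeries.coeff ω (f : MvPowerSeries σ R)) ≠ 0 := by
    intro P hP hbot hxP
    obtain ⟨f, hfP, hf⟩ := P.ne_bot_iff.1 hbot
    obtain ⟨N, g, rfl, hg⟩ := hx.exists_eq_toConv_pow_mul hf
    exact ⟨g, (hP.mem_or_mem hfP).resolve_left fun h => hxP (hP.mem_of_pow_mem N h),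
      exists_value_coeff_ne_zero hg⟩
  have hnoeth : IsNoetherianRing (F.conv s) := by
    -- By Cohen's theorem prime ideals suffice. Primality is what allows the power of `x` to be
    -- removed from an element of `P` in `hmem`.
    refine IsNoetherianRing.of_prime fun P hP => ?_
    by_cases hbot : P = ⊥
    · rw [hbot]
      exact Submodule.fg_bot
    by_cases hxP : hx.toConv s ∈ P
    · refine Ideal.fg_of_surjective reduction_surjective ?_ (hker hxP)
      rw [hx.ker_reduction]
      exact Submodule.fg_span_singleton _
    · obtain ⟨f, hfP, hf⟩ := hmem hP hbot hxP
      exact fg_of_mem hf ih' hfP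
  -- The quotient by `x` is the ring of convergent complex power series, an integrally closed
  -- domain.
  have hic : IsIntegrallyClosed (F.conv s) := by
    have e : F.conv s ⧸ Ideal.span {hx.toConv s} ≃+* complex.conv s :=
      (Ideal.quotEquivOfEq hx.ker_reduction.symm).trans
        (RingHom.quotientKerEquivOfSurjective reduction_surjective)
    have hq : IsDomain (F.conv s ⧸ Ideal.span {hx.toConv s}) :=
      e.toMulEquiv.isDomain (complex.conv s)
    exact isIntegrallyClosed_of_quotient_span_prime (x := hx.toConv s)
      ((Ideal.span_singleton_prime hx.toConv_ne_zero).1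
        ((Ideal.Quotient.isDomain_iff_prime _).1 hq)) (IsIntegrallyClosed.of_equiv e.symm)
  refine ⟨hnoeth, fun P hP => ?_⟩
  by_cases hbot : P = ⊥
  · subst hbot
    exact HasNormalization.bot
  by_cases hxP : hx.toConv s ∈ P
  · exact HasNormalization.of_surjective hC reduction_surjective hP (hker hxP)
  · obtain ⟨f, hfP, hf⟩ := hmem hP hbot hxP
    exact hasNormalization_of_mem hf ih' hP hfP

end IsUniformizer

end NormFamily

/-! ### Application to the ring of Gevrey-analytic functions -/

lemma isUniformizer_gevreyVar (k : ℝ) (hk : 1 / 2 < k) :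
    (gevreyFamily k hk).IsUniformizer (gevreyVar k hk) where
  mem_fin := by
    obtain ⟨R, ρ, hR, -, -, hρ0, hρ, h⟩ := exists_gevreyNorm_id_lt (k := k) (by linarith)
      one_pos (by norm_num : (1 / 2 : ℝ) < 1) (δ := ∞) ENNReal.top_ne_zero
    exact ⟨⟨R, ρ, 1, hR, hρ0, hρ, one_pos⟩, (h 1).ne⟩
  value_eq_zero := gevreyValue_gevreyVar hk
  eq_zero_of_mul h hh := by
    have h1 := congrArg (fun g => g * invVar k) (congrArg Subtype.val hh)
    change (gevreyVar k hk : SectorGerm k) * (h : SectorGerm k) * invVar k = 0 * invVar k at h1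
    rw [mul_right_comm, gevreyVar_mul_invVar, one_mul, zero_mul] at h1
    exact Subtype.ext h1
  exists_eq_mul α := by
    obtain ⟨ρ', h1, h2⟩ := exists_between α.ρ_lt_one
    obtain ⟨c, hc, hdiv⟩ := exists_eq_gevreyVar_mul hk α.R_pos α.η_pos α.ρ_pos h1 h2
    exact ⟨⟨α.R, ρ', α.η, α.R_pos, α.ρ_pos.trans h1, h2, α.η_pos⟩, c, hc, hdiv⟩
  eq_zero_of_forall_pow_dvd := fun _ ⟨α, hα⟩ =>
    eq_zero_of_forall_gevreyVar_pow_dvd α.R_pos α.η_pos α.ρ_pos α.ρ_lt_one hα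

lemma NormFamily.weight_const {σ : Type} [Fintype σ] (c : ℝ≥0∞) (ω : σ →₀ ℕ) :
    weight (fun _ => c) ω = c ^ ω.degree := by
  rw [weight, Finset.prod_pow_eq_pow_sum, Finsupp.degree_eq_sum]

lemma gevreyAnalyticNorm_eq {k : ℝ} {hk : 1 / 2 < k} {n : ℕ} (α : GevreyIndex) (μ : ℝ)
    (f : MvPowerSeries (Fin n) (gevreyRing k hk)) : gevreyAnalyticNorm α.R α.η α.ρ μ f =
      (gevreyFamily k hk).seriesNorm α (fun _ => ENNReal.ofReal μ) f := by
  simp_rw [gevreyAnalyticNorm, NormFamily.seriesNorm, NormFamily.weight_const]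
  rfl

/-- One radius for all variables suffices: a polyradius may be shrunk to a positive lower bound of
its entries. -/
lemma gevreyAnalytic_eq_conv (k : ℝ) (hk : 1 / 2 < k) (n : ℕ) :
    gevreyAnalytic k hk n = (gevreyFamily k hk).conv (Finset.univ : Finset (Fin n)) := by
  ext f
  rw [NormFamily.mem_conv]
  constructor
  · rintro ⟨R, ρ, η, μ, hR, hρ0, hρ, hη, hμ, hf⟩
    refine ⟨⟨R, ρ, η, hR, hρ0, hρ, hη⟩, fun _ => ENNReal.ofReal μ, fun b => by simpa using hμ, ?_⟩
    rwa [← gevreyAnalyticNorm_eq]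
  · rintro ⟨α, μ, hμ, hf⟩
    obtain ⟨δ, hδ0, hδ⟩ : ∃ δ : ℝ, 0 < δ ∧ ∀ b, ENNReal.ofReal δ ≤ μ b := by
      -- The minimum with `1` covers `n = 0`, where the infimum over no variables is `∞`.
      have h0 : (0 : ℝ≥0∞) < min 1 (Finset.univ.inf μ) := by
        refine lt_min one_pos ((Finset.lt_inf_iff ENNReal.zero_lt_top).2 fun b _ => (hμ b).1.bot_lt)
      have h1 : min 1 (Finset.univ.inf μ) ≠ ∞ :=
        ne_top_of_le_ne_top ENNReal.one_ne_top (min_le_left _ _)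
      refine ⟨_, ENNReal.toReal_pos h0.ne' h1, fun b => ?_⟩
      rw [ENNReal.ofReal_toReal h1]
      exact (min_le_right _ _).trans (Finset.inf_le (Finset.mem_univ b))
    refine ⟨α.R, α.ρ, α.η, δ, α.R_pos, α.ρ_pos, α.ρ_lt_one, α.η_pos, hδ0, ?_⟩
    rw [gevreyAnalyticNorm_eq]
    exact ne_top_of_le_ne_top hf (NormFamily.seriesNorm_mono _ (fun _ => le_rfl) hδ f)

theorem mainTheorem6 (k : ℝ) (hk : 1 / 2 < k) (n : ℕ) :
    IsPseudoGeometric (gevreyAnalytic k hk n) := by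
  rw [gevreyAnalytic_eq_conv]
  exact ((isUniformizer_gevreyVar k hk).isNormalizable_conv Finset.univ).isPseudoGeometric
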